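/- **Setting.** Let $L/K$ be a finite separable field extension, $n=[L:K]$, $\Gamma$ an archimedean ordered $\mathbb Q$-divisible abelian group, $\nu:K^*\to\Gamma$ a non-trivial valuation (so $\nu$ has rank one), and $\nu':L^*\to\Gamma$ a valuation extending $\nu$ ($\nu'(0)=\infty$). Let $L=K[x]$, let $f=\sum_{i=0}^n a_iX^i$ be the (monic) minimal polynomial of $x$ over $K$, and assume $\nu(a_i)>0$ for $i<n$. Let $p=1$ if $\operatorname{char}K=0$ and $p=\operatorname{char}K$ otherwise. For $h\in K[X]$ write $\nu'(h)=\nu'(h(x))$. Let $G_{\nu'}=\bigoplus_{\beta\in\Gamma}\{\nu'\ge\beta\}/\{\nu'>\beta\}$, write $\mathrm{in}\,y\in G_{\nu'}$ for the initial form of $y\in L$ (and $\mathrm{in}\,h=\mathrm{in}\,h(x)$ for $h\in K[X]$), and let $G_\nu\subset G_{\nu'}$ be the subalgebra of sums of the $\mathrm{in}\,a$, $a\in K$. For a graded subalgebra $A\subset G_{\nu'}$, $A^*$ is the algebra of fractions $g/h$ with $g,h\in A$, $h\neq0$ homogeneous. *Newton polygons.* For $P\in K[X]$ monic of positive degree and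 $h\in K[X]$ write $h=\sum_j d_jP^j$ with $\deg d_j<\deg P$. For $b\in\Gamma$ let $S(h,P,b)$ be the set of $j$ at which $\nu'(d_j)+jb$ is minimal and $\mathrm{in}_{P,b}h=\sum_{j\in S(h,P,b)}\mathrm{in}(d_j)\bar X^j$. For a key polynomial $Q_l$ (below) put $\beta_l=\nu'(Q_l)$, $\nu_l(h)=\min_j(\nu'(d_j)+j\beta_l)$ with $P=Q_l$, $\mathrm{in}_lh=\mathrm{in}_{Q_l,\beta_l}h$, $\delta_l(h)=\max S(h,Q_l,\beta_l)$ and $\nu_l^+(h)=\min_{j>\delta_l(h)}(\nu'(d_j)+j\beta_l)$ ($=\infty$ if all these $d_j$ vanish). *Standard expansions.* Key polynomials $Q_i\in K[X]$ and integers $\alpha_i\ge1$ are indexed by ordinals $i\ge1$. Given those with $i\le l$, an index $i<l$ is $l$-essential if for some integer $t>0$ either $i+t=l$, or $i+t<l$ and $\alpha_{i+t}>1$; put $i_+=i+1$ if $i$ is $l$-essential and $i_+=i+\omega$ otherwise. An $l$-standard monomial is $c\prod_{i\le l}Q_i^{\gamma_i}$ with $c\in K$, finitely many $\gamma_i\ne0$,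 $\gamma_i<\alpha_{i_+}$ for $i<l$, $\sum_i\gamma_i\deg Q_i\le n$, and, for each $l$-inessential $i$, at most one $j<i_+$ with $j_+=i_+$ and $\gamma_j\ne0$. An $l$-standard expansion not involving $Q_l$ is a finite sum of $l$-standard monomials with $\gamma_l=0$ such that, for each $\beta$ that is the value of one of them, the initial forms of those of value $\beta$ have a non-zero sum; it is homogeneous if all its monomials have the same value. *Construction of key polynomials.* $Q_1=X$, $\alpha_1=1$. Suppose $Q_i,\alpha_i$ are defined for $i\le l$. If $Q_l(x)=0$, stop. Otherwise let $g$ be the minimal polynomial of $\mathrm{in}\,Q_l$ over $G_\nu[\mathrm{in}\,Q_i\,|\,i<l]^*$. Call $l$ *special* if $\deg g=1$ and $\mathrm{in}_lf=\mathrm{in}(a_\delta)\,g^\delta$, where $\delta=\delta_l(f)$ and $a_\delta$ is the coefficient of $Q_l^\delta$ in the $Q_l$-expansion of $f$. (a) If $l$ is not special (or $l=1$), one may take $\alpha_{l+1}=\deg g$ and for $Q_{l+1}$ any lifting $Q_l^{\alpha_{l+1}}+\sum_{j<\alpha_{l+1}}b_jQ_l^j$ of $g$: each $b_j$ is a (possibly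 zero) homogeneous $l$-standard expansion not involving $Q_l$, and the initial forms of its monomials add up to the $j$-th coefficient of $g$. If $l$ is special, let $T$ be the set of all $Q'=Q_l+z_0+\dots+z_{k-1}$ ($k\ge0$), with the $z_j$ homogeneous $l$-standard expansions not involving $Q_l$, $\beta_l=\nu'(z_0)<\dots<\nu'(z_{k-1})$, $\nu'(z_{k-1})<\beta(Q')$, and, with $P_j=Q_l+z_0+\dots+z_{j-1}$, $\mathrm{in}_{P_j,\beta(P_j)}f=\mathrm{in}(a_\delta(P_j))(\bar X+\mathrm{in}\,z_j)^\delta$ for $0\le j<k-1$. Here $a_\delta(P)$ is the coefficient of $P^\delta$ in the $P$-expansion of $f$, and $\beta(P)$ is the $b\in\Gamma$ with $\max S(f,P,b)=\delta$ and $\#S(f,P,b)\ge2$ (and $\beta(P)=\infty$ if the coefficients of $P^j$, $j<\delta$, all vanish). $T$ is ordered by extension of the sequence $(z_j)$. (b) $l$ special, $\operatorname{char}K=0$: let $f=\sum a_jQ_l^j$ be the $Q_l$-expansion and let $y\in K[X]$ with $\deg y<n$ represent $a_{\delta-1}(x)/(\delta a_\delta(x))$. Write $y=z_0+\dots+z_{m-1}+\phi+w$,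 $m>0$, with $z_j$ homogeneous $l$-standard expansions not involving $Q_l$, $\nu'(y)=\nu'(z_0)<\dots<\nu'(z_{m-1})<B$, $\phi$ a sum of $l$-standard monomials of value $\ge B$, and $w$ divisible by $Q_l+y$, where $B=\nu_l^+(f)-\nu_l(f)+\beta_l$ (any bound $B\in\Gamma\cup\{\infty\}$ if $\nu_l^+(f)=\infty$). Let $s\le m$ be maximal with $Q_l+z_0+\dots+z_{s-1}\in T$; put $Q_{l+i}=Q_l+z_0+\dots+z_{i-1}$ for $i\le s$ and $\alpha_{l+i}=1$ for $1\le i\le s$. Continue from $l+s$. (c) $l$ special, $\operatorname{char}K=p>0$, $T$ has a maximal element: choose one, $Q_l+z_0+\dots+z_{s-1}$, define $Q_{l+i},\alpha_{l+i}$ for $i\le s$ as in (b), and continue from $l+s$. (d) $l$ special, $\operatorname{char}K=p>0$, $T$ has no maximal element: choose an infinite sequence $(z_j)$ all of whose partial sums $Q_l+z_0+\dots+z_{t-1}$ lie in $T$ and whose values are cofinal in $\{\nu'(Q')\,|\,Q'\in T\}$; put $Q_{l+t}=Q_l+z_0+\dots+z_{t-1}$ for all $t\in\mathbb N$ and $\alpha_{l+t}=1$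 for $t\ge1$. If the $\beta_{l+t}$ are bounded in $\Gamma$, choose for $Q_{l+\omega}$ a polynomial which for some $i=l+t$ is monic of degree $p^{e_0}$ in $Q_i$, with $e_0>0$, is weakly affine (the coefficient of $Q_i^j$ vanishes unless $j=0$ or $j$ is a power of $p$), satisfies $\nu'(Q_{l+\omega})>p^{e_0}\beta_{l+t}$ for all $t$, and has $e_0$ least possible; put $\alpha_{l+\omega}=p^{e_0}$ and continue from $l+\omega$. **Theorem.** Suppose that the construction gives rise to an infinite sequence $\{Q_{l+t}\}_{t\in\mathbb N}$ of key polynomials, non-zero in $L$ (obtained at once as in (d), or by infinitely many successive steps), and that $\lim_{t\to\infty}\beta_{l+t}=\infty$. Then $\delta_{l+t}(f)$ is constant for all sufficiently large $t$, and its stable value $\delta$ is of the form $\delta=p^e$ for some $e\in\mathbb N$ (in particular $\delta=1$ if $\operatorname{char}K=0$). -/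

import Mathlib

open Polynomial

namespace KeyPoly

noncomputable section

/-! ### The graded algebra of a valuation

For a valuation `v` of a field `F` with values in `Γ`, the graded algebra
`G_v = ⨁_β P_β / P_{β+}` is realised as the quotient of the extended Rees ring
`⨁_β P_β T^β` (a subring of the group ring of `Γ` over `F`) by its ideal `⨁_β P_{β+} T^β`. -/

section Graded

variable {F Γ : Type*} [Field F] [AddCommGroup Γ] [LinearOrder Γ] [IsOrderedAddMonoid Γ]

/-- The extended Rees ring `⨁_β P_β T^β`, where `P_β = {y | β ≤ v y}`. -/
def rees (v : AddValuation F (WithTop Γ)) : Subring (AddMonoidAlgebra F Γ) where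
  carrier := {a | ∀ β : Γ, (β : WithTop Γ) ≤ v (a.coeff β)}
  mul_mem' := by
    intro a b ha hb β
    rw [AddMonoidAlgebra.coeff_mul]
    simp only [Finsupp.sum]
    refine AddValuation.map_le_sum v fun i _ => AddValuation.map_le_sum v fun j _ => ?_
    split_ifs with h
    · rw [AddValuation.map_mul, ← h, WithTop.coe_add]
      exact add_le_add (ha i) (hb j)
    · simp
  one_mem' := by
    intro β
    rw [AddMonoidAlgebra.one_def, AddMonoidAlgebra.coeff_single, Finsupp.single_apply]
    split_ifs with h
    · subst h; simp
    · simp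
  add_mem' := by
    intro a b ha hb β
    rw [AddMonoidAlgebra.coeff_add, Finsupp.add_apply]
    exact AddValuation.map_le_add v (ha β) (hb β)
  zero_mem' := by intro β; simp
  neg_mem' := by
    intro a ha β
    rw [AddMonoidAlgebra.coeff_neg, Finsupp.neg_apply, AddValuation.map_neg]
    exact ha β

/-- The ideal `⨁_β P_{β+} T^β`, where `P_{β+} = {y | β < v y}`. -/
def reesIdeal (v : AddValuation F (WithTop Γ)) : Ideal (rees v) where
  carrier := {a | ∀ β : Γ, (β : WithTop Γ) < v (a.1.coeff β)}
  add_mem' := by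
    intro a b ha hb β
    rw [Subring.coe_add, AddMonoidAlgebra.coeff_add, Finsupp.add_apply]
    exact AddValuation.map_lt_add v (ha β) (hb β)
  zero_mem' := by intro β; simp
  smul_mem' := by
    intro a b hb β
    rw [smul_eq_mul, Subring.coe_mul, AddMonoidAlgebra.coeff_mul]
    simp only [Finsupp.sum]
    refine AddValuation.map_lt_sum v (by simp) fun i _ =>
      AddValuation.map_lt_sum v (by simp) fun j _ => ?_
    split_ifs with h
    · rw [AddValuation.map_mul, ← h, WithTop.coe_add]
      exact WithTop.add_lt_add_of_le_of_lt (by simp) (a.2 i) (hb j)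
    · simp

/-- The graded algebra `G_v = ⨁_β P_β / P_{β+}`. -/
abbrev Gr (v : AddValuation F (WithTop Γ)) : Type _ := rees v ⧸ reesIdeal v

theorem single_mem_rees (v : AddValuation F (WithTop Γ)) {y : F} {β : Γ}
    (h : (β : WithTop Γ) ≤ v y) : AddMonoidAlgebra.single β y ∈ rees v := by
  intro γ
  rw [AddMonoidAlgebra.coeff_single, Finsupp.single_apply]
  split_ifs with h'
  · subst h'; exact h
  · simp

/-- The initial form `in_v y`: the class of `y` in `P_{v y} / P_{(v y)+}`, and `0` for `y = 0`. -/
def init (v : AddValuation F (WithTop Γ)) (y : F) : Gr v :=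
  if h : v y = ⊤ then 0 else
    Ideal.Quotient.mk (reesIdeal v)
      ⟨AddMonoidAlgebra.single ((v y).untop h) y,
        single_mem_rees v (le_of_eq (WithTop.coe_untop (v y) h))⟩

/-- The saturation of a graded subalgebra `A` of `G_v`: all fractions `g / h` with
`g, h ∈ A` and `h ≠ 0` homogeneous. (A non-zero homogeneous element of `G_v` is some `in_v y`
with `y ≠ 0`, and is invertible in `G_v`.) -/
def saturation (v : AddValuation F (WithTop Γ)) (A : Subring (Gr v)) : Set (Gr v) :=
  {g | ∃ y : F, y ≠ 0 ∧ init v y ∈ A ∧ init v y * g ∈ A}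

end Graded

/-- `g` is a minimal polynomial of `θ` over `A`: it is monic with coefficients in `A`, kills `θ`,
and no non-zero polynomial of smaller degree with coefficients in `A` kills `θ`. -/
def IsMinPoly {G : Type*} [CommRing G] (A : Set G) (θ : G) (g : G[X]) : Prop :=
  g.Monic ∧ (∀ j, g.coeff j ∈ A) ∧ g.eval θ = 0 ∧
    ∀ q : G[X], q ≠ 0 → (∀ j, q.coeff j ∈ A) → q.eval θ = 0 → g.natDegree ≤ q.natDegree

/-! ### Expansions in powers of one polynomial, and their Newton polygons

`v` is a valuation of `L` and a polynomial `h` over `K` has the value `v (h(x))`. -/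

section Newton

variable {K L Γ : Type*} [Field K] [Field L] [Algebra K L]
  [AddCommGroup Γ] [LinearOrder Γ] [IsOrderedAddMonoid Γ]

/-- The value `v (h(x))`. -/
def val (v : AddValuation L (WithTop Γ)) (x : L) (h : K[X]) : WithTop Γ := v (aeval x h)

/-- The initial form of `h(x)`. -/
def inx (v : AddValuation L (WithTop Γ)) (x : L) (h : K[X]) : Gr v := init v (aeval x h)

/-- For `P` monic of positive degree, the coefficient `d_j` in the unique expansion
`h = ∑ d_j P ^ j` with `deg d_j < deg P`. -/
def coeffAt (P h : K[X]) (j : ℕ) : K[X] := (h /ₘ P ^ j) %ₘ P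

/-- The value of the `j`-th term `d_j P ^ j` if `P` is given the value `b`. -/
def termVal (v : AddValuation L (WithTop Γ)) (x : L) (P h : K[X]) (b : WithTop Γ) (j : ℕ) :
    WithTop Γ :=
  val v x (coeffAt P h j) + j • b

open Classical in
/-- The set `S(h, b)` of the indices `j` for which `v(d_j) + j b` is minimal. -/
def sideSet (v : AddValuation L (WithTop Γ)) (x : L) (P h : K[X]) (b : WithTop Γ) : Finset ℕ :=
  (Finset.range (h.natDegree + 1)).filter fun j =>
    ∀ k : ℕ, termVal v x P h b j ≤ termVal v x P h b k

/-- The initial form `∑_{j ∈ S(h, b)} in_v(d_j) X ^ j` of `h`. -/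
def initForm (v : AddValuation L (WithTop Γ)) (x : L) (P h : K[X]) (b : WithTop Γ) : (Gr v)[X] :=
  ∑ j ∈ sideSet v x P h b, C (inx v x (coeffAt P h j)) * X ^ j

/-- `δ(h) = max S(h, b)` with `b = v(P(x))`, the degree of the initial form of `h`. -/
def delta (v : AddValuation L (WithTop Γ)) (x : L) (P h : K[X]) : ℕ :=
  (sideSet v x P h (val v x P)).sup id

/-- `min_j (v(d_j) + j v(P))`. -/
def truncVal (v : AddValuation L (WithTop Γ)) (x : L) (P h : K[X]) : WithTop Γ :=
  (Finset.range (h.natDegree + 1)).inf (termVal v x P h (val v x P))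

/-- `min_{j > δ(h)} (v(d_j) + j v(P))`, equal to `⊤` if there is no such term. -/
def truncValPlus (v : AddValuation L (WithTop Γ)) (x : L) (P h : K[X]) : WithTop Γ :=
  ((Finset.range (h.natDegree + 1)).filter (fun j => delta v x P h < j)).inf
    (termVal v x P h (val v x P))

/-- `b` determines the side of the Newton polygon of `h` with respect to `P` whose upper endpoint
is the vertex of ordinate `δ`; `b = ⊤` if there is no point of smaller ordinate. -/
def IsCharSlope (v : AddValuation L (WithTop Γ)) (x : L) (P h : K[X]) (δ : ℕ)
    (b : WithTop Γ) : Prop :=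
  (b = ⊤ ∧ ∀ j < δ, coeffAt P h j = 0) ∨
  (b ≠ ⊤ ∧ δ ∈ sideSet v x P h b ∧ (∀ j ∈ sideSet v x P h b, j ≤ δ) ∧
    2 ≤ (sideSet v x P h b).card)

end Newton

/-! ### Key polynomials

The key polynomials `Q i` and the integers `α i` are indexed by ordinals `i ≥ 1`. All notions
below at an index `l` only depend on the `Q i`, `α i` with `i` at most the indices named there. -/

section Construction

variable {K L Γ : Type*} [Field K] [Field L] [Algebra K L]
  [AddCommGroup Γ] [LinearOrder Γ] [IsOrderedAddMonoid Γ]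

/-- The index `i < l` is `l`-essential. -/
def Essential (α : Ordinal.{0} → ℕ) (l i : Ordinal.{0}) : Prop :=
  ∃ t : ℕ, 0 < t ∧ (i + (t : Ordinal.{0}) = l ∨
    (i + (t : Ordinal.{0}) < l ∧ 1 < α (i + (t : Ordinal.{0}))))

open Classical in
/-- The index `i+` (relative to `l`). -/
def plus (α : Ordinal.{0} → ℕ) (l i : Ordinal.{0}) : Ordinal.{0} :=
  if Essential α l i then i + 1 else i + Ordinal.omega0

/-- The product `∏ Q_i ^ γ_i`. -/
def mono (Q : Ordinal.{0} → K[X]) (γ : Ordinal.{0} →₀ ℕ) : K[X] := γ.prod fun i e => Q i ^ e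

/-- Multiindices of `l`-standard monomials; `n = [L : K]`. (The degree of `Q_i` is the product of
the `α_j` with `j ≤ i`.) -/
def IsStdIndex (Q : Ordinal.{0} → K[X]) (α : Ordinal.{0} → ℕ) (n : ℕ) (l : Ordinal.{0})
    (γ : Ordinal.{0} →₀ ℕ) : Prop :=
  (∀ i ∈ γ.support, 1 ≤ i ∧ i ≤ l) ∧
  (∀ i, 1 ≤ i → i < l → γ i < α (plus α l i)) ∧
  (γ.sum fun i e => e * (Q i).natDegree) ≤ n ∧
  (∀ i, 1 ≤ i → i < l → ¬ Essential α l i →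
    {j | 1 ≤ j ∧ j < plus α l i ∧ plus α l j = plus α l i ∧ γ j ≠ 0}.Subsingleton)

/-- The polynomial `∑_γ c_γ ∏ Q_i ^ γ_i`. -/
def expansion (Q : Ordinal.{0} → K[X]) (c : (Ordinal.{0} →₀ ℕ) →₀ K) : K[X] :=
  c.sum fun γ a => C a * mono Q γ

/-- The value of the monomial `c_γ ∏ Q_i ^ γ_i`. -/
def monoVal (v : AddValuation L (WithTop Γ)) (x : L) (Q : Ordinal.{0} → K[X])
    (c : (Ordinal.{0} →₀ ℕ) →₀ K) (γ : Ordinal.{0} →₀ ℕ) : WithTop Γ :=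
  val v x (C (c γ) * mono Q γ)

open Classical in
/-- `∑_γ c_γ ∏ Q_i ^ γ_i` is an `l`-standard expansion not involving `Q_l`: all monomials are
`l`-standard and do not involve `Q_l`, and for each `β` which is the value of one of them the
initial forms of the monomials of value `β` have a non-zero sum. -/
def IsStdExpansion (v : AddValuation L (WithTop Γ)) (x : L) (Q : Ordinal.{0} → K[X])
    (α : Ordinal.{0} → ℕ) (l : Ordinal.{0}) (c : (Ordinal.{0} →₀ ℕ) →₀ K) : Prop :=
  (∀ γ ∈ c.support, IsStdIndex Q α (Module.finrank K L) l γ ∧ γ l = 0) ∧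
  ∀ β : WithTop Γ, (∃ γ ∈ c.support, monoVal v x Q c γ = β) →
    ∑ γ ∈ c.support.filter (fun γ => monoVal v x Q c γ = β), inx v x (C (c γ) * mono Q γ) ≠ 0

/-- A homogeneous `l`-standard expansion not involving `Q_l`: all monomials have equal values. -/
def IsHomogExpansion (v : AddValuation L (WithTop Γ)) (x : L) (Q : Ordinal.{0} → K[X])
    (α : Ordinal.{0} → ℕ) (l : Ordinal.{0}) (c : (Ordinal.{0} →₀ ℕ) →₀ K) : Prop :=
  IsStdExpansion v x Q α l c ∧
  ∀ γ ∈ c.support, ∀ γ' ∈ c.support, monoVal v x Q c γ = monoVal v x Q c γ'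

/-- The subalgebra `G_ν[in Q_i, i < l]` of the graded algebra of `v`, where `ν` is the restriction
of `v` to `K`. -/
def grSub (v : AddValuation L (WithTop Γ)) (x : L) (Q : Ordinal.{0} → K[X])
    (l : Ordinal.{0}) : Subring (Gr v) :=
  Subring.closure
    (Set.range (fun a : K => init v (algebraMap K L a)) ∪
      {g | ∃ i, 1 ≤ i ∧ i < l ∧ g = inx v x (Q i)})

/-- `g` is the minimal polynomial of `in Q_l` over (the saturation of) `G_ν[in Q_i, i < l]`. -/
def IsInitMinPoly (v : AddValuation L (WithTop Γ)) (x : L) (Q : Ordinal.{0} → K[X])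
    (l : Ordinal.{0}) (g : (Gr v)[X]) : Prop :=
  IsMinPoly (saturation v (grSub v x Q l)) (inx v x (Q l)) g

/-- `Q (l + 1) = Q_l ^ α + ∑_{j < α} b_j Q_l ^ j`, with `α = α (l + 1)`, is a lifting of the
minimal polynomial of `in Q_l`: each `b_j` is a homogeneous `l`-standard expansion not involving
`Q_l` and the initial forms of its monomials add up to the corresponding coefficient. -/
def IsLifting (v : AddValuation L (WithTop Γ)) (x : L) (Q : Ordinal.{0} → K[X])
    (α : Ordinal.{0} → ℕ) (l : Ordinal.{0}) : Prop :=
  ∃ g : (Gr v)[X], IsInitMinPoly v x Q l g ∧ α (l + 1) = g.natDegree ∧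
    ∃ c : ℕ → (Ordinal.{0} →₀ ℕ) →₀ K,
      Q (l + 1) = Q l ^ α (l + 1) + ∑ j ∈ Finset.range (α (l + 1)), expansion Q (c j) * Q l ^ j ∧
      ∀ j < α (l + 1), IsHomogExpansion v x Q α l (c j) ∧
        ∑ γ ∈ (c j).support, inx v x (C (c j γ) * mono Q γ) = g.coeff j

/-- The special case `t = α_{l+1} = 1`: the minimal polynomial `g` of `in Q_l` is linear and is the
only monic irreducible factor of the initial form `in_l f` of the minimal polynomial `f` of `x`,
that is, `in_l f = in(a_δ) g ^ δ`. -/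
def IsSpecial (v : AddValuation L (WithTop Γ)) (x : L) (Q : Ordinal.{0} → K[X])
    (l : Ordinal.{0}) : Prop :=
  ∃ g : (Gr v)[X], IsInitMinPoly v x Q l g ∧ g.natDegree = 1 ∧
    initForm v x (Q l) (minpoly K x) (val v x (Q l)) =
      C (inx v x (coeffAt (Q l) (minpoly K x) (delta v x (Q l) (minpoly K x)))) *
        g ^ delta v x (Q l) (minpoly K x)

/-- `Q_l + z_0 + ⋯ + z_{k-1}`. -/
def partialSum (Q : Ordinal.{0} → K[X]) (l : Ordinal.{0}) (z : ℕ → K[X]) (k : ℕ) : K[X] :=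
  Q l + ∑ j ∈ Finset.range k, z j

/-- `Q_l + z_0 + ⋯ + z_{k-1}` (together with the sequence `z_0, …, z_{k-1}`) belongs to the set `T`
attached to `l`; here `δ = δ_l(f)`. -/
def InT (v : AddValuation L (WithTop Γ)) (x : L) (Q : Ordinal.{0} → K[X])
    (α : Ordinal.{0} → ℕ) (l : Ordinal.{0}) (z : ℕ → K[X]) (k : ℕ) : Prop :=
  let f := minpoly K x
  let δ := delta v x (Q l) f
  let P := partialSum Q l z
  (∀ j < k, ∃ c, IsHomogExpansion v x Q α l c ∧ z j = expansion Q c) ∧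
  (0 < k → val v x (z 0) = val v x (Q l)) ∧
  (∀ j, j + 1 < k → val v x (z j) < val v x (z (j + 1))) ∧
  (∀ j, j + 1 = k → ∃ b, IsCharSlope v x (P k) f δ b ∧ val v x (z j) < b) ∧
  (∀ j, j + 1 < k → ∃ b, IsCharSlope v x (P j) f δ b ∧
    initForm v x (P j) f b =
      C (inx v x (coeffAt (P j) f δ)) * (X + C (inx v x (z j))) ^ δ)

/-- `Q_l + z_0 + ⋯ + z_{k-1}` is a maximal element of `T`, ordered by extension. -/
def IsMaxT (v : AddValuation L (WithTop Γ)) (x : L) (Q : Ordinal.{0} → K[X])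
    (α : Ordinal.{0} → ℕ) (l : Ordinal.{0}) (z : ℕ → K[X]) (k : ℕ) : Prop :=
  InT v x Q α l z k ∧
    ∀ z' : ℕ → K[X], (∀ j < k, z' j = z j) → ¬ InT v x Q α l z' (k + 1)

/-- `Q_{l+i} = Q_l + z_0 + ⋯ + z_{i-1}` and `α_{l+i} = 1` for the index `i > 0`. -/
def Follows (Q : Ordinal.{0} → K[X]) (α : Ordinal.{0} → ℕ) (l : Ordinal.{0}) (z : ℕ → K[X])
    (i : ℕ) : Prop :=
  Q (l + (i : Ordinal.{0})) = partialSum Q l z i ∧ (0 < i → α (l + (i : Ordinal.{0})) = 1)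

/-- The choice of `Q_{l+1}, …, Q_{l+s}` in the special case in characteristic `0`. With
`f = ∑ a_j Q_l ^ j` and `δ = δ_l(f)`, the representative `y` of degree `< n` of
`a_{δ-1} / (δ a_δ)` is written `y = z_0 + ⋯ + z_{m-1} + φ + w`, where the `z_i` are homogeneous
`l`-standard expansions not involving `Q_l` of increasing values less than
`B = ν_l⁺(f) - ν_l(f) + β_l`, `φ` is a sum of `l`-standard monomials of values at least `B`, and
`w` is divisible by `Q_l + y`. If `ν_l⁺(f) = ∞`, any bound `B` may be used. -/
def CharZeroBatch (v : AddValuation L (WithTop Γ)) (x : L) (Q : Ordinal.{0} → K[X])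
    (α : Ordinal.{0} → ℕ) (l : Ordinal.{0}) (s : ℕ) : Prop :=
  let f := minpoly K x
  let δ := delta v x (Q l) f
  ∃ (y w : K[X]) (φ : (Ordinal.{0} →₀ ℕ) →₀ K) (z : ℕ → K[X]) (m : ℕ) (B : WithTop Γ),
    y.degree < (Module.finrank K L : WithBot ℕ) ∧
    aeval x y = aeval x (coeffAt (Q l) f (δ - 1)) / (δ * aeval x (coeffAt (Q l) f δ)) ∧
    (truncValPlus v x (Q l) f ≠ ⊤ →
      B + truncVal v x (Q l) f = truncValPlus v x (Q l) f + val v x (Q l)) ∧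
    0 < m ∧
    y = (∑ j ∈ Finset.range m, z j) + expansion Q φ + w ∧
    (∀ j < m, ∃ c, IsHomogExpansion v x Q α l c ∧ z j = expansion Q c) ∧
    val v x y = val v x (z 0) ∧
    (∀ j, j + 1 < m → val v x (z j) < val v x (z (j + 1))) ∧
    (∀ j < m, val v x (z j) < B) ∧
    (∀ γ ∈ φ.support, IsStdIndex Q α (Module.finrank K L) l γ ∧ B ≤ monoVal v x Q φ γ) ∧
    Q l + y ∣ w ∧
    IsGreatest {i : ℕ | i ≤ m ∧ InT v x Q α l z i} s ∧
    ∀ i ≤ s, Follows Q α l z i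

/-- The choice of `Q_{l+1}, …, Q_{l+s}` in the special case in positive characteristic, if `T` has
a maximal element. -/
def CaseOne (v : AddValuation L (WithTop Γ)) (x : L) (Q : Ordinal.{0} → K[X])
    (α : Ordinal.{0} → ℕ) (l : Ordinal.{0}) (s : ℕ) : Prop :=
  ∃ z : ℕ → K[X], IsMaxT v x Q α l z s ∧ ∀ i ≤ s, Follows Q α l z i

/-- The choice of the infinite sequence `Q_{l+1}, Q_{l+2}, …` in the special case in positive
characteristic, if `T` has no maximal element: all `Q_{l+t}` belong to `T` and their values
are cofinal among the values of the elements of `T`. -/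
def CaseTwo (v : AddValuation L (WithTop Γ)) (x : L) (Q : Ordinal.{0} → K[X])
    (α : Ordinal.{0} → ℕ) (l : Ordinal.{0}) : Prop :=
  (∀ z k, ¬ IsMaxT v x Q α l z k) ∧
  ∃ z : ℕ → K[X], (∀ t, InT v x Q α l z t) ∧
    (∀ z' k, InT v x Q α l z' k →
      ∃ t, val v x (partialSum Q l z' k) ≤ val v x (partialSum Q l z t)) ∧
    ∀ t, Follows Q α l z t

/-- `P` is a weakly affine expansion, monic of degree `p ^ e`, in powers of `R`. -/
def IsWeaklyAffine (R : K[X]) (e : ℕ) (P : K[X]) : Prop :=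
  coeffAt R P (ringExpChar K ^ e) = 1 ∧
  (∀ j, ringExpChar K ^ e < j → coeffAt R P j = 0) ∧
  ∀ j, 0 < j → coeffAt R P j ≠ 0 → ∃ k : ℕ, j = ringExpChar K ^ k

/-- `P` is, for some `i = l + t`, a weakly affine expansion, monic of degree `p ^ e`, in `Q_i`,
and `v(P(x)) > p ^ e β_{l+s}` for all `s`. -/
def IsLimitCandidate (v : AddValuation L (WithTop Γ)) (x : L) (Q : Ordinal.{0} → K[X])
    (l : Ordinal.{0}) (e : ℕ) (P : K[X]) : Prop :=
  (∃ t : ℕ, IsWeaklyAffine (Q (l + (t : Ordinal.{0}))) e P) ∧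
  ∀ s : ℕ, ringExpChar K ^ e • val v x (Q (l + (s : Ordinal.{0}))) < val v x P

/-- `Q_{l+ω}` is a limit key polynomial: a candidate with the least possible `e`, and `e > 0`. -/
def IsLimitKey (v : AddValuation L (WithTop Γ)) (x : L) (Q : Ordinal.{0} → K[X])
    (α : Ordinal.{0} → ℕ) (l : Ordinal.{0}) : Prop :=
  ∃ e : ℕ, 0 < e ∧ α (l + Ordinal.omega0) = ringExpChar K ^ e ∧
    IsLimitCandidate v x Q l e (Q (l + Ordinal.omega0)) ∧
    ∀ e' < e, ∀ P : K[X], ¬ IsLimitCandidate v x Q l e' P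

/-- One step of the construction: from the key polynomials `Q_i`, `i ≤ l`, with `Q_l ≠ 0` in `L`,
to the key polynomials `Q_i`, `i ≤ l'`. -/
def Step (v : AddValuation L (WithTop Γ)) (x : L) (Q : Ordinal.{0} → K[X])
    (α : Ordinal.{0} → ℕ) (l l' : Ordinal.{0}) : Prop :=
  aeval x (Q l) ≠ 0 ∧
  ( -- an arbitrary lifting (always allowed for the second key polynomial)
    (l' = l + 1 ∧ (l = 1 ∨ ¬ IsSpecial v x Q l) ∧ IsLifting v x Q α l) ∨
    -- the special case in characteristic zero
    (ringChar K = 0 ∧ IsSpecial v x Q l ∧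
      ∃ s : ℕ, l' = l + (s : Ordinal.{0}) ∧ CharZeroBatch v x Q α l s) ∨
    -- the special case in positive characteristic, `T` having a maximal element
    (ringChar K ≠ 0 ∧ IsSpecial v x Q l ∧
      ∃ s : ℕ, l' = l + (s : Ordinal.{0}) ∧ CaseOne v x Q α l s) ∨
    -- the special case in positive characteristic, `T` having no maximal element and the
    -- values being bounded
    (ringChar K ≠ 0 ∧ IsSpecial v x Q l ∧ l' = l + Ordinal.omega0 ∧ CaseTwo v x Q α l ∧
      (∃ γ : Γ, ∀ t : ℕ, val v x (Q (l + (t : Ordinal.{0}))) ≤ (γ : WithTop Γ)) ∧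
      IsLimitKey v x Q α l))

/-- The key polynomials `Q_i`, `1 ≤ i ≤ l`, are obtained from `Q_1 = X` by finitely many steps of
the construction. -/
def IsStage (v : AddValuation L (WithTop Γ)) (x : L) (Q : Ordinal.{0} → K[X])
    (α : Ordinal.{0} → ℕ) (l : Ordinal.{0}) : Prop :=
  Q 1 = X ∧ α 1 = 1 ∧ Relation.ReflTransGen (Step v x Q α) 1 l

/-- The construction gives rise to the infinite sequence `{Q_{l+t}}_{t ∈ ℕ}` of key polynomials,
none of them `0` in `L`. The sequence is a tail of one which is obtained, starting at some stage
`l₀`, either at once (special case, `T` without maximal element) or by infinitely many steps. -/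
def IsInfiniteSequence (v : AddValuation L (WithTop Γ)) (x : L) (Q : Ordinal.{0} → K[X])
    (α : Ordinal.{0} → ℕ) (l : Ordinal.{0}) : Prop :=
  ∃ l₀ : Ordinal.{0}, l₀ ≤ l ∧ l < l₀ + Ordinal.omega0 ∧ IsStage v x Q α l₀ ∧
    (∀ t : ℕ, aeval x (Q (l₀ + (t : Ordinal.{0}))) ≠ 0) ∧
    ((ringChar K ≠ 0 ∧ IsSpecial v x Q l₀ ∧ CaseTwo v x Q α l₀) ∨
      ∃ s : ℕ → ℕ, StrictMono s ∧ s 0 = 0 ∧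
        ∀ k, Step v x Q α (l₀ + (s k : Ordinal.{0})) (l₀ + (s (k + 1) : Ordinal.{0})))

end Construction

end

end KeyPoly

/-! Separability decides the matter: the stable value of δ is 1, so the exponent e is 0. Let P be a
late key polynomial of the sequence, β its value, and f = ∑ a_k P^k. Differentiating and evaluating
at x gives f'(x) = ∑ a_k' P^k + ∑ k a_k P^(k-1) P'. The value F of f'(x) is finite because x is
separable. If the values of the a_k, of their derivatives and of P' are bounded below independently
of P, then for large β every term except a_1 P' has value greater than F. Hence v(a_1 P') = F, so
v(a_1) is bounded above and the term of index 1 beats all terms of index k ≥ 2. As f(x) = 0, at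
least two terms of the expansion have the least value; these can only be those of index 0 and 1, and
δ = 1. This is `eventually_delta_eq_one`.

The work lies in the uniform bounds, for which three facts about the key polynomials are needed. (1)
Their degrees are eventually constant (`exists_degree_eq`). (2) Monic polynomials of degree < deg
Q_l have bounded values. This controls derivatives (`exists_ge_val_derivative`), and it also gives
deg Q_l ≤ deg f, since f is monic of value ∞. (3) In a product of two polynomials of degree < deg
Q_l the quotient by Q_l, the carry, loses less than the value of Q_l (`Carry`). Then expansions can
be multiplied, divided and rewritten in a nearby polynomial with control of values.

These facts, with the statement that polynomials of degree < deg Q_l have initial forms in G_ν[in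
Q_i | i < l], form `Invariant`, which is proved along the construction. For a lifting
(`Invariant.lifting`) the minimality of the polynomial of in Q_l shows that polynomials of smaller
degree than Q_{l+1} take the least value among the terms of their Q_l-expansions. For steps inside T
(`Invariant.add_natCast_of_inT`) only a polynomial of smaller degree and no smaller value is added.
For a limit key polynomial (`Invariant.add_omega0`) a Kaplansky-type analysis is needed: a
polynomial of least degree whose value is never read off an expansion is dominated by a term of
index p^e (`PseudoLimit.exists_pow`) and can be replaced by a weakly affine one
(`IsChain.exists_weaklyAffine`). The minimality of the exponent then makes all polynomials of degree
less than that of the limit key polynomial eventually fixed.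

Since Γ is archimedean, it embeds in ℝ, and all estimates are made for real values. -/

namespace KeyPoly

noncomputable section

/-! ### Expansions in powers of a monic polynomial P; their coefficients are called digits below. -/

section Expansions

variable {K : Type*} [Field K]

theorem coeffAt_zero_index (P h : K[X]) : coeffAt P h 0 = h %ₘ P := by
  simp [coeffAt]

theorem degree_coeffAt_lt {P : K[X]} (hP : P.Monic) (h : K[X]) (j : ℕ) :
    (coeffAt P h j).degree < P.degree :=
  degree_modByMonic_lt _ hP

theorem divByMonic_mul {P R : K[X]} (hP : P.Monic) (hR : R.Monic) (h : K[X]) :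
    h /ₘ (P * R) = (h /ₘ P) /ₘ R := by
  have e1 := modByMonic_add_div h P
  have e2 := modByMonic_add_div (h /ₘ P) R
  refine (div_modByMonic_unique ((h /ₘ P) /ₘ R) (h %ₘ P + P * ((h /ₘ P) %ₘ R)) (hP.mul hR)
    ⟨?_, ?_⟩).1
  · calc _ = h %ₘ P + P * ((h /ₘ P) %ₘ R + R * ((h /ₘ P) /ₘ R)) := by ring
      _ = h := by rw [e2, e1]
  · refine lt_of_le_of_lt (degree_add_le _ _) (max_lt ?_ ?_)
    · refine (degree_modByMonic_lt h hP).trans_le ?_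
      rw [degree_mul]
      exact le_add_of_nonneg_right (zero_le_degree_iff.2 hR.ne_zero)
    · rw [degree_mul, degree_mul]
      exact WithBot.add_lt_add_left (degree_ne_bot.2 hP.ne_zero) (degree_modByMonic_lt _ hR)

theorem coeffAt_succ {P : K[X]} (hP : P.Monic) (h : K[X]) (j : ℕ) :
    coeffAt P h (j + 1) = coeffAt P (h /ₘ P) j := by
  rw [coeffAt, coeffAt, pow_succ', divByMonic_mul hP (hP.pow j)]

theorem add_divByMonic' {P : K[X]} (hP : P.Monic) (h h' : K[X]) :
    (h + h') /ₘ P = h /ₘ P + h' /ₘ P := by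
  refine (div_modByMonic_unique _ (h %ₘ P + h' %ₘ P) hP ⟨?_, ?_⟩).1
  · calc _ = (h %ₘ P + P * (h /ₘ P)) + (h' %ₘ P + P * (h' /ₘ P)) := by ring
      _ = _ := by rw [modByMonic_add_div, modByMonic_add_div]
  · exact lt_of_le_of_lt (degree_add_le _ _)
      (max_lt (degree_modByMonic_lt _ hP) (degree_modByMonic_lt _ hP))

theorem coeffAt_add {P : K[X]} (hP : P.Monic) (h h' : K[X]) (j : ℕ) :
    coeffAt P (h + h') j = coeffAt P h j + coeffAt P h' j := by
  rw [coeffAt, add_divByMonic' (hP.pow j), add_modByMonic]; rfl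

/-- The `j`-th coefficient of the `P`-expansion, as an additive map. -/
def coeffAtHom {P : K[X]} (hP : P.Monic) (j : ℕ) : K[X] →+ K[X] :=
  AddMonoidHom.mk' (fun h => coeffAt P h j) fun h h' => coeffAt_add hP h h' j

theorem coeffAt_sum {P : K[X]} (hP : P.Monic) {ι : Type*} (s : Finset ι) (h : ι → K[X]) (j : ℕ) :
    coeffAt P (∑ i ∈ s, h i) j = ∑ i ∈ s, coeffAt P (h i) j :=
  map_sum (coeffAtHom hP j) h s

theorem coeffAt_zero {P : K[X]} (hP : P.Monic) (j : ℕ) : coeffAt P 0 j = 0 :=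
  map_zero (coeffAtHom hP j)

theorem coeffAt_neg {P : K[X]} (hP : P.Monic) (h : K[X]) (j : ℕ) :
    coeffAt P (-h) j = -coeffAt P h j :=
  map_neg (coeffAtHom hP j) h

theorem div_of_degree_lt {P : K[X]} (hP : P.Monic) {a : K[X]} (ha : a.degree < P.degree) :
    a /ₘ P = 0 := (divByMonic_eq_zero_iff hP).2 ha

theorem mod_of_degree_lt {P : K[X]} (hP : P.Monic) {a : K[X]} (ha : a.degree < P.degree) :
    a %ₘ P = a := (modByMonic_eq_self_iff hP).2 ha

theorem coeffAt_of_degree_lt {P : K[X]} (hP : P.Monic) {a : K[X]} (ha : a.degree < P.degree)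
    (j : ℕ) : coeffAt P a j = if j = 0 then a else 0 := by
  cases j with
  | zero => simp [coeffAt_zero_index, mod_of_degree_lt hP ha]
  | succ j => simp [coeffAt_succ hP, div_of_degree_lt hP ha, coeffAt_zero hP]

theorem coeffAt_mul_self_zero {P : K[X]} (hP : P.Monic) (h : K[X]) :
    coeffAt P (P * h) 0 = 0 := by
  rw [coeffAt_zero_index, self_mul_modByMonic hP]

theorem coeffAt_mul_self_succ {P : K[X]} (hP : P.Monic) (h : K[X]) (j : ℕ) :
    coeffAt P (P * h) (j + 1) = coeffAt P h j := by
  rw [coeffAt_succ hP, mul_divByMonic_cancel_left _ hP]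

theorem coeffAt_mul_pow {P : K[X]} (hP : P.Monic) {a : K[X]} (ha : a.degree < P.degree)
    (i j : ℕ) : coeffAt P (a * P ^ i) j = if j = i then a else 0 := by
  induction i generalizing j with
  | zero => simp [coeffAt_of_degree_lt hP ha]
  | succ i ih =>
    rw [show a * P ^ (i + 1) = P * (a * P ^ i) by ring]
    cases j with
    | zero => simp [coeffAt_mul_self_zero hP]
    | succ j => simp [coeffAt_mul_self_succ hP, ih]

theorem coeffAt_sum_mul_pow {P : K[X]} (hP : P.Monic) (s : Finset ℕ) (a : ℕ → K[X])
    (ha : ∀ i ∈ s, (a i).degree < P.degree) (j : ℕ) :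
    coeffAt P (∑ i ∈ s, a i * P ^ i) j = if j ∈ s then a j else 0 := by
  rw [coeffAt_sum hP, Finset.sum_congr rfl fun i hi => coeffAt_mul_pow hP (ha i hi) i j]
  simp

theorem natDegree_div {P : K[X]} (hP : P.Monic) (h : K[X]) :
    (h /ₘ P).natDegree = h.natDegree - P.natDegree := natDegree_divByMonic h hP

theorem coeffAt_eq_zero {P : K[X]} (hP : P.Monic) {h : K[X]} {j : ℕ}
    (hj : h.natDegree < j * P.natDegree) : coeffAt P h j = 0 := by
  rw [coeffAt, div_of_degree_lt (hP.pow j), zero_modByMonic]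
  by_cases h0 : h = 0
  · rw [h0, degree_zero, bot_lt_iff_ne_bot]
    exact degree_ne_bot.2 (hP.pow j).ne_zero
  · rw [degree_eq_natDegree h0, degree_eq_natDegree (hP.pow j).ne_zero, hP.natDegree_pow]
    exact_mod_cast hj

theorem eq_sum_coeffAt {P : K[X]} (hP : P.Monic) (h : K[X]) (M : ℕ)
    (hM : h.natDegree < M * P.natDegree) :
    h = ∑ j ∈ Finset.range M, coeffAt P h j * P ^ j := by
  induction M generalizing h with
  | zero => simp at hM
  | succ M ih =>
    rw [Finset.sum_range_succ']
    have e := modByMonic_add_div h P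
    simp only [coeffAt_succ hP, pow_zero, mul_one, coeffAt_zero_index]
    have key : h /ₘ P = ∑ j ∈ Finset.range M, coeffAt P (h /ₘ P) j * P ^ j := by
      rcases Nat.eq_zero_or_pos M with h0 | h0
      · subst h0
        simp only [Finset.range_zero, Finset.sum_empty]
        apply div_of_degree_lt hP
        by_cases hh : h = 0
        · rw [hh, degree_zero, bot_lt_iff_ne_bot]
          exact degree_ne_bot.2 hP.ne_zero
        · rw [degree_eq_natDegree hh, degree_eq_natDegree hP.ne_zero]
          exact_mod_cast (by simpa using hM)
      · apply ih
        rw [natDegree_div hP]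
        have : 0 < M * P.natDegree := by
          rcases Nat.eq_zero_or_pos P.natDegree with hz | hz
          · rw [hz] at hM; omega
          · positivity
        rw [add_mul, one_mul] at hM
        omega
    conv_lhs => rw [← e, key]
    rw [Finset.mul_sum, add_comm]
    congr 1
    exact Finset.sum_congr rfl fun j _ => by ring

/-- Since deg(ab) < 2 deg P, the carry of a product of two digits is again a single digit. -/
theorem degree_mul_div_lt {P a b : K[X]} (hP : P.Monic) (ha : a.degree < P.degree)
    (hb : b.degree < P.degree) : ((a * b) /ₘ P).degree < P.degree := by
  by_cases ha0 : a = 0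
  · rw [ha0, zero_mul, zero_divByMonic]; rwa [ha0] at ha
  by_cases hb0 : b = 0
  · rw [hb0, mul_zero, zero_divByMonic]; rwa [hb0] at hb
  by_cases hq : (a * b) /ₘ P = 0
  · rw [hq]; exact lt_of_le_of_lt bot_le ha
  have h1 := natDegree_div hP (a * b)
  rw [natDegree_mul ha0 hb0] at h1
  have := natDegree_lt_natDegree ha0 ha
  have := natDegree_lt_natDegree hb0 hb
  exact degree_lt_degree (by omega)

theorem coeffAt_natDegree_div {P : K[X]} (hP : P.Monic) (hP1 : 1 ≤ P.natDegree) (h : K[X]) :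
    coeffAt P h (h.natDegree / P.natDegree) = h /ₘ P ^ (h.natDegree / P.natDegree) := by
  have hlt : h.natDegree < (h.natDegree / P.natDegree + 1) * P.natDegree := by
    rw [mul_comm]; exact Nat.lt_mul_div_succ _ hP1
  rw [coeffAt, mod_of_degree_lt hP]
  by_cases hq : h /ₘ P ^ (h.natDegree / P.natDegree) = 0
  · rw [hq, degree_zero, bot_lt_iff_ne_bot]; exact degree_ne_bot.2 hP.ne_zero
  · apply degree_lt_degree
    rw [natDegree_div (hP.pow _), hP.natDegree_pow]
    rw [add_mul, one_mul] at hlt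
    omega

/-- The top digit needs no reduction modulo P and inherits the leading coefficient. For monic `h` it
is a monic polynomial of degree < deg P, to which bounds on such polynomials apply. -/
theorem leadingCoeff_coeffAt_natDegree_div {P : K[X]} (hP : P.Monic) (hP1 : 1 ≤ P.natDegree)
    {h : K[X]} (h0 : h ≠ 0) :
    (coeffAt P h (h.natDegree / P.natDegree)).leadingCoeff = h.leadingCoeff := by
  rw [coeffAt_natDegree_div hP hP1]
  refine leadingCoeff_divByMonic_of_monic (hP.pow _) ?_
  rw [degree_eq_natDegree (hP.pow _).ne_zero, degree_eq_natDegree h0, hP.natDegree_pow]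
  exact_mod_cast Nat.div_mul_le_self _ _

theorem natDegree_coeffAt_natDegree_div {P : K[X]} (hP : P.Monic) (hP1 : 1 ≤ P.natDegree)
    (h : K[X]) : (coeffAt P h (h.natDegree / P.natDegree)).natDegree =
      h.natDegree - h.natDegree / P.natDegree * P.natDegree := by
  rw [coeffAt_natDegree_div hP hP1, natDegree_div (hP.pow _), hP.natDegree_pow]

theorem natDegree_lt_of_degree_lt {P h : K[X]} (h1 : 1 ≤ P.natDegree)
    (hd : h.degree < P.degree) : h.natDegree < P.natDegree := by
  by_cases h0 : h = 0
  · rw [h0, natDegree_zero]; omega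
  · exact natDegree_lt_natDegree h0 hd

end Expansions

/-! ### Upper sets of values, treating the estimates ≥ c, > c and ≥ c + ε uniformly -/

section Cuts

/-- Monotone families of upper sets of values, used to measure errors. -/
structure IsCut (B : ℝ → WithTop ℝ → Prop) : Prop where
  mono : ∀ {c y y'}, B c y → y ≤ y' → B c y'
  anti : ∀ {c c' y}, B c y → c' ≤ c → B c' y
  top : ∀ c, B c ⊤
  add : ∀ {c c' : ℝ} {y y'}, B c y → (c' : WithTop ℝ) ≤ y' → B (c + c') (y + y')
  -- A real `c₁` below `y` that keeps the information of the cut: estimates with `Ge`, which take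
  -- real bounds, are applied to `c₁`, and the last clause turns the result back into one for `B`.
  lift : ∀ {c y}, B c y → ∃ c₁ : ℝ, c ≤ c₁ ∧ (c₁ : WithTop ℝ) ≤ y ∧
    ∀ (d : ℝ) (y' : WithTop ℝ), ((c₁ + d : ℝ) : WithTop ℝ) ≤ y' → B (c + d) y'

/-- Values at least `c`. -/
abbrev Ge (c : ℝ) (y : WithTop ℝ) : Prop := (c : WithTop ℝ) ≤ y

/-- Values greater than `c`. -/
abbrev Gt (c : ℝ) (y : WithTop ℝ) : Prop := (c : WithTop ℝ) < y

/-- Values at least `c + ε`. -/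
def Gain (ε : ℝ) (c : ℝ) (y : WithTop ℝ) : Prop := ((c + ε : ℝ) : WithTop ℝ) ≤ y

theorem Ge.anti {c c' : ℝ} {y : WithTop ℝ} (h : Ge c y) (hc : c' ≤ c) : Ge c' y :=
  le_trans (WithTop.coe_le_coe.2 hc) h

theorem Ge.add {c c' : ℝ} {y y' : WithTop ℝ} (h : Ge c y) (h' : Ge c' y') :
    Ge (c + c') (y + y') := by
  unfold Ge at *
  rw [WithTop.coe_add]
  exact add_le_add h h'

theorem nonpos_of_ge_zero {c : ℝ} (h : Ge c 0) : c ≤ 0 :=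
  WithTop.coe_le_coe.1 (h.trans_eq WithTop.coe_zero.symm)

theorem isCut_ge : IsCut Ge where
  mono h h' := le_trans h h'
  anti h h' := Ge.anti h h'
  top _ := le_top
  add h h' := Ge.add h h'
  lift {c _} h := ⟨c, le_rfl, h, fun _ _ h' => h'⟩

theorem isCut_gain {ε : ℝ} (hε : 0 ≤ ε) : IsCut (Gain ε) where
  mono h h' := le_trans h h'
  anti h h' := Ge.anti h (by linarith)
  top _ := le_top
  add h h' := by
    have := Ge.add h h'
    exact this.anti (by linarith)
  lift {c _} h := ⟨c + ε, by linarith, h, fun d y' h' => by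
    unfold Gain; rwa [show c + d + ε = c + ε + d by ring]⟩

theorem isCut_gt : IsCut Gt where
  mono h h' := lt_of_lt_of_le h h'
  anti h h' := lt_of_le_of_lt (WithTop.coe_le_coe.2 h') h
  top c := WithTop.coe_lt_top c
  add {c c' y y'} h h' := by
    unfold Gt at *
    rw [WithTop.coe_add]
    exact WithTop.add_lt_add_of_lt_of_le WithTop.coe_ne_top h h'
  lift {c y} h := by
    cases y with
    | top => exact ⟨c + 1, by linarith, le_top, fun d y' h' =>
        lt_of_lt_of_le (WithTop.coe_lt_coe.2 (by linarith)) h'⟩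
    | coe y =>
      have h1 : c < y := WithTop.coe_lt_coe.1 h
      exact ⟨y, h1.le, le_rfl, fun d y' h' => lt_of_lt_of_le (WithTop.coe_lt_coe.2 (by linarith)) h'⟩

end Cuts

/-! ### The filtration of K[X] defined by an expansion, and its behaviour under products, division
and change of P -/

section Filtration

variable {K L : Type*} [Field K] [Field L] [Algebra K L]

/-- All terms of the `P`-expansion of `h` have values at least `μ` (in the sense of the cut `B`)
if `P` is given the value `b`. -/
def InU (v : AddValuation L (WithTop ℝ)) (x : L) (B : ℝ → WithTop ℝ → Prop) (P : K[X])
    (b μ : ℝ) (h : K[X]) : Prop :=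
  ∀ k : ℕ, B (μ - k * b) (val v x (coeffAt P h k))

/-- The quotients of the products of two polynomials of degree `< deg P` by `P` have large
values. -/
def Carry (v : AddValuation L (WithTop ℝ)) (x : L) (B : ℝ → WithTop ℝ → Prop) (P : K[X])
    (κ : ℝ) : Prop :=
  ∀ a b : K[X], a.degree < P.degree → b.degree < P.degree → ∀ c c' : ℝ,
    Ge c (val v x a) → Ge c' (val v x b) → B (c + c' - κ) (val v x ((a * b) /ₘ P))

variable {v : AddValuation L (WithTop ℝ)} {x : L} {B : ℝ → WithTop ℝ → Prop} {P : K[X]}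
  {κ b μ : ℝ}

theorem IsCut.map_add (hB : IsCut B) {c : ℝ} {y z : L} (hy : B c (v y)) (hz : B c (v z)) :
    B c (v (y + z)) := by
  rcases AddValuation.map_add' v y z with h | h
  · exact hB.mono hy h
  · exact hB.mono hz h

theorem IsCut.map_sub (hB : IsCut B) {c : ℝ} {y z : L} (hy : B c (v y)) (hz : B c (v z)) :
    B c (v (y - z)) := by
  rw [sub_eq_add_neg]
  exact hB.map_add hy (by rwa [AddValuation.map_neg])

theorem IsCut.map_sum (hB : IsCut B) {c : ℝ} {ι : Type*} (s : Finset ι) (y : ι → L)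
    (hy : ∀ i ∈ s, B c (v (y i))) : B c (v (∑ i ∈ s, y i)) := by
  classical
  induction s using Finset.induction_on with
  | empty => rw [Finset.sum_empty, AddValuation.map_zero]; exact hB.top c
  | insert i s hi ih =>
    rw [Finset.sum_insert hi]
    exact hB.map_add (hy i (Finset.mem_insert_self i s))
      (ih fun j hj => hy j (Finset.mem_insert_of_mem hj))

theorem IsCut.map_mul (hB : IsCut B) {c c' : ℝ} {y z : L} (hy : B c (v y)) (hz : Ge c' (v z)) :
    B (c + c') (v (y * z)) := by
  rw [AddValuation.map_mul]; exact hB.add hy hz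

theorem Ge.map_pow {c : ℝ} {y : L} (hy : Ge c (v y)) (m : ℕ) : Ge (m * c) (v (y ^ m)) := by
  induction m with
  | zero => simp
  | succ m ih =>
    rw [pow_succ]
    have := isCut_ge.map_mul ih hy
    rwa [show ((m + 1 : ℕ) : ℝ) * c = m * c + c by push_cast; ring]

theorem nonneg_map_natCast (m : ℕ) : Ge 0 (v (m : L)) := by
  induction m with
  | zero => simp
  | succ m ih =>
    rw [Nat.cast_succ]
    exact isCut_ge.map_add ih (by simp)

theorem val_add (h h' : K[X]) : val v x (h + h') = v (aeval x h + aeval x h') := by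
  simp [val]

theorem val_mul (h h' : K[X]) : val v x (h * h') = val v x h + val v x h' := by
  simp [val]

theorem InU.zero (hB : IsCut B) (hP : P.Monic) : InU v x B P b μ 0 := by
  intro k
  rw [coeffAt_zero hP, val, map_zero, AddValuation.map_zero]
  exact hB.top _

theorem InU.add (hB : IsCut B) (hP : P.Monic) {h h' : K[X]} (H : InU v x B P b μ h)
    (H' : InU v x B P b μ h') : InU v x B P b μ (h + h') := by
  intro k
  rw [coeffAt_add hP, val_add]
  exact hB.map_add (H k) (H' k)

theorem InU.neg (hP : P.Monic) {h : K[X]} (H : InU v x B P b μ h) : InU v x B P b μ (-h) := by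
  intro k
  rw [coeffAt_neg hP, val, map_neg, AddValuation.map_neg]
  exact H k

theorem InU.sub (hB : IsCut B) (hP : P.Monic) {h h' : K[X]} (H : InU v x B P b μ h)
    (H' : InU v x B P b μ h') : InU v x B P b μ (h - h') := by
  rw [sub_eq_add_neg]; exact H.add hB hP (H'.neg hP)

theorem InU.sum (hB : IsCut B) (hP : P.Monic) {ι : Type*} (s : Finset ι) (h : ι → K[X])
    (H : ∀ i ∈ s, InU v x B P b μ (h i)) : InU v x B P b μ (∑ i ∈ s, h i) := by
  intro k
  rw [coeffAt_sum hP, val, map_sum]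
  exact hB.map_sum _ _ fun i hi => H i hi k

theorem InU.anti (hB : IsCut B) {μ' : ℝ} {h : K[X]} (H : InU v x B P b μ h) (hμ : μ' ≤ μ) :
    InU v x B P b μ' h :=
  fun k => hB.anti (H k) (by linarith)

theorem InU.of_degree_lt (hB : IsCut B) (hP : P.Monic) {a : K[X]} (ha : a.degree < P.degree)
    (H : B μ (val v x a)) : InU v x B P b μ a := by
  intro k
  rw [coeffAt_of_degree_lt hP ha]
  split_ifs with hk
  · subst hk; simpa using H
  · rw [val, map_zero, AddValuation.map_zero]; exact hB.top _

theorem InU.self_mul (hB : IsCut B) (hP : P.Monic) {h : K[X]} (H : InU v x B P b μ h) :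
    InU v x B P b (μ + b) (P * h) := by
  intro k
  cases k with
  | zero => rw [coeffAt_mul_self_zero hP, val, map_zero, AddValuation.map_zero]; exact hB.top _
  | succ k =>
    rw [coeffAt_mul_self_succ hP]
    exact hB.anti (H k) (by push_cast; linarith)

theorem InU.mul_pow (hB : IsCut B) (hP : P.Monic) {h : K[X]} (H : InU v x B P b μ h) (m : ℕ) :
    InU v x B P b (μ + m * b) (h * P ^ m) := by
  induction m with
  | zero => simpa using H
  | succ m ih =>
    have := ih.self_mul hB hP
    rw [show h * P ^ (m + 1) = P * (h * P ^ m) by ring]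
    exact this.anti hB (by push_cast; linarith)

theorem InU.mod {h : K[X]} (H : InU v x B P b μ h) : B μ (val v x (h %ₘ P)) := by
  have := H 0
  simpa [coeffAt_zero_index] using this

theorem InU.div (hB : IsCut B) (hP : P.Monic) {h : K[X]} (H : InU v x B P b μ h) :
    InU v x B P b (μ - b) (h /ₘ P) := by
  intro k
  rw [← coeffAt_succ hP]
  exact hB.anti (H (k + 1)) (by push_cast; linarith)

/-- Induction on the number of terms of an expansion. -/
theorem expansion_induction (hP : P.Monic) (hP1 : 1 ≤ P.natDegree) {C : K[X] → Prop}
    (zero : C 0) (step : ∀ h, C (h /ₘ P) → C h) (h : K[X]) : C h := by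
  induction hn : h.natDegree using Nat.strong_induction_on generalizing h with
  | _ n ih =>
    by_cases hd : h.degree < P.degree
    · apply step; rw [div_of_degree_lt hP hd]; exact zero
    · apply step
      refine ih _ ?_ _ rfl
      rw [natDegree_div hP]
      have : P.natDegree ≤ h.natDegree := by
        by_contra hlt
        exact hd (degree_lt_degree (not_le.1 hlt))
      omega

theorem InU.eval (hB : IsCut B) (hP : P.Monic) (hP1 : 1 ≤ P.natDegree)
    (hb : Ge b (val v x P)) {h : K[X]} (H : InU v x B P b μ h) : B μ (val v x h) := by
  induction h using expansion_induction hP hP1 generalizing μ with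
  | zero => rw [val, map_zero, AddValuation.map_zero]; exact hB.top _
  | step h ih =>
    have h1 := hB.add (ih (H.div hB hP)) hb
    rw [← modByMonic_add_div h P, val_add]
    refine hB.map_add H.mod ?_
    rw [map_mul, mul_comm, AddValuation.map_mul]
    exact hB.anti h1 (by linarith)

/-- Multiplication digit by digit. The product of `a` with the lowest digit leaves a remainder and a
carry; the carry loses κ but moves up one place, which earns b ≥ κ. -/
theorem InU.mul_of_degree_lt (hB : IsCut B) (hP : P.Monic) (hP1 : 1 ≤ P.natDegree)
    (hC : Carry v x Ge P κ) (hκ : κ ≤ b) (hκP : Ge κ (val v x P)) {a h : K[X]} {c : ℝ}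
    (ha : a.degree < P.degree) (hc : Ge c (val v x a)) (H : InU v x B P b μ h) :
    InU v x B P b (c + μ) (a * h) := by
  induction h using expansion_induction hP hP1 generalizing μ with
  | zero => rw [mul_zero]; exact InU.zero hB hP
  | step h ih =>
    have h1 := (ih (H.div hB hP)).self_mul hB hP
    obtain ⟨c₁, hcc, hc₁, hl⟩ := hB.lift H.mod
    have hm := degree_modByMonic_lt h hP
    have h2 := hC a _ ha hm c c₁ hc hc₁
    have e : a * h = (a * (h %ₘ P)) %ₘ P + P * ((a * (h %ₘ P)) /ₘ P) + P * (a * (h /ₘ P)) := by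
      rw [modByMonic_add_div]
      conv_lhs => rw [← modByMonic_add_div h P]
      ring
    rw [e]
    refine InU.add hB hP (InU.add hB hP ?_ ?_) (h1.anti hB (by linarith))
    · refine InU.of_degree_lt hB hP (degree_modByMonic_lt _ hP) ?_
      rw [modByMonic_eq_sub_mul_div, val, map_sub]
      refine hB.map_sub ?_ ?_
      · rw [map_mul, mul_comm]
        have := hB.map_mul (z := aeval x a) H.mod hc
        rwa [add_comm] at this
      · rw [map_mul, AddValuation.map_mul, add_comm c μ]
        have := Ge.add hκP h2
        exact hl c _ (this.anti (by linarith))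
    · have h3 : InU v x B P b (c + μ - b) ((a * (h %ₘ P)) /ₘ P) := by
        refine InU.of_degree_lt hB hP (degree_mul_div_lt hP ha hm) ?_
        rw [show c + μ - b = μ + (c - b) by ring]
        exact hl _ _ (h2.anti (by linarith))
      exact (h3.self_mul hB hP).anti hB (by linarith)

theorem InU.mul (hB : IsCut B) (hP : P.Monic) (hP1 : 1 ≤ P.natDegree)
    (hC : Carry v x Ge P κ) (hκ : κ ≤ b) (hκP : Ge κ (val v x P)) {g h : K[X]} {μ' : ℝ}
    (G : InU v x Ge P b μ g) (H : InU v x B P b μ' h) :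
    InU v x B P b (μ + μ') (g * h) := by
  induction g using expansion_induction hP hP1 generalizing μ with
  | zero => rw [zero_mul]; exact InU.zero hB hP
  | step g ih =>
    have h1 := (ih (G.div isCut_ge hP)).self_mul hB hP
    have h2 := H.mul_of_degree_lt hB hP hP1 hC hκ hκP (degree_modByMonic_lt g hP) G.mod
    have e : g * h = (g %ₘ P) * h + P * ((g /ₘ P) * h) := by
      conv_lhs => rw [← modByMonic_add_div g P]
      ring
    rw [e]
    exact h2.add hB hP (h1.anti hB (by linarith))

theorem InU.pow (hP : P.Monic) (hP1 : 1 ≤ P.natDegree)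
    (hC : Carry v x Ge P κ) (hκ : κ ≤ b) (hκP : Ge κ (val v x P)) {g : K[X]}
    (G : InU v x Ge P b μ g) (m : ℕ) : InU v x Ge P b (m * μ) (g ^ m) := by
  induction m with
  | zero =>
    refine InU.of_degree_lt isCut_ge hP ?_ (by simp [val])
    rw [pow_zero, degree_one, degree_eq_natDegree hP.ne_zero]
    exact_mod_cast hP1
  | succ m ih =>
    rw [pow_succ]
    exact (ih.mul isCut_ge hP hP1 hC hκ hκP G).anti isCut_ge (by push_cast; linarith)

/-- Division with remainder by a monic polynomial whose initial form is monic. -/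
theorem InU.div_mod (hP : P.Monic) (hP1 : 1 ≤ P.natDegree)
    (hC : Carry v x Ge P κ) (hκ : κ ≤ b) (hκP : Ge κ (val v x P)) {R : K[X]} {α : ℕ}
    (hR : R.Monic) (hRd : R.natDegree = α * P.natDegree) (hRU : InU v x Ge P b (α * b) R)
    {h : K[X]} (H : InU v x Ge P b μ h) :
    InU v x Ge P b (μ - α * b) (h /ₘ R) := by
  induction hn : h.natDegree using Nat.strong_induction_on generalizing h with
  | _ n ih =>
    by_cases hd : h.degree < R.degree
    · rw [div_of_degree_lt hR hd]; exact InU.zero isCut_ge hP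
    by_cases h0 : h = 0
    · rw [h0, zero_divByMonic]; exact InU.zero isCut_ge hP
    have hRh : R.natDegree ≤ h.natDegree := by
      by_contra hlt
      exact hd (degree_lt_degree (not_le.1 hlt))
    set M := h.natDegree / P.natDegree with hM
    have hαM : α ≤ M := by
      rw [hM, Nat.le_div_iff_mul_le hP1, ← hRd]; exact hRh
    set c := coeffAt P h M with hcdef
    have hlc : c.leadingCoeff = h.leadingCoeff := leadingCoeff_coeffAt_natDegree_div hP hP1 h0
    have hcn := natDegree_coeffAt_natDegree_div hP hP1 h
    have hc0 : c ≠ 0 := by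
      intro hc; rw [hc, leadingCoeff_zero] at hlc
      exact h0 (leadingCoeff_eq_zero.1 hlc.symm)
    -- `t * R` has the leading term of `h`, so subtracting it lowers the degree; the bound `μ`
    -- survives because `R` has the bound `α * b`.
    set t := c * P ^ (M - α) with ht
    have htU : InU v x Ge P b (μ - α * b) t := by
      have h1 : InU v x Ge P b (μ - M * b) c :=
        InU.of_degree_lt isCut_ge hP (degree_coeffAt_lt hP h M) (H M)
      refine (h1.mul_pow isCut_ge hP (M - α)).anti isCut_ge ?_
      rw [Nat.cast_sub hαM]; linarith
    have htR : InU v x Ge P b μ (t * R) :=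
      (htU.mul isCut_ge hP hP1 hC hκ hκP hRU).anti isCut_ge (by linarith)
    have hMle : M * P.natDegree ≤ h.natDegree := Nat.div_mul_le_self _ _
    have hdeg : (t * R).natDegree = h.natDegree := by
      rw [ht, mul_assoc, natDegree_mul hc0 (mul_ne_zero (hP.pow _).ne_zero hR.ne_zero),
        natDegree_mul (hP.pow _).ne_zero hR.ne_zero, hP.natDegree_pow, hRd, hcn, ← hM,
        ← add_mul, Nat.sub_add_cancel hαM]
      omega
    have htR0 : t * R ≠ 0 := mul_ne_zero (mul_ne_zero hc0 (hP.pow _).ne_zero) hR.ne_zero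
    have hlead : (t * R).leadingCoeff = h.leadingCoeff := by
      rw [leadingCoeff_mul, hR.leadingCoeff, mul_one, ht, leadingCoeff_mul,
        (hP.pow _).leadingCoeff, mul_one, hlc]
    have hlt : (h - t * R).degree < h.degree := by
      refine degree_sub_lt_left ?_ h0 hlead.symm
      rw [degree_eq_natDegree h0, degree_eq_natDegree htR0, hdeg]
    have hU' : InU v x Ge P b μ (h - t * R) := H.sub isCut_ge hP htR
    have hdiv : h /ₘ R = t + (h - t * R) /ₘ R := by
      conv_lhs => rw [show h = R * t + (h - t * R) by ring]
      rw [add_divByMonic' hR, mul_divByMonic_cancel_left _ hR]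
    rw [hdiv]
    refine htU.add isCut_ge hP ?_
    by_cases hz : h - t * R = 0
    · rw [hz, zero_divByMonic]; exact InU.zero isCut_ge hP
    · exact ih _ (hn ▸ natDegree_lt_natDegree hz hlt) hU' rfl

/-- Reduction modulo P after each multiplication by `z`. What is dropped is P times a carry, hence
an error in the finer cut `B`, in which carries lose at most b. Thus `a * z ^ m` may be replaced by
a single digit. -/
theorem Carry.exists_approx (hB : IsCut B) (hP : P.Monic) (hP1 : 1 ≤ P.natDegree)
    (hC : Carry v x Ge P κ) (hκ : κ ≤ b) (hκP : Ge κ (val v x P)) (hCB : Carry v x B P b)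
    {a z : K[X]} {c ζ : ℝ} (ha : a.degree < P.degree) (hz : z.degree < P.degree)
    (hc : Ge c (val v x a)) (hζ : Ge ζ (val v x z)) (m : ℕ) :
    ∃ r : K[X], r.degree < P.degree ∧ Ge (c + m * ζ) (val v x r) ∧
      InU v x B P b (c + m * ζ) (a * z ^ m - r) := by
  induction m with
  | zero =>
    refine ⟨a, ha, by simpa using hc, ?_⟩
    rw [pow_zero, mul_one, sub_self]; exact InU.zero hB hP
  | succ m ih =>
    obtain ⟨r, hr, hrc, hrU⟩ := ih
    have h1 := hC z r hz hr _ _ hζ hrc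
    have h2 := hCB z r hz hr _ _ hζ hrc
    refine ⟨(z * r) %ₘ P, degree_modByMonic_lt _ hP, ?_, ?_⟩
    · rw [modByMonic_eq_sub_mul_div, val, map_sub]
      refine isCut_ge.map_sub ?_ ?_
      · rw [map_mul]
        exact (isCut_ge.map_mul (y := aeval x z) hζ hrc).anti (by push_cast; linarith)
      · rw [map_mul]
        exact (isCut_ge.map_mul (y := aeval x P) hκP h1).anti (by push_cast; linarith)
    · have e : a * z ^ (m + 1) - (z * r) %ₘ P = z * (a * z ^ m - r) + P * ((z * r) /ₘ P) := by
        rw [modByMonic_eq_sub_mul_div]; ring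
      rw [e]
      refine InU.add hB hP ?_ ?_
      · exact (hrU.mul_of_degree_lt hB hP hP1 hC hκ hκP hz hζ).anti hB (by push_cast; linarith)
      · have h3 : InU v x B P b (ζ + (c + m * ζ) - b) ((z * r) /ₘ P) :=
          InU.of_degree_lt hB hP (degree_mul_div_lt hP hz hr) h2
        exact (h3.self_mul hB hP).anti hB (by push_cast; linarith)

theorem degree_sum_mul_lt {ι : Type*} (hP : P.Monic) (s : Finset ι) (r : ι → K[X])
    (hr : ∀ i ∈ s, (r i).degree < P.degree) : (∑ i ∈ s, r i).degree < P.degree :=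
  lt_of_le_of_lt (degree_sum_le _ _)
    ((Finset.sup_lt_iff (bot_lt_iff_ne_bot.2 (degree_ne_bot.2 hP.ne_zero))).2 hr)

theorem degree_natCast_mul_lt {a : K[X]} (ha : a.degree < P.degree) (m : ℕ) :
    ((m : K[X]) * a).degree < P.degree := by
  refine lt_of_le_of_lt ?_ ha
  rw [← nsmul_eq_mul]
  exact degree_smul_le _ _

/-- Change of the polynomial in an expansion: up to an error, the coefficients change as in a
polynomial ring. -/
theorem Carry.taylor_approx (hB : IsCut B) (hP : P.Monic) (hP1 : 1 ≤ P.natDegree)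
    (hC : Carry v x Ge P κ) (hκ : κ ≤ b) (hκP : Ge κ (val v x P)) (hCB : Carry v x B P b)
    (hbP : Ge b (val v x P)) {z : K[X]} (hz : z.degree < P.degree) (hζ : Ge b (val v x z))
    (N : ℕ) (a : ℕ → K[X]) (ha : ∀ i < N, (a i).degree < P.degree)
    (hμ : ∀ i < N, Ge (μ - i * b) (val v x (a i))) (k : ℕ) :
    B (μ - k * b) (v (aeval x (coeffAt P (∑ i ∈ Finset.range N, a i * (P - z) ^ i) k) -
      ∑ i ∈ Finset.range N, (i.choose k : L) * aeval x (a i) * (-aeval x z) ^ (i - k))) := by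
  have key : ∀ i < N, ∀ k : ℕ, ∃ r : K[X], r.degree < P.degree ∧
      InU v x B P b (μ - k * b) ((i.choose k : K[X]) * a i * (-z) ^ (i - k) - r) := by
    intro i hi k
    rcases le_or_gt k i with hki | hki
    · have hc : Ge (μ - i * b) (val v x ((i.choose k : K[X]) * a i)) := by
        rw [val, map_mul, map_natCast]
        exact (isCut_ge.map_mul (nonneg_map_natCast _) (hμ i hi)).anti (by linarith)
      obtain ⟨r, h1, -, h3⟩ := hC.exists_approx hB hP hP1 hκ hκP hCB (z := -z)
        (degree_natCast_mul_lt (ha i hi) _) (by rwa [degree_neg]) hc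
        (by rw [val, map_neg, AddValuation.map_neg]; exact hζ) (i - k)
      refine ⟨r, h1, h3.anti hB ?_⟩
      rw [Nat.cast_sub hki]; linarith
    · refine ⟨0, ?_, ?_⟩
      · rw [degree_zero, bot_lt_iff_ne_bot]; exact degree_ne_bot.2 hP.ne_zero
      · rw [Nat.choose_eq_zero_of_lt hki]; simpa using InU.zero hB hP
  choose! r hr hrU using key
  have hexp : ∑ i ∈ Finset.range N, a i * (P - z) ^ i = ∑ k ∈ Finset.range N,
      (∑ i ∈ Finset.range N, (i.choose k : K[X]) * a i * (-z) ^ (i - k)) * P ^ k := by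
    simp_rw [Finset.sum_mul]
    rw [Finset.sum_comm]
    refine Finset.sum_congr rfl fun i hi => ?_
    rw [sub_eq_add_neg, add_pow, Finset.mul_sum]
    have hi' : i + 1 ≤ N := Finset.mem_range.1 hi
    rw [← Finset.sum_subset (Finset.range_subset_range.2 hi')]
    · refine Finset.sum_congr rfl fun k _ => by ring
    · intro k _ hk
      rw [Nat.choose_eq_zero_of_lt (by simpa using hk)]; simp
  -- `F k` is the k-th coefficient according to the binomial formula for (P - z)^i, but its degree
  -- may be too large. `R k` is a digit approximating it, and the differences contribute only
  -- errors.
  set F : ℕ → K[X] := fun k => ∑ i ∈ Finset.range N, (i.choose k : K[X]) * a i * (-z) ^ (i - k)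
    with hF
  set R : ℕ → K[X] := fun k => ∑ i ∈ Finset.range N, r i k with hR
  have hFR : ∀ k : ℕ, InU v x B P b (μ - k * b) (F k - R k) := by
    intro k
    rw [hF, hR]; simp only
    rw [← Finset.sum_sub_distrib]
    exact InU.sum hB hP _ _ fun i hi => hrU i (Finset.mem_range.1 hi) k
  have hsplit : ∑ i ∈ Finset.range N, a i * (P - z) ^ i =
      ∑ k ∈ Finset.range N, R k * P ^ k + ∑ k ∈ Finset.range N, (F k - R k) * P ^ k := by
    rw [hexp, ← Finset.sum_add_distrib]
    exact Finset.sum_congr rfl fun k _ => by ring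
  have hE : InU v x B P b μ (∑ k ∈ Finset.range N, (F k - R k) * P ^ k) :=
    InU.sum hB hP _ _ fun k _ => ((hFR k).mul_pow hB hP k).anti hB (by linarith)
  have hsum : ∑ i ∈ Finset.range N, (i.choose k : L) * aeval x (a i) * (-aeval x z) ^ (i - k)
      = aeval x (F k) := by
    simp [hF]
  rw [hsum, hsplit, coeffAt_add hP, coeffAt_sum_mul_pow hP _ _
    fun k _ => degree_sum_mul_lt hP _ _ fun i hi => hr i (Finset.mem_range.1 hi) k]
  have h2 := (hFR k).eval hB hP hP1 hbP
  rw [val, map_sub] at h2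
  by_cases hk : k ∈ Finset.range N
  · rw [if_pos hk, map_add]
    have := hB.map_sub (hE k) h2
    rwa [show aeval x (R k) + aeval x (coeffAt P (∑ k ∈ Finset.range N, (F k - R k) * P ^ k) k) -
      aeval x (F k) = aeval x (coeffAt P (∑ k ∈ Finset.range N, (F k - R k) * P ^ k) k) -
      (aeval x (F k) - aeval x (R k)) by ring]
  · have hF0 : F k = 0 := by
      refine Finset.sum_eq_zero fun i hi => ?_
      rw [Nat.choose_eq_zero_of_lt]
      · simp
      · simp only [Finset.mem_range, not_lt] at hk hi; omega
    rw [if_neg hk, zero_add, hF0, map_zero, sub_zero]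
    exact hE k

/-- The carry condition passes from `P` to `P + y`. -/
theorem Carry.add_right (hB : IsCut B) (hP : P.Monic) (hP1 : 1 ≤ P.natDegree)
    (hCB : Carry v x B P κ) {y : K[X]} (hy : y.degree < P.degree)
    (hyκ : Ge κ (val v x y)) : Carry v x B (P + y) κ := by
  have hP' : (P + y).Monic := hP.add_of_left hy
  have hdeg : (P + y).degree = P.degree := degree_add_eq_left_of_degree_lt hy
  intro a b ha hb c c' hc hc'
  rw [hdeg] at ha hb
  have h0 := hCB a b ha hb c c' hc hc'
  -- division of `a b` by `P + y` starting from a representation with a multiple of `P`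
  have main : ∀ n : ℕ, ∀ q : K[X], q.natDegree < n → q.degree < P.degree →
      B (c + c' - κ) (val v x q) → B (c + c' - κ) (val v x ((q * P) /ₘ (P + y))) := by
    intro n
    induction n with
    | zero => intro q hq; omega
    | succ n ih =>
      intro q hq hqd hqv
      obtain ⟨c₁, hcc, hc₁, hl⟩ := hB.lift hqv
      have h1 := hCB q y hqd hy c₁ κ hc₁ hyκ
      set q' := (q * y) /ₘ P with hq'
      -- Here q P = (P + y) q - q y, and the division of q y by P leaves a multiple q' P with deg q'
      -- < deg q because deg y < deg P, so the recursion ends.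
      have e : q * P = (P + y) * q + (-(q * y) %ₘ P) + -(q' * P) := by
        rw [neg_modByMonic, modByMonic_eq_sub_mul_div, hq']; ring
      have hq'd : q'.degree < P.degree := degree_mul_div_lt hP hqd hy
      have hdiv : (q * P) /ₘ (P + y) = q - (q' * P) /ₘ (P + y) := by
        have hneg : (-(q' * P)) /ₘ (P + y) = -((q' * P) /ₘ (P + y)) := by
          have := add_divByMonic' hP' (q' * P) (-(q' * P))
          rw [add_neg_cancel, zero_divByMonic] at this
          exact (neg_eq_of_add_eq_zero_right this.symm).symm
        rw [e, add_divByMonic' hP', add_divByMonic' hP', mul_divByMonic_cancel_left _ hP',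
          div_of_degree_lt hP' (by rw [hdeg]; exact degree_modByMonic_lt _ hP), hneg]
        ring
      rw [hdiv, val, map_sub]
      refine hB.map_sub hqv ?_
      by_cases hq0 : q' = 0
      · rw [hq0, zero_mul, zero_divByMonic, map_zero, AddValuation.map_zero]; exact hB.top _
      refine ih q' ?_ hq'd (hB.anti h1 (by linarith))
      have h2 : P.natDegree ≤ (q * y).natDegree := by
        by_contra hlt
        exact hq0 (div_of_degree_lt hP (degree_lt_degree (not_le.1 hlt)))
      have h3 := natDegree_mul_le (p := q) (q := y)
      have h4 := natDegree_lt_of_degree_lt hP1 hy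
      rw [hq', natDegree_div hP]
      omega
  have e : a * b = (a * b) %ₘ P + ((a * b) /ₘ P) * P := by
    conv_lhs => rw [← modByMonic_add_div (a * b) P]
    ring
  rw [e, add_divByMonic' hP', div_of_degree_lt hP' (by rw [hdeg]; exact degree_modByMonic_lt _ hP),
    zero_add]
  exact main _ _ (Nat.lt_succ_self _) (degree_mul_div_lt hP ha hb) h0

end Filtration

/-! ### Kaplansky's analysis of a polynomial along a pseudo-convergent sequence -/

section Kaplansky

/-- Only for powers of p are all inner binomial coefficients divisible by p. For other j the index k
found here lets the k-th derivative control the j-th one. -/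
theorem exists_not_dvd_choose {p : ℕ} (hp : p.Prime) {j : ℕ} (hj : 0 < j)
    (h : ∀ e, j ≠ p ^ e) : ∃ k, 1 ≤ k ∧ k < j ∧ ¬ p ∣ j.choose k := by
  have := Fact.mk hp
  by_contra! hc
  exact h _ (Choose.eq_pow_multiplicity_of_choose_modEq_zero_nat hj fun k hk =>
    (Nat.modEq_zero_iff_dvd).2 (hc k (by grind) (by grind)))

theorem eval_eq_sum_hasseDeriv {R : Type*} [CommRing R] (G : R[X]) (u y : R) {M : ℕ}
    (hM : G.natDegree ≤ M) :
    G.eval u = ∑ i ∈ Finset.range (M + 1), (hasseDeriv i G).eval y * (u - y) ^ i := by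
  rw [← taylor_eval_sub y G u, eval_eq_sum_range' (n := M + 1)]
  · simp only [taylor_coeff]
  · rw [natDegree_taylor]; omega

theorem hasseDeriv_hasseDeriv_eval {R : Type*} [CommRing R] (G : R[X]) (i k : ℕ) (y : R) :
    (hasseDeriv i (hasseDeriv k G)).eval y =
      ((k + i).choose k : R) * (hasseDeriv (k + i) G).eval y := by
  have := LinearMap.congr_fun (hasseDeriv_comp (R := R) i k) G
  rw [LinearMap.comp_apply] at this
  rw [this, LinearMap.smul_apply, eval_smul, nsmul_eq_mul, add_comm i k,
    ← Nat.choose_symm_add]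

variable {L : Type*} [Field L] {v : AddValuation L (WithTop ℝ)}

/-- `m` has an inverse modulo p that is again the image of an integer; both values are non-negative
and add up to 0. -/
theorem map_natCast_eq_zero {p : ℕ} (hp : p.Prime) [CharP L p] {m : ℕ} (hm : ¬ p ∣ m) :
    v (m : L) = 0 := by
  have hcop : Nat.Coprime m p := ((Nat.Prime.coprime_iff_not_dvd hp).2 hm).symm
  obtain ⟨m', -, hm'⟩ := Nat.exists_mul_mod_eq_one_of_coprime hcop hp.one_lt
  have h1 : (m : L) * (m' : L) = 1 := by
    rw [← Nat.cast_mul, ← Nat.div_add_mod (m * m') p, hm']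
    simp
  have h2 := congrArg v h1
  rw [AddValuation.map_mul, AddValuation.map_one] at h2
  have h3 := nonneg_map_natCast (v := v) m
  have h4 := nonneg_map_natCast (v := v) m'
  refine le_antisymm ?_ h3
  rw [← h2]
  exact le_add_of_nonneg_right h4

/-- A polynomial `H` over `L` and a sequence `y t` with `v (u - y t) = β t`, where the variation
of the `β t` is small with respect to `ε`. All derivatives of `H`, but not `H` itself, have
eventually fixed values along the sequence, up to errors of size `ε`. -/
structure PseudoLimit (v : AddValuation L (WithTop ℝ)) (H : L[X]) (u : L) (y : ℕ → L) (β : ℕ → ℝ)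
    (μ ε : ℝ) : Prop where
  mono : StrictMono β
  val_sub : ∀ t, v (u - y t) = β t
  window : ∀ t, H.natDegree * (β t - β 0) < ε
  -- Together with `val_sub` this gives `u`, and hence every `y t`, a value at least `β 0`.
  zero : y 0 = 0
  exists_le : ∃ k, v (H.coeff k) ≤ ((μ - k * β 0 : ℝ) : WithTop ℝ)
  fixed : ∀ k, 1 ≤ k → ∃ t₁, ∀ t ≥ t₁, ∀ i : ℕ, ∀ c : ℝ, Ge c (v ((hasseDeriv k H).eval u)) →
    c ≤ μ - k * β 0 + ε → Ge (c - i * β t) (v ((hasseDeriv i (hasseDeriv k H)).eval (y t)))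
  large_or_unfixed : ∀ t, Ge (μ + ε) (v (H.eval u)) ∨ ∃ (k : ℕ) (c : ℝ),
    v ((hasseDeriv k H).eval (y t)) = c ∧ Gt (c + k * β t) (v (H.eval u))

namespace PseudoLimit

variable {H : L[X]} {u : L} {y : ℕ → L} {β : ℕ → ℝ} {μ ε : ℝ}

theorem ge_val_sub (D : PseudoLimit v H u y β μ ε) (t : ℕ) (i : ℕ) :
    Ge (i * β t) (v ((u - y t) ^ i)) :=
  Ge.map_pow (by rw [D.val_sub]) i

theorem hasseDeriv_eq_zero {k : ℕ} (hk : H.natDegree < k) (z : L) :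
    v ((hasseDeriv k H).eval z) = ⊤ := by
  rw [hasseDeriv_eq_zero_of_lt_natDegree _ _ hk, eval_zero, AddValuation.map_zero]

/-- Each derivative has a truncated value `m k`. -/
theorem exists_truncated (_ : PseudoLimit v H u y β μ ε) (k : ℕ) :
    ∃ m : ℝ, Ge m (v ((hasseDeriv k H).eval u)) ∧ m ≤ μ - k * β 0 + ε ∧
      (m < μ - k * β 0 + ε → v ((hasseDeriv k H).eval u) = m) := by
  rcases le_or_gt ((μ - k * β 0 + ε : ℝ) : WithTop ℝ) (v ((hasseDeriv k H).eval u)) with h | h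
  · exact ⟨_, h, le_rfl, fun h' => absurd h' (lt_irrefl _)⟩
  · obtain ⟨m, hm⟩ := WithTop.ne_top_iff_exists.1 h.ne_top
    refine ⟨m, hm.le, ?_, fun _ => hm.symm⟩
    rw [← hm] at h
    exact (WithTop.coe_lt_coe.1 h).le

/-- The truncated values of the derivatives. -/
def truncated (D : PseudoLimit v H u y β μ ε) (k : ℕ) : ℝ := (D.exists_truncated k).choose

theorem ge_truncated (D : PseudoLimit v H u y β μ ε) (k : ℕ) :
    Ge (D.truncated k) (v ((hasseDeriv k H).eval u)) := (D.exists_truncated k).choose_spec.1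

theorem truncated_le (D : PseudoLimit v H u y β μ ε) (k : ℕ) :
    D.truncated k ≤ μ - k * β 0 + ε := (D.exists_truncated k).choose_spec.2.1

theorem eq_truncated (D : PseudoLimit v H u y β μ ε) {k : ℕ}
    (h : D.truncated k < μ - k * β 0 + ε) : v ((hasseDeriv k H).eval u) = D.truncated k :=
  (D.exists_truncated k).choose_spec.2.2 h

/-- The i-th Hasse derivative of the k-th one is a binomial multiple of the (k+i)-th; if p does not
divide the binomial coefficient, it has value 0, and `fixed` for index k bounds the derivative of
index k+i. -/
theorem eventually_ge (D : PseudoLimit v H u y β μ ε) {p : ℕ} (hp : p.Prime) [CharP L p] {k i : ℕ}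
    (hk : 1 ≤ k) (hki : ¬ p ∣ (k + i).choose k) :
    ∀ᶠ t in Filter.atTop, Ge (D.truncated k - i * β t) (v ((hasseDeriv (k + i) H).eval (y t))) := by
  obtain ⟨t₁, ht₁⟩ := D.fixed k hk
  filter_upwards [Filter.eventually_ge_atTop t₁] with t ht
  have := ht₁ t ht i _ (D.ge_truncated k) (D.truncated_le k)
  rwa [hasseDeriv_hasseDeriv_eval, AddValuation.map_mul, map_natCast_eq_zero hp hki,
    zero_add] at this

theorem eventually_ge_self (D : PseudoLimit v H u y β μ ε) {p : ℕ} (hp : p.Prime) [CharP L p]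
    {k : ℕ} (hk : 1 ≤ k) :
    ∀ᶠ t in Filter.atTop, Ge (D.truncated k) (v ((hasseDeriv k H).eval (y t))) := by
  have := D.eventually_ge hp (k := k) (i := 0) hk (by simpa using hp.one_lt.ne')
  simpa using this

/-- The line `m k + k b` of the Newton polygon, at `b = β t`. -/
def line (D : PseudoLimit v H u y β μ ε) (k t : ℕ) : ℝ := D.truncated k + k * β t

/-- At one instant `t₁` the (k, j-k) bound says that line k is not above line j. Line j is steeper
and β increases strictly, so afterwards the inequality is strict. If `truncated j` has its maximal
value, the upper bound for `truncated k` suffices. -/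
theorem line_lt_of_eventually_eq (D : PseudoLimit v H u y β μ ε) {p : ℕ} (hp : p.Prime) [CharP L p]
    {k j : ℕ} (hk : 1 ≤ k) (hkj : k < j) (hc : ¬ p ∣ j.choose k)
    (hj : ∀ᶠ t in Filter.atTop, D.truncated j < μ - j * β 0 + ε →
      v ((hasseDeriv j H).eval (y t)) = D.truncated j) :
    ∀ᶠ t in Filter.atTop, D.line k t < D.line j t := by
  obtain ⟨i, rfl⟩ := Nat.exists_eq_add_of_lt hkj
  obtain ⟨t₁, h1, h2⟩ := (hj.and (D.eventually_ge hp (i := i + 1) hk hc)).exists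
  have hk0 := D.truncated_le k
  have hj0 := D.truncated_le (k + i + 1)
  filter_upwards [Filter.eventually_gt_atTop t₁] with t ht
  have hβ : β t₁ < β t := D.mono ht
  have hβ0 : β 0 < β t := D.mono (by omega)
  have hi : (0 : ℝ) ≤ i := Nat.cast_nonneg i
  rw [line, line]
  push_cast at *
  rcases lt_or_eq_of_le hj0 with h | h
  · have h3 := h1 h
    rw [show k + (i + 1) = k + i + 1 by ring, h3] at h2
    have h4 := WithTop.coe_le_coe.1 h2
    nlinarith
  · rw [h]
    nlinarith

/-- Descending induction on k. In the Taylor expansion of the k-th derivative at `y t`, the higher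
terms either vanish modulo p or lie on lines strictly above line k. They cannot alter the value
`truncated k` taken at `u`. -/
theorem eventually_eq (D : PseudoLimit v H u y β μ ε) {p : ℕ} (hp : p.Prime) [CharP L p]
    {k : ℕ} (hk : 1 ≤ k) (hkN : k ≤ H.natDegree) :
    ∀ᶠ t in Filter.atTop, D.truncated k < μ - k * β 0 + ε →
      v ((hasseDeriv k H).eval (y t)) = D.truncated k := by
  induction hn : H.natDegree - k using Nat.strong_induction_on generalizing k with
  | _ n ih =>
    have h1 : ∀ᶠ t in Filter.atTop, ∀ i ∈ Finset.range (H.natDegree + 1), 1 ≤ i →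
        k + i ≤ H.natDegree → ¬ p ∣ (k + i).choose k →
        D.line k t < D.line (k + i) t ∧
          Ge (D.truncated (k + i)) (v ((hasseDeriv (k + i) H).eval (y t))) := by
      rw [Finset.eventually_all]
      intro i _
      by_cases hi : 1 ≤ i ∧ k + i ≤ H.natDegree ∧ ¬ p ∣ (k + i).choose k
      · filter_upwards [D.line_lt_of_eventually_eq hp hk (by omega) hi.2.2
          (ih _ (by omega) (k := k + i) (by omega) hi.2.1 rfl),
          D.eventually_ge_self hp (k := k + i) (by omega)] with t ht ht' _ _ _
        exact ⟨ht, ht'⟩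
      · filter_upwards with t h1 h2 h3
        exact absurd ⟨h1, h2, h3⟩ hi
    filter_upwards [h1] with t ht hlt
    have hG : (hasseDeriv k H).natDegree ≤ H.natDegree :=
      (natDegree_hasseDeriv_le H k).trans (Nat.sub_le _ _)
    have hsum := eval_eq_sum_hasseDeriv (hasseDeriv k H) u (y t) hG
    rw [Finset.sum_range_succ'] at hsum
    simp only [hasseDeriv_zero', pow_zero, mul_one] at hsum
    have hrest : Gt (D.truncated k) (v (∑ i ∈ Finset.range H.natDegree,
        (hasseDeriv (i + 1) (hasseDeriv k H)).eval (y t) * (u - y t) ^ (i + 1))) := by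
      refine isCut_gt.map_sum _ _ fun i hi => ?_
      rw [hasseDeriv_hasseDeriv_eval]
      by_cases hc : p ∣ (k + (i + 1)).choose k
      · rw [(CharP.cast_eq_zero_iff L p _).2 hc, zero_mul, zero_mul, AddValuation.map_zero]
        exact WithTop.coe_lt_top _
      by_cases hN : k + (i + 1) ≤ H.natDegree
      · obtain ⟨h2, h3⟩ := ht (i + 1) (by simp at hi ⊢; omega) (by omega) hN hc
        rw [line, line] at h2
        have h4 := isCut_ge.map_mul (isCut_ge.map_mul (nonneg_map_natCast ((k + (i + 1)).choose k))
          h3) (D.ge_val_sub t (i + 1))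
        refine lt_of_lt_of_le (WithTop.coe_lt_coe.2 ?_) h4
        push_cast at h2 ⊢
        linarith
      · rw [AddValuation.map_mul, AddValuation.map_mul, hasseDeriv_eq_zero (by omega)]
        simp
    have h5 := D.eq_truncated hlt
    have h6 : (hasseDeriv k H).eval (y t) = (hasseDeriv k H).eval u - ∑ i ∈ Finset.range H.natDegree,
        (hasseDeriv (i + 1) (hasseDeriv k H)).eval (y t) * (u - y t) ^ (i + 1) := by
      rw [hsum]; ring
    rw [h6, AddValuation.map_sub_eq_of_lt_left v (by rw [h5]; exact hrest), h5]

theorem line_lt (D : PseudoLimit v H u y β μ ε) {p : ℕ} (hp : p.Prime) [CharP L p]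
    {k j : ℕ} (hk : 1 ≤ k) (hkj : k < j) (hj : j ≤ H.natDegree) (hc : ¬ p ∣ j.choose k) :
    ∀ᶠ t in Filter.atTop, D.line k t < D.line j t :=
  D.line_lt_of_eventually_eq hp hk hkj hc (D.eventually_eq hp (by omega) hj)

/-- The lines are affine in `β t`, which increases, so their order changes at most once. -/
theorem line_total (D : PseudoLimit v H u y β μ ε) (k j : ℕ) :
    (∀ᶠ t in Filter.atTop, D.line k t ≤ D.line j t) ∨
      ∀ᶠ t in Filter.atTop, D.line j t ≤ D.line k t := by
  wlog hkj : k ≤ j generalizing k j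
  · exact (this j k (by omega)).symm
  by_cases h : ∃ t, D.line k t ≤ D.line j t
  · left
    obtain ⟨t₁, h1⟩ := h
    filter_upwards [Filter.eventually_ge_atTop t₁] with t ht
    have hβ : β t₁ ≤ β t := D.mono.monotone ht
    have hc : (k : ℝ) ≤ j := Nat.cast_le.2 hkj
    rw [line, line] at *
    nlinarith
  · right
    push Not at h
    exact Filter.Eventually.of_forall fun t => (h t).le

/-- The index whose line is eventually lowest. -/
theorem exists_lowest (D : PseudoLimit v H u y β μ ε) (s : Finset ℕ) (hs : s.Nonempty) :
    ∃ d ∈ s, ∀ k ∈ s, ∀ᶠ t in Filter.atTop, D.line d t ≤ D.line k t := by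
  induction hs using Finset.Nonempty.cons_induction with
  | singleton a => exact ⟨a, by simp, fun k hk => by simp at hk; subst hk; simp⟩
  | cons a s ha hs ih =>
    obtain ⟨d, hd, hmin⟩ := ih
    rcases D.line_total d a with h | h
    · refine ⟨d, by simp [hd], fun k hk => ?_⟩
      rcases Finset.mem_cons.1 hk with rfl | hk
      · exact h
      · exact hmin k hk
    · refine ⟨a, by simp, fun k hk => ?_⟩
      rcases Finset.mem_cons.1 hk with rfl | hk
      · exact Filter.Eventually.of_forall fun _ => le_rfl
      · filter_upwards [h, hmin k hk] with t h1 h2 using h1.trans h2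

/-- If all derivatives at `y t` were larger, the Taylor expansion around `y t`, evaluated at 0 with
v(y t) ≥ β 0, would make every coefficient of H larger than `exists_le` allows. -/
theorem exists_small_term (D : PseudoLimit v H u y β μ ε) (t : ℕ) :
    ∃ k ≤ H.natDegree, ∃ c : ℝ, v ((hasseDeriv k H).eval (y t)) = c ∧ c ≤ μ - k * β 0 := by
  have hy : Ge (β 0) (v (0 - y t)) := by
    have h1 : Ge (β 0) (v (u - y t)) := by
      rw [D.val_sub]; exact WithTop.coe_le_coe.2 (D.mono.monotone (Nat.zero_le t))
    have h2 : Ge (β 0) (v (u - y 0)) := by rw [D.val_sub]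
    rw [D.zero] at h2
    rw [show 0 - y t = (u - y t) - (u - 0) by ring]
    exact isCut_ge.map_sub h1 h2
  by_contra! hcon
  obtain ⟨k, hk⟩ := D.exists_le
  have hG : (hasseDeriv k H).natDegree ≤ H.natDegree :=
    (natDegree_hasseDeriv_le H k).trans (Nat.sub_le _ _)
  have hsum := eval_eq_sum_hasseDeriv (hasseDeriv k H) 0 (y t) hG
  have hcoe : H.coeff k = (hasseDeriv k H).eval 0 := by
    rw [← coeff_zero_eq_eval_zero, hasseDeriv_coeff]; simp
  have : Gt (μ - k * β 0) (v (H.coeff k)) := by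
    rw [hcoe, hsum]
    refine isCut_gt.map_sum _ _ fun i _ => ?_
    rw [hasseDeriv_hasseDeriv_eval]
    have h2 : Gt (μ - (k + i : ℕ) * β 0) (v ((hasseDeriv (k + i) H).eval (y t))) := by
      by_cases hN : k + i ≤ H.natDegree
      · rcases eq_or_ne (v ((hasseDeriv (k + i) H).eval (y t))) ⊤ with htop | htop
        · rw [htop]; exact WithTop.coe_lt_top _
        · obtain ⟨c, hc⟩ := WithTop.ne_top_iff_exists.1 htop
          rw [← hc]
          exact WithTop.coe_lt_coe.2 (hcon _ hN c hc.symm)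
      · rw [hasseDeriv_eq_zero (by omega)]; exact WithTop.coe_lt_top _
    have h3 := isCut_gt.map_mul (isCut_gt.map_mul h2 (nonneg_map_natCast ((k + i).choose k)))
      (Ge.map_pow hy i)
    rw [mul_comm (((k + i).choose k : ℕ) : L)]
    refine isCut_gt.anti h3 ?_
    push_cast; linarith
  exact absurd hk (not_le.2 this)

/-- If H(u) has value at least μ + ε, the small term already lies below it: by `window` its line
exceeds μ by less than ε at time t. -/
theorem unfixed (D : PseudoLimit v H u y β μ ε) (t : ℕ) :
    ∃ (k : ℕ) (c : ℝ), v ((hasseDeriv k H).eval (y t)) = c ∧ Gt (c + k * β t) (v (H.eval u)) := by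
  rcases D.large_or_unfixed t with h | h
  · obtain ⟨k, hkN, c, hc, hck⟩ := D.exists_small_term t
    refine ⟨k, c, hc, lt_of_lt_of_le (WithTop.coe_lt_coe.2 ?_) h⟩
    have hβ : β 0 ≤ β t := D.mono.monotone (Nat.zero_le t)
    have h2 : (k : ℝ) * (β t - β 0) ≤ H.natDegree * (β t - β 0) :=
      mul_le_mul_of_nonneg_right (Nat.cast_le.2 hkN) (sub_nonneg.2 hβ)
    have := D.window t
    linarith
  · exact h

theorem natDegree_pos (D : PseudoLimit v H u y β μ ε) : 1 ≤ H.natDegree := by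
  by_contra hN
  obtain ⟨k, c, hc, hk⟩ := D.unfixed 0
  rcases Nat.eq_zero_or_pos k with rfl | hk0
  · have : H.eval u = H.eval (y 0) := by
      rw [eq_C_of_natDegree_eq_zero (by omega : H.natDegree = 0)]; simp
    rw [hasseDeriv_zero', ← this] at hc
    rw [hc] at hk
    have := WithTop.coe_lt_coe.1 hk
    simp at this
  · rw [hasseDeriv_eq_zero (by omega)] at hc
    exact WithTop.top_ne_coe hc

/-- The non-constant terms of the Taylor expansion at `y t`. -/
def tail (H : L[X]) (u : L) (z : L) : L :=
  ∑ i ∈ Finset.range H.natDegree, (hasseDeriv (i + 1) H).eval z * (u - z) ^ (i + 1)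

theorem eval_eq_add_tail (H : L[X]) (u z : L) : H.eval u = H.eval z + tail H u z := by
  have := eval_eq_sum_hasseDeriv H u z le_rfl
  rw [Finset.sum_range_succ'] at this
  simp only [hasseDeriv_zero', pow_zero, mul_one] at this
  rw [this, tail]; ring

/-- Some non-constant term has a value at most `μ + N (β t - β 0)` and is smaller than the value
at `u`. -/
theorem exists_term_le (D : PseudoLimit v H u y β μ ε) (t : ℕ) :
    ∃ k, 1 ≤ k ∧ k ≤ H.natDegree ∧ ∃ c : ℝ, v ((hasseDeriv k H).eval (y t)) = c ∧
      c + k * β t < μ + ε := by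
  have hw := D.window t
  have hβ : β 0 ≤ β t := D.mono.monotone (Nat.zero_le t)
  obtain ⟨k, hkN, c, hc, hck⟩ := D.exists_small_term t
  have hN1 := D.natDegree_pos
  rcases Nat.eq_zero_or_pos k with rfl | hk0
  · rw [hasseDeriv_zero'] at hc
    have hcμ : c ≤ μ := by simpa using hck
    -- The small term is the constant one. If all non-constant terms were at least μ + ε, then H(u)
    -- and H(y t) would have the same value c and no term would lie below it, contrary to `unfixed`.
    by_contra! hcon
    have hε : 0 < ε := lt_of_le_of_lt (by have := sub_nonneg.2 hβ; positivity) hw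
    have htail : Gt c (v (tail H u (y t))) := by
      refine isCut_gt.map_sum _ _ fun i hi => ?_
      have h2 : Ge (μ + ε - (i + 1 : ℕ) * β t) (v ((hasseDeriv (i + 1) H).eval (y t))) := by
        rcases eq_or_ne (v ((hasseDeriv (i + 1) H).eval (y t))) ⊤ with htop | htop
        · rw [htop]; exact le_top
        · obtain ⟨c', hc'⟩ := WithTop.ne_top_iff_exists.1 htop
          have := hcon (i + 1) (by omega) (by simpa using hi) c' hc'.symm
          rw [← hc']
          exact WithTop.coe_le_coe.2 (by linarith)
      refine lt_of_lt_of_le (WithTop.coe_lt_coe.2 ?_) (isCut_ge.map_mul h2 (D.ge_val_sub t (i + 1)))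
      linarith
    have hval : v (H.eval u) = c := by
      rw [eval_eq_add_tail H u (y t), AddValuation.map_add_eq_of_lt_left v (by rw [hc]; exact htail),
        hc]
    obtain ⟨j, c', hc', hj⟩ := D.unfixed t
    rw [hval] at hj
    have hj' := WithTop.coe_lt_coe.1 hj
    rcases Nat.eq_zero_or_pos j with rfl | hj0
    · rw [hasseDeriv_zero', hc] at hc'
      have := WithTop.coe_injective hc'
      simp at hj'; linarith
    · by_cases hjN : j ≤ H.natDegree
      · have := hcon j hj0 hjN c' hc'
        linarith
      · rw [hasseDeriv_eq_zero (by omega)] at hc'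
        exact WithTop.top_ne_coe hc'
  · refine ⟨k, hk0, hkN, c, hc, ?_⟩
    have h2 : (k : ℝ) * (β t - β 0) ≤ H.natDegree * (β t - β 0) :=
      mul_le_mul_of_nonneg_right (Nat.cast_le.2 hkN) (sub_nonneg.2 hβ)
    linarith

/-- If the line `j` is above a less steep line `k` which is not below the line `d`, then
eventually the line `j` is above all values on the line `d`. -/
theorem eventually_line_lt_all (D : PseudoLimit v H u y β μ ε) {d k j : ℕ} (hkj : k < j)
    (h1 : ∀ᶠ t in Filter.atTop, D.line k t < D.line j t)
    (h2 : ∀ᶠ t in Filter.atTop, D.line d t ≤ D.line k t) :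
    ∀ᶠ t in Filter.atTop, ∀ s, D.line d s < D.line j t := by
  obtain ⟨t₁, ht₁⟩ := Filter.eventually_atTop.1 (h1.and h2)
  have hN1 : (1 : ℝ) ≤ H.natDegree := by exact_mod_cast D.natDegree_pos
  have hbdd : BddAbove (Set.range β) := by
    refine ⟨β 0 + ε, ?_⟩
    rintro _ ⟨t, rfl⟩
    have := D.window t
    have hβ : β 0 ≤ β t := D.mono.monotone (Nat.zero_le t)
    nlinarith
  have hlim := tendsto_atTop_ciSup D.mono.monotone hbdd
  set b := ⨆ t, β t with hb
  have hle : ∀ t, β t ≤ b := fun t => le_ciSup hbdd t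
  have hgap : (0 : ℝ) < β (t₁ + 1) - β t₁ := sub_pos.2 (D.mono (Nat.lt_succ_self _))
  -- For s > t line k rises from t to s by at most k (b - β t), where b is the supremum. Once this
  -- is less than β (t₁+1) - β t₁, it is compensated by the greater slope of line j between t₁ and
  -- t.
  have hlim2 : Filter.Tendsto (fun t => (k : ℝ) * (b - β t)) Filter.atTop (nhds 0) := by
    have := (hlim.const_sub b).const_mul (k : ℝ)
    simpa using this
  filter_upwards [Filter.eventually_ge_atTop (t₁ + 1), hlim2.eventually (gt_mem_nhds hgap)]
    with t ht hsmall s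
  have hdmono : ∀ s s', s ≤ s' → D.line d s ≤ D.line d s' := by
    intro s s' hs
    have := D.mono.monotone hs
    have hd : (0 : ℝ) ≤ d := Nat.cast_nonneg d
    rw [line, line]; nlinarith
  rcases le_or_gt s t with hst | hst
  · exact (hdmono _ _ hst).trans_lt ((ht₁ t (by omega)).2.trans_lt (ht₁ t (by omega)).1)
  · refine (ht₁ s (by omega)).2.trans_lt ?_
    have h3 := (ht₁ t₁ le_rfl).1
    have h4 : β (t₁ + 1) ≤ β t := D.mono.monotone ht
    have h5 := hle s
    have hk0 : (0 : ℝ) ≤ k := Nat.cast_nonneg k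
    have hjk : (k : ℝ) + 1 ≤ j := by exact_mod_cast hkj
    rw [line, line] at *
    nlinarith

/-- The structure of `H` near the limit: the eventually lowest non-constant term is the one of
index `p ^ e`, and the terms whose indices are larger or not powers of `p` are negligible. -/
theorem exists_pow (D : PseudoLimit v H u y β μ ε) {p : ℕ} (hp : p.Prime) [CharP L p] :
    ∃ e, p ^ e ≤ H.natDegree ∧ ∃ c : ℝ, (∀ s, c + (p ^ e : ℕ) * β s < μ + ε) ∧
      (∀ s, Gt (c + (p ^ e : ℕ) * β s) (v (H.eval u))) ∧
      ∀ᶠ t in Filter.atTop, v ((hasseDeriv (p ^ e) H).eval (y t)) = c ∧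
        (∀ k : ℕ, Ge (c + (p ^ e : ℕ) * β t - k * β t) (v ((hasseDeriv k H).eval (y t)))) ∧
        ∀ j : ℕ, 1 ≤ j → ((∀ e', j ≠ p ^ e') ∨ p ^ e < j) → ∀ s,
          Gt (c + (p ^ e : ℕ) * β s - j * β t) (v ((hasseDeriv j H).eval (y t))) := by
  obtain ⟨d, hd, hmin⟩ := D.exists_lowest (Finset.Icc 1 H.natDegree)
    (Finset.nonempty_Icc.2 D.natDegree_pos)
  obtain ⟨hd1, hdN⟩ := Finset.mem_Icc.1 hd
  have hmin' : ∀ k, 1 ≤ k → k ≤ H.natDegree → ∀ᶠ t in Filter.atTop, D.line d t ≤ D.line k t :=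
    fun k h1 h2 => hmin k (Finset.mem_Icc.2 ⟨h1, h2⟩)
  -- Otherwise some k < d with p not dividing the binomial coefficient would have a strictly lower
  -- line.
  have hpow : ∃ e, d = p ^ e := by
    by_contra! hcon
    obtain ⟨k, hk1, hkd, hkc⟩ := exists_not_dvd_choose hp (by omega) hcon
    obtain ⟨t, h1, h2⟩ := ((D.line_lt hp hk1 hkd hdN hkc).and (hmin' k hk1 (by omega))).exists
    linarith
  obtain ⟨e, rfl⟩ := hpow
  set d := p ^ e with hde
  have hall : ∀ᶠ t in Filter.atTop, ∀ k ∈ Finset.Icc 1 H.natDegree,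
      D.line d t ≤ D.line k t ∧ Ge (D.truncated k) (v ((hasseDeriv k H).eval (y t))) := by
    rw [Finset.eventually_all]
    intro k hk
    exact (hmin k hk).and (D.eventually_ge_self hp (Finset.mem_Icc.1 hk).1)
  have hdmono : ∀ s s', s ≤ s' → D.line d s ≤ D.line d s' := by
    intro s s' hs
    have := D.mono.monotone hs
    have hd : (0 : ℝ) ≤ (d : ℕ) := Nat.cast_nonneg d
    rw [line, line]; nlinarith
  have hterm : ∀ᶠ t in Filter.atTop, ∀ k : ℕ, 1 ≤ k →
      Ge (D.line d t - k * β t) (v ((hasseDeriv k H).eval (y t))) := by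
    filter_upwards [hall] with t ht k hk
    by_cases hkN : k ≤ H.natDegree
    · obtain ⟨h1, h2⟩ := ht k (Finset.mem_Icc.2 ⟨hk, hkN⟩)
      exact h2.anti (by rw [line, line] at h1; rw [line]; linarith)
    · rw [hasseDeriv_eq_zero (by omega)]; exact le_top
  have htail : ∀ᶠ t in Filter.atTop, Ge (D.line d t) (v (tail H u (y t))) := by
    filter_upwards [hterm] with t ht
    refine isCut_ge.map_sum _ _ fun i _ => ?_
    exact (isCut_ge.map_mul (ht (i + 1) (by omega)) (D.ge_val_sub t (i + 1))).anti (by linarith)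
  have hwin : ∀ s, D.line d s < μ + ε := by
    intro s
    obtain ⟨t₁, ht₁⟩ := Filter.eventually_atTop.1 hall
    refine (hdmono s (max s t₁) (le_max_left _ _)).trans_lt ?_
    obtain ⟨k, hk1, hkN, c, hc, hck⟩ := D.exists_term_le (max s t₁)
    obtain ⟨h1, h2⟩ := ht₁ (max s t₁) (le_max_right _ _) k (Finset.mem_Icc.2 ⟨hk1, hkN⟩)
    rw [hc] at h2
    have h3 := WithTop.coe_le_coe.1 h2
    refine h1.trans_lt (lt_of_le_of_lt ?_ hck)
    rw [line]; linarith
  -- The term below H(u) given by `unfixed` is either non-constant, hence on or above line d, or it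
  -- is H(y t); in the latter case the tail H(u) - H(y t) has its value, and the tail is at least
  -- line d.
  have hgt : ∀ s, Gt (D.line d s) (v (H.eval u)) := by
    intro s
    obtain ⟨t₁, ht₁⟩ := Filter.eventually_atTop.1 (hterm.and htail)
    obtain ⟨h1, h2⟩ := ht₁ (max s t₁) (le_max_right _ _)
    refine isCut_gt.anti ?_ (hdmono s (max s t₁) (le_max_left _ _))
    obtain ⟨k, c, hc, hk⟩ := D.unfixed (max s t₁)
    rcases Nat.eq_zero_or_pos k with rfl | hk0
    · rw [hasseDeriv_zero'] at hc
      by_contra hcon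
      simp only [Nat.cast_zero, zero_mul, add_zero] at hk
      have h3 : v (tail H u (y (max s t₁))) = c := by
        rw [← hc, ← AddValuation.map_neg,
          show -tail H u (y (max s t₁)) = H.eval (y (max s t₁)) - H.eval u by
            rw [eval_eq_add_tail H u (y (max s t₁))]; ring]
        exact AddValuation.map_sub_eq_of_lt_left v (by rw [hc]; exact hk)
      rw [h3] at h2
      exact hcon (lt_of_le_of_lt h2 hk)
    · have h3 := h1 k hk0
      rw [hc] at h3
      have h4 := WithTop.coe_le_coe.1 h3
      exact isCut_gt.anti hk (by linarith)
  -- An index that is not a power of p lies above a smaller index k by the binomial argument; an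
  -- index j > d lies above d because its line is steeper. Both give a margin valid for all s at
  -- once.
  have hbad : ∀ᶠ t in Filter.atTop, ∀ j ∈ Finset.Icc 1 H.natDegree,
      ((∀ e', j ≠ p ^ e') ∨ d < j) → ∀ s, D.line d s < D.line j t := by
    rw [Finset.eventually_all]
    intro j hj
    obtain ⟨hj1, hjN⟩ := Finset.mem_Icc.1 hj
    by_cases hjp : ∀ e', j ≠ p ^ e'
    · obtain ⟨k, hk1, hkj, hkc⟩ := exists_not_dvd_choose hp hj1 hjp
      filter_upwards [D.eventually_line_lt_all hkj (D.line_lt hp hk1 hkj hjN hkc)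
        (hmin' k hk1 (by omega))] with t ht _ using ht
    · by_cases hdj : d < j
      · have h1 : ∀ᶠ t in Filter.atTop, D.line d t < D.line j t := by
          obtain ⟨t₁, ht₁⟩ := Filter.eventually_atTop.1 (hmin' j hj1 hjN)
          filter_upwards [Filter.eventually_gt_atTop t₁] with t ht
          have h2 := ht₁ t₁ le_rfl
          have h3 : β t₁ < β t := D.mono ht
          have h4 : (d : ℝ) < j := Nat.cast_lt.2 hdj
          rw [line, line] at *
          nlinarith
        filter_upwards [D.eventually_line_lt_all hdj h1 (hmin' d hd1 hdN)] with t ht _ using ht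
      · filter_upwards with t h
        rcases h with h | h
        · exact absurd h hjp
        · exact absurd h hdj
  refine ⟨e, hdN, D.truncated d, hwin, hgt, ?_⟩
  filter_upwards [D.eventually_eq hp hd1 hdN, hterm, htail, hbad, hall] with t h1 h2 h3 h4 h5
  refine ⟨?_, ?_, ?_⟩
  · refine h1 ?_
    have h6 := hwin t
    have hβ : β 0 ≤ β t := D.mono.monotone (Nat.zero_le t)
    have hd0 : (0 : ℝ) ≤ (d : ℕ) := Nat.cast_nonneg d
    rw [line] at h6
    nlinarith
  · intro k
    rcases Nat.eq_zero_or_pos k with rfl | hk0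
    · rw [hasseDeriv_zero', show H.eval (y t) = H.eval u - tail H u (y t) by
        rw [eval_eq_add_tail H u (y t)]; ring]
      simp only [Nat.cast_zero, zero_mul, sub_zero]
      exact isCut_ge.map_sub (hgt t).le h3
    · exact h2 k hk0
  · intro j hj1 hj s
    by_cases hjN : j ≤ H.natDegree
    · have h6 := h4 j (Finset.mem_Icc.2 ⟨hj1, hjN⟩) hj s
      refine lt_of_lt_of_le (WithTop.coe_lt_coe.2 ?_) (h5 j (Finset.mem_Icc.2 ⟨hj1, hjN⟩)).2
      rw [line, line] at h6
      linarith
    · rw [hasseDeriv_eq_zero (by omega)]; exact WithTop.coe_lt_top _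

end PseudoLimit

end Kaplansky

/-! ### Sequences of polynomials of equal degree with bounded increasing values -/

section Chain

variable {K L : Type*} [Field K] [Field L] [Algebra K L] {v : AddValuation L (WithTop ℝ)} {x : L}

theorem natDegree_coeffAt_add_le {P : K[X]} (hP : P.Monic) {h : K[X]} {j : ℕ}
    (hj : coeffAt P h j ≠ 0) : (coeffAt P h j).natDegree + j * P.natDegree ≤ h.natDegree := by
  have h1 : j * P.natDegree ≤ h.natDegree := by
    by_contra hlt
    exact hj (coeffAt_eq_zero hP (not_le.1 hlt))
  have h2 : (coeffAt P h j).natDegree ≤ (h /ₘ P ^ j).natDegree := natDegree_modByMonic_le_left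
  rw [natDegree_div (hP.pow j), hP.natDegree_pow] at h2
  omega

theorem InU.pow_self {P : K[X]} (hP : P.Monic) (hP1 : 1 ≤ P.natDegree) {b : ℝ} (n : ℕ) :
    InU v x Ge P b (n * b) (P ^ n) := by
  have h1 : InU v x Ge P b 0 1 := by
    refine InU.of_degree_lt isCut_ge hP ?_ (by simp [val])
    rw [degree_one, degree_eq_natDegree hP.ne_zero]
    exact_mod_cast hP1
  have := h1.mul_pow isCut_ge hP n
  rwa [one_mul, zero_add] at this

/-- Change of the polynomial in an expansion. -/
theorem InU.change {P P' : K[X]} {b b' κ μ : ℝ} {h : K[X]} (H : InU v x Ge P b μ h)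
    (hP : P.Monic) (hP' : P'.Monic) (hd : P.degree = P'.degree) (hP1 : 1 ≤ P'.natDegree)
    (hC : Carry v x Ge P' κ) (hκ : κ ≤ b') (hκP : Ge κ (val v x P')) (hbb : b ≤ b')
    (hb : Ge b (val v x (P' - P))) : InU v x Ge P' b' μ h := by
  have hs := eq_sum_coeffAt hP h (h.natDegree + 1)
    (by rw [natDegree_eq_of_degree_eq hd]; nlinarith)
  -- P = P' - (P' - P), with both parts of value at least b; it remains to multiply out the powers
  -- of P.
  have hPs : InU v x Ge P' b' b P := by
    rw [show P = P' ^ 1 - (P' - P) by ring]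
    refine InU.sub isCut_ge hP' ((InU.pow_self hP' hP1 1).anti isCut_ge (by simpa using hbb)) ?_
    refine InU.of_degree_lt isCut_ge hP' ?_ hb
    exact degree_sub_lt_left hd.symm hP'.ne_zero (by rw [hP.leadingCoeff, hP'.leadingCoeff])
  rw [hs]
  refine InU.sum isCut_ge hP' _ _ fun j _ => ?_
  have h1 := hPs.pow hP' hP1 hC hκ hκP j
  have h2 : InU v x Ge P' b' (μ - j * b) (coeffAt P h j) :=
    InU.of_degree_lt isCut_ge hP' (by rw [← hd]; exact degree_coeffAt_lt hP h j) (H j)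
  exact (h2.mul isCut_ge hP' hP1 hC hκ hκP h1).anti isCut_ge (by linarith)

/-- A sequence of monic polynomials of the same degree and of increasing bounded values. -/
structure IsChain (v : AddValuation L (WithTop ℝ)) (x : L) (P : ℕ → K[X]) (β : ℕ → ℝ) : Prop where
  monic : ∀ t, (P t).Monic
  natDegree_eq : ∀ t, (P t).natDegree = (P 0).natDegree
  pos : 1 ≤ (P 0).natDegree
  val_eq : ∀ t, val v x (P t) = β t
  mono : StrictMono β
  bdd : BddAbove (Set.range β)
  carry : Carry v x Ge (P 0) (β 0)

namespace IsChain

variable {P : ℕ → K[X]} {β : ℕ → ℝ}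

theorem one_le (D : IsChain v x P β) (t : ℕ) : 1 ≤ (P t).natDegree := by
  rw [D.natDegree_eq]; exact D.pos

theorem degree_eq (D : IsChain v x P β) (s t : ℕ) : (P s).degree = (P t).degree := by
  rw [degree_eq_natDegree (D.monic s).ne_zero, degree_eq_natDegree (D.monic t).ne_zero,
    D.natDegree_eq s, D.natDegree_eq t]

theorem degree_sub_lt (D : IsChain v x P β) (s t : ℕ) : (P t - P s).degree < (P t).degree :=
  degree_sub_lt_left (D.degree_eq t s) (D.monic t).ne_zero
    (by rw [(D.monic t).leadingCoeff, (D.monic s).leadingCoeff])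

theorem ge_val_sub (D : IsChain v x P β) {s t : ℕ} (hst : s ≤ t) :
    Ge (β s) (val v x (P t - P s)) := by
  rw [val, map_sub]
  refine isCut_ge.map_sub ?_ (D.val_eq s).ge
  exact (WithTop.coe_le_coe.2 (D.mono.monotone hst)).trans (D.val_eq t).ge

/-- `P t - P 0` has smaller degree and value at least `β 0`, so one constant `β 0` serves all t. The
gap between `β t` and `β 0` later makes the errors from carries negligible. -/
theorem carry_all (D : IsChain v x P β) (t : ℕ) : Carry v x Ge (P t) (β 0) := by
  have := D.carry.add_right isCut_ge (D.monic 0) D.pos (y := P t - P 0)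
    (by rw [D.degree_eq 0 t]; exact D.degree_sub_lt 0 t) (D.ge_val_sub (Nat.zero_le t))
  rwa [add_sub_cancel] at this

theorem zero_le (D : IsChain v x P β) (t : ℕ) : β 0 ≤ β t := D.mono.monotone (Nat.zero_le t)

theorem ge_zero (D : IsChain v x P β) (t : ℕ) : Ge (β 0) (val v x (P t)) := by
  rw [D.val_eq]; exact WithTop.coe_le_coe.2 (D.zero_le t)

theorem inU_mono (D : IsChain v x P β) {s t : ℕ} (hst : s ≤ t) {μ : ℝ} {h : K[X]}
    (H : InU v x Ge (P s) (β s) μ h) : InU v x Ge (P t) (β t) μ h :=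
  H.change (D.monic s) (D.monic t) (D.degree_eq s t) (D.one_le t) (D.carry_all t) (D.zero_le t)
    (D.ge_zero t) (D.mono.monotone hst) (D.ge_val_sub hst)

/-- The value of `h` is the minimum of the values of the terms of its `P t`-expansion. -/
def Fixed (v : AddValuation L (WithTop ℝ)) (x : L) (P : ℕ → K[X]) (β : ℕ → ℝ) (t : ℕ)
    (h : K[X]) : Prop :=
  ∀ c, Ge c (val v x h) → InU v x Ge (P t) (β t) c h

theorem Fixed.mono (D : IsChain v x P β) {s t : ℕ} (hst : s ≤ t) {h : K[X]}
    (H : Fixed v x P β s h) : Fixed v x P β t h :=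
  fun c hc => D.inU_mono hst (H c hc)

theorem fixed_of_degree_lt (D : IsChain v x P β) {t : ℕ} {h : K[X]}
    (hd : h.degree < (P t).degree) : Fixed v x P β t h :=
  fun _ hc => InU.of_degree_lt isCut_ge (D.monic t) hd hc

/-- The variation of the values is eventually small. -/
theorem eventually_small (D : IsChain v x P β) (N : ℕ) {ε : ℝ} (hε : 0 < ε) :
    ∀ᶠ t in Filter.atTop, ∀ s, N * (β s - β t) < ε := by
  have hlim := tendsto_atTop_ciSup D.mono.monotone D.bdd
  set b := ⨆ t, β t
  have hle : ∀ t, β t ≤ b := fun t => le_ciSup D.bdd t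
  have hlim2 : Filter.Tendsto (fun t => (N : ℝ) * (b - β t)) Filter.atTop (nhds 0) := by
    have := (hlim.const_sub b).const_mul (N : ℝ)
    simpa using this
  filter_upwards [hlim2.eventually (gt_mem_nhds hε)] with t ht s
  refine lt_of_le_of_lt ?_ ht
  exact mul_le_mul_of_nonneg_left (by linarith [hle s]) (Nat.cast_nonneg N)

/-- The polynomial over `L` with the coefficients `(a i)(x)`. -/
def evalCoeffs (x : L) (M : ℕ) (a : ℕ → K[X]) : L[X] :=
  ∑ i ∈ Finset.range M, monomial i (aeval x (a i))

theorem coeff_evalCoeffs (M : ℕ) (a : ℕ → K[X]) (j : ℕ) :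
    (evalCoeffs x M a).coeff j = if j < M then aeval x (a j) else 0 := by
  simp [evalCoeffs, coeff_monomial]

theorem evalCoeffs_eval (M : ℕ) (a : ℕ → K[X]) (R : K[X]) :
    (evalCoeffs x M a).eval (aeval x R) = aeval x (∑ i ∈ Finset.range M, a i * R ^ i) := by
  simp [evalCoeffs, eval_finsetSum]

theorem hasseDeriv_evalCoeffs_eval (M : ℕ) (a : ℕ → K[X]) (k : ℕ) (y : L) :
    (hasseDeriv k (evalCoeffs x M a)).eval y =
      ∑ i ∈ Finset.range M, (i.choose k : L) * aeval x (a i) * y ^ (i - k) := by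
  simp [evalCoeffs, eval_finsetSum, hasseDeriv_monomial]

theorem hasseDeriv_evalCoeffs (M : ℕ) (a : ℕ → K[X]) (ha : ∀ i, M ≤ i → a i = 0) (k : ℕ) :
    hasseDeriv k (evalCoeffs x M a) =
      evalCoeffs x M fun i => ((i + k).choose k : K[X]) * a (i + k) := by
  ext n
  rw [hasseDeriv_coeff, coeff_evalCoeffs, coeff_evalCoeffs]
  split_ifs with h1 h2 h2
  · simp
  · omega
  · rw [ha _ (by omega)]; simp
  · simp

/-- Carries lose only `β 0`, while the line has slope `β t₀ ≥ β 1`. Each carry therefore gains at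
least `β 1 - β 0`, and coefficients change as in a polynomial ring up to errors larger by this
amount. -/
theorem taylor_approx (D : IsChain v x P β) {t₀ t : ℕ} (ht₀ : 1 ≤ t₀) (ht : t₀ ≤ t) {μ : ℝ}
    (M : ℕ) (a : ℕ → K[X]) (ha : ∀ i < M, (a i).degree < (P t₀).degree)
    (hμ : ∀ i < M, Ge (μ - i * β t₀) (val v x (a i))) (k : ℕ) :
    Ge (μ - k * β t₀ + (β 1 - β 0))
      (v (aeval x (coeffAt (P t) (∑ i ∈ Finset.range M, a i * P t₀ ^ i) k) -
        (hasseDeriv k (evalCoeffs x M a)).eval (aeval x (P t₀) - aeval x (P t)))) := by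
  have h1 : β 1 ≤ β t₀ := D.mono.monotone ht₀
  have h0 : β 0 ≤ β 1 := D.zero_le 1
  have hε : 0 ≤ β 1 - β 0 := by linarith
  have hCB : Carry v x (Gain (β 1 - β 0)) (P t) (β t₀) := by
    intro a b ha hb c c' hc hc'
    exact (D.carry_all t a b ha hb c c' hc hc').anti (by linarith)
  have := Carry.taylor_approx (isCut_gain hε) (D.monic t) (D.one_le t) (D.carry_all t)
    (D.zero_le t₀) (D.ge_zero t) hCB (b := β t₀)
    (by rw [D.val_eq]; exact WithTop.coe_le_coe.2 (D.mono.monotone ht))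
    (D.degree_sub_lt t₀ t) (D.ge_val_sub ht) M a
    (fun i hi => by rw [D.degree_eq t t₀]; exact ha i hi) hμ k
  rw [hasseDeriv_evalCoeffs_eval]
  rwa [show P t - (P t - P t₀) = P t₀ by ring, map_sub (aeval x) (P t), neg_sub] at this

/-- The structure of a polynomial whose value is never fixed, if all polynomials of smaller degree
have eventually fixed values. -/
theorem exists_pow_of_unfixed (D : IsChain v x P β) {p : ℕ} (hp : p.Prime) [CharP L p] {h : K[X]}
    (hunf : ∀ t, ¬ Fixed v x P β t h)
    (hlow : ∀ g : K[X], g.natDegree < h.natDegree → ∃ t, Fixed v x P β t g) :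
    ∃ e, p ^ e * (P 0).natDegree ≤ h.natDegree ∧ ∃ c : ℝ,
      (∀ s, Gt (c + (p ^ e : ℕ) * β s) (val v x h)) ∧
      ∀ᶠ t in Filter.atTop, val v x (coeffAt (P t) h (p ^ e)) = c ∧
        (∀ k : ℕ, Ge (c + (p ^ e : ℕ) * β t - k * β t) (val v x (coeffAt (P t) h k))) ∧
        ∀ j : ℕ, 1 ≤ j → ((∀ e', j ≠ p ^ e') ∨ p ^ e < j) → ∀ s,
          Gt (c + (p ^ e : ℕ) * β s - j * β t) (val v x (coeffAt (P t) h j)) := by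
  set ε := β 1 - β 0 with hε
  have hε0 : 0 < ε := sub_pos.2 (D.mono Nat.one_pos)
  -- From `t₀` on the values vary so little that even deg h times the variation stays below the gain
  -- ε of a carry.
  obtain ⟨t₀, hsmall, ht₀⟩ := ((D.eventually_small h.natDegree hε0).and
    (Filter.eventually_ge_atTop 1)).exists
  have hdeg : (P 0).natDegree ≤ h.natDegree := by
    by_contra hlt
    exact hunf 0 (D.fixed_of_degree_lt (degree_lt_degree (not_le.1 hlt)))
  set M := h.natDegree / (P 0).natDegree + 1 with hM
  have hMlt : h.natDegree < M * (P t₀).natDegree := by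
    rw [D.natDegree_eq t₀, hM, mul_comm]; exact Nat.lt_mul_div_succ _ D.pos
  set a := coeffAt (P t₀) h with ha
  have hsum : h = ∑ j ∈ Finset.range M, a j * P t₀ ^ j := eq_sum_coeffAt (D.monic t₀) h M hMlt
  have ha0 : ∀ i, M ≤ i → a i = 0 := fun i hi => coeffAt_eq_zero (D.monic t₀)
    (hMlt.trans_le (Nat.mul_le_mul_right _ hi))
  have had : ∀ i, (a i).degree < (P t₀).degree := degree_coeffAt_lt (D.monic t₀) h
  -- the value of the lowest term
  have hμ : ∃ μ : ℝ, (∀ i : ℕ, Ge (μ - i * β t₀) (val v x (a i))) ∧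
      ∃ i < M, val v x (a i) = ((μ - i * β t₀ : ℝ) : WithTop ℝ) := by
    have hne : ∃ i, val v x (a i) ≠ ⊤ := by
      by_contra! hcon
      exact hunf t₀ fun c _ k => by rw [← ha, hcon k]; exact le_top
    obtain ⟨i₀, hi₀⟩ := hne
    have hi₀M : i₀ < M := by
      by_contra hlt
      rw [ha0 _ (not_lt.1 hlt), val, map_zero, AddValuation.map_zero] at hi₀
      exact hi₀ rfl
    obtain ⟨i, hi, hmin⟩ := Finset.exists_min_image
      ((Finset.range M).filter fun i => val v x (a i) ≠ ⊤)
      (fun i => (val v x (a i)).untopD 0 + i * β t₀) ⟨i₀, by simp [hi₀M, hi₀]⟩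
    simp only [Finset.mem_filter, Finset.mem_range] at hi hmin
    refine ⟨(val v x (a i)).untopD 0 + i * β t₀, fun j => ?_, i, hi.1, ?_⟩
    · by_cases hj : val v x (a j) = ⊤
      · rw [hj]; exact le_top
      · have hjM : j < M := by
          by_contra hlt
          rw [ha0 _ (not_lt.1 hlt), val, map_zero, AddValuation.map_zero] at hj
          exact hj rfl
        have := hmin j ⟨hjM, hj⟩
        obtain ⟨c, hc⟩ := WithTop.ne_top_iff_exists.1 hj
        rw [← hc] at this ⊢
        rw [WithTop.untopD_coe] at this
        exact WithTop.coe_le_coe.2 (by linarith)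
    · obtain ⟨c, hc⟩ := WithTop.ne_top_iff_exists.1 hi.2
      rw [← hc, WithTop.untopD_coe]
      congr 1; ring
  obtain ⟨μ, hμ, iμ, hiμM, hiμ⟩ := hμ
  set H := evalCoeffs x M a with hH
  have hHdeg : H.natDegree * (P 0).natDegree ≤ h.natDegree := by
    have h1 : H.natDegree ≤ h.natDegree / (P 0).natDegree := by
      rw [natDegree_le_iff_coeff_eq_zero]
      intro j hj
      rw [hH, coeff_evalCoeffs, if_neg (by omega)]
    exact (Nat.mul_le_mul_right _ h1).trans (Nat.div_mul_le_self _ _)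
  have hHn : H.natDegree ≤ h.natDegree := by
    have := D.pos; nlinarith
  have hHu : H.eval (aeval x (P t₀)) = aeval x h := by
    rw [hH, evalCoeffs_eval, ← hsum]
  -- comparison of the expansions with the Taylor expansions of `H`
  have happ : ∀ t ≥ t₀, ∀ k : ℕ, Ge (μ - k * β t₀ + ε) (v (aeval x (coeffAt (P t) h k) -
      (hasseDeriv k H).eval (aeval x (P t₀) - aeval x (P t)))) := by
    intro t ht k
    have := D.taylor_approx ht₀ ht M a (fun i _ => had i) (fun i _ => hμ i) k
    rwa [← hsum] at this
  have hβt : ∀ t, β t₀ ≤ β (t₀ + t) := fun t => D.mono.monotone (Nat.le_add_right _ _)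
  -- With u = P_{t₀}(x) and y_t = P_{t₀}(x) - P_{t₀+t}(x), the difference u - y_t is P_{t₀+t}(x),
  -- and the derivatives of H at y_t approximate the coefficients of the P_{t₀+t}-expansion of h.
  have PL : PseudoLimit v H (aeval x (P t₀))
      (fun t => aeval x (P t₀) - aeval x (P (t₀ + t))) (fun t => β (t₀ + t)) μ ε := by
    refine ⟨fun s t hst => D.mono (by omega), fun t => ?_, fun t => ?_, by simp, ?_, ?_, ?_⟩
    · rw [sub_sub_cancel]; exact D.val_eq _
    · refine lt_of_le_of_lt ?_ (hsmall (t₀ + t))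
      exact mul_le_mul_of_nonneg_right (Nat.cast_le.2 hHn) (by have := hβt t; simp; linarith)
    · refine ⟨iμ, ?_⟩
      rw [hH, coeff_evalCoeffs, if_pos hiμM]
      exact hiμ.le
    · intro k hk
      set b : ℕ → K[X] := fun i => ((i + k).choose k : K[X]) * a (i + k) with hb
      -- `g` represents the k-th derivative of H. As k ≥ 1, its degree is smaller by at least deg P,
      -- so it is eventually fixed by `hlow`.
      set g := ∑ i ∈ Finset.range M, b i * P t₀ ^ i with hg
      have hgd : g.natDegree < h.natDegree := by
        have h1 : g.natDegree ≤ h.natDegree - (P 0).natDegree := by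
          refine natDegree_sum_le_of_forall_le _ _ fun i _ => ?_
          by_cases hai : a (i + k) = 0
          · simp [hb, hai]
          · have h2 := natDegree_coeffAt_add_le (D.monic t₀) hai
            have h3 : (b i * P t₀ ^ i).natDegree ≤ (a (i + k)).natDegree + i * (P t₀).natDegree := by
              refine natDegree_mul_le.trans ?_
              rw [(D.monic t₀).natDegree_pow]
              refine Nat.add_le_add_right (natDegree_mul_le.trans ?_) _
              rw [natDegree_natCast, zero_add]
            rw [D.natDegree_eq] at h2 h3
            have h4 : (i + 1) * (P 0).natDegree ≤ (i + k) * (P 0).natDegree :=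
              Nat.mul_le_mul_right _ (by omega)
            rw [add_mul, one_mul] at h4
            change (a (i + k)).natDegree + (i + k) * (P 0).natDegree ≤ h.natDegree at h2
            omega
        have := D.pos
        omega
      obtain ⟨t₁, ht₁⟩ := hlow g hgd
      refine ⟨t₁, fun t ht i c hc hcμ => ?_⟩
      have hfix := Fixed.mono D (show t₁ ≤ t₀ + t by omega) ht₁
      rw [hH, hasseDeriv_evalCoeffs M a ha0] at hc ⊢
      rw [evalCoeffs_eval] at hc
      have h1 := hfix c hc i
      have h2 := D.taylor_approx ht₀ (Nat.le_add_right t₀ t) (μ := μ - k * β t₀) M b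
        (fun i _ => degree_natCast_mul_lt (had _) _) (fun i _ => by
          rw [val, map_mul, map_natCast]
          exact (isCut_ge.map_mul (nonneg_map_natCast _) (hμ (i + k))).anti
            (by push_cast; linarith)) i
      have h3 := isCut_ge.map_sub h1 (h2.anti (c' := c - i * β (t₀ + t)) (by
        have := mul_le_mul_of_nonneg_left (hβt t) (Nat.cast_nonneg (α := ℝ) i)
        simp only [add_zero] at hcμ
        linarith))
      rwa [sub_sub_cancel] at h3
    · intro t
      have := hunf (t₀ + t)
      unfold Fixed InU at this
      push Not at this
      obtain ⟨c, hc, k, hk⟩ := this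
      obtain ⟨c', hc'⟩ := WithTop.ne_top_iff_exists.1 hk.ne_top
      rw [← hc'] at hk
      have hk' := WithTop.coe_lt_coe.1 hk
      have hk2 := mul_le_mul_of_nonneg_left (hβt t) (Nat.cast_nonneg (α := ℝ) k)
      rw [hHu]
      rcases le_or_gt (μ - k * β t₀ + ε) c' with hle | hlt
      · left
        exact Ge.anti hc (by linarith)
      · right
        refine ⟨k, c', ?_, lt_of_lt_of_le (WithTop.coe_lt_coe.2 (by linarith)) hc⟩
        have h1 := happ (t₀ + t) (Nat.le_add_right _ _) k
        have h2 : v (aeval x (coeffAt (P (t₀ + t)) h k)) < v (aeval x (coeffAt (P (t₀ + t)) h k) -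
            (hasseDeriv k H).eval (aeval x (P t₀) - aeval x (P (t₀ + t)))) := by
          refine lt_of_lt_of_le ?_ h1
          change val v x _ < _
          rw [← hc']; exact WithTop.coe_lt_coe.2 hlt
        have h3 := AddValuation.map_sub_eq_of_lt_left v h2
        rw [sub_sub_cancel] at h3
        rw [h3]; exact hc'.symm
  obtain ⟨e, heN, c, hwin, hgt, hev⟩ := PL.exists_pow hp
  refine ⟨e, (Nat.mul_le_mul_right _ heN).trans hHdeg, c, fun s => ?_, ?_⟩
  · have := hgt s
    rw [hHu] at this
    refine isCut_gt.anti this ?_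
    have : β s ≤ β (t₀ + s) := D.mono.monotone (Nat.le_add_left _ _)
    have := mul_le_mul_of_nonneg_left this (Nat.cast_nonneg (α := ℝ) (p ^ e))
    linarith
  · obtain ⟨T, hT⟩ := Filter.eventually_atTop.1 hev
    filter_upwards [Filter.eventually_ge_atTop (t₀ + T)] with t ht
    obtain ⟨s, rfl⟩ := Nat.exists_eq_add_of_le (show t₀ ≤ t by omega)
    obtain ⟨h1, h2, h3⟩ := hT s (by omega)
    have happ' := happ (t₀ + s) (Nat.le_add_right _ _)
    have hw0 := hwin 0
    have hws := hwin s
    simp only [add_zero] at hw0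
    refine ⟨?_, fun k => ?_, fun j hj1 hj r => ?_⟩
    · have h4 := happ' (p ^ e)
      have h5 : v ((hasseDeriv (p ^ e) H).eval (aeval x (P t₀) - aeval x (P (t₀ + s)))) <
          v (aeval x (coeffAt (P (t₀ + s)) h (p ^ e)) -
            (hasseDeriv (p ^ e) H).eval (aeval x (P t₀) - aeval x (P (t₀ + s)))) := by
        refine lt_of_lt_of_le ?_ h4
        rw [h1]; exact WithTop.coe_lt_coe.2 (by linarith)
      have h6 := AddValuation.map_add_eq_of_lt_left v h5
      rw [add_sub_cancel, h1] at h6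
      exact h6
    · have hk2 := mul_le_mul_of_nonneg_left (hβt s) (Nat.cast_nonneg (α := ℝ) k)
      have h4 := isCut_ge.map_add (h2 k) ((happ' k).anti
        (c' := c + (p ^ e : ℕ) * β (t₀ + s) - k * β (t₀ + s)) (by linarith))
      rwa [add_sub_cancel] at h4
    · have hk2 := mul_le_mul_of_nonneg_left (hβt s) (Nat.cast_nonneg (α := ℝ) j)
      have hwr := hwin r
      have hr : β r ≤ β (t₀ + r) := D.mono.monotone (Nat.le_add_left _ _)
      have hr2 := mul_le_mul_of_nonneg_left hr (Nat.cast_nonneg (α := ℝ) (p ^ e))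
      have h4 := isCut_gt.map_add (isCut_gt.anti (h3 j hj1 hj r)
        (c' := c + (p ^ e : ℕ) * β r - j * β (t₀ + s)) (by linarith))
        (lt_of_lt_of_le (WithTop.coe_lt_coe.2
        (show c + (p ^ e : ℕ) * β r - j * β (t₀ + s) < μ - j * β t₀ + ε by linarith)) (happ' j))
      rwa [add_sub_cancel] at h4

end IsChain

end Chain

/-! ### Weakly affine polynomials and the limit key polynomial -/

section Candidate

variable {K L : Type*} [Field K] [Field L] [Algebra K L] {v : AddValuation L (WithTop ℝ)} {x : L}

namespace IsChain

variable {P : ℕ → K[X]} {β : ℕ → ℝ}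

theorem degree_one_lt (D : IsChain v x P β) (t : ℕ) : (1 : K[X]).degree < (P t).degree := by
  rw [degree_one, degree_eq_natDegree (D.monic t).ne_zero]
  exact_mod_cast D.one_le t

/-- If `P t = f g` with factors of smaller degree, the carry of f g is 1, of value 0, whereas the
carry condition requires at least `β t - β 0 > 0`. -/
theorem irreducible (D : IsChain v x P β) {t : ℕ} (ht : 1 ≤ t) : Irreducible (P t) := by
  rw [(D.monic t).irreducible_iff_natDegree]
  refine ⟨fun h1 => ?_, fun f g hf hg hfg => ?_⟩
  · have := D.one_le t
    rw [h1, natDegree_one] at this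
    omega
  · have hn := congrArg natDegree hfg
    rw [hf.natDegree_mul hg] at hn
    by_contra hcon
    have hfd : f.degree < (P t).degree := degree_lt_degree (by omega)
    have hgd : g.degree < (P t).degree := degree_lt_degree (by omega)
    have hv : val v x f + val v x g = β t := by rw [← val_mul, hfg, D.val_eq]
    obtain ⟨hf', hg'⟩ := WithTop.add_ne_top.1 (hv.trans_ne WithTop.coe_ne_top)
    obtain ⟨c, hc⟩ := WithTop.ne_top_iff_exists.1 hf'
    obtain ⟨c', hc'⟩ := WithTop.ne_top_iff_exists.1 hg'
    have h1 := D.carry_all t f g hfd hgd c c' hc.le hc'.le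
    have h2 : (f * g) /ₘ P t = 1 := by
      rw [hfg]
      have := mul_divByMonic_cancel_left (1 : K[X]) (D.monic t)
      rwa [mul_one] at this
    rw [← hc, ← hc', ← WithTop.coe_add] at hv
    have hv' := WithTop.coe_injective hv
    rw [h2, val, map_one, AddValuation.map_one] at h1
    have h3 := nonpos_of_ge_zero h1
    have h4 : β 0 < β t := D.mono (by omega)
    linarith

/-- An approximate inverse modulo `P t` of a polynomial of degree `< deg P t`. -/
theorem exists_inverse (D : IsChain v x P β) {t : ℕ} (ht : 1 ≤ t) {a : K[X]}
    (had : a.degree < (P t).degree) {c : ℝ} (hc : val v x a = c) :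
    ∃ b : K[X], b.degree < (P t).degree ∧ val v x b = (-c : ℝ) ∧
      Ge (β t - β 0) (val v x (b * a - 1)) := by
  have hβ : β 0 < β t := D.mono (by omega)
  have ha0 : a ≠ 0 := by
    rintro rfl
    rw [val, map_zero, AddValuation.map_zero] at hc
    exact WithTop.top_ne_coe hc
  have hndvd : ¬ P t ∣ a := fun hdvd => not_lt.2 (degree_le_of_dvd hdvd ha0) had
  obtain ⟨s, b, hsb⟩ := ((D.irreducible ht).coprime_iff_not_dvd).2 hndvd
  have hm : (b %ₘ P t * a) %ₘ P t = 1 := by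
    have e : b %ₘ P t * a = 1 + P t * (-s - (b /ₘ P t) * a) := by
      rw [modByMonic_eq_sub_mul_div, ← hsb]; ring
    rw [e, add_modByMonic, self_mul_modByMonic (D.monic t), add_zero,
      mod_of_degree_lt (D.monic t) (D.degree_one_lt t)]
  set b' := b %ₘ P t with hb'
  have hbd : b'.degree < (P t).degree := degree_modByMonic_lt _ (D.monic t)
  set q := (b' * a) /ₘ P t with hq
  have e : b' * a = 1 + P t * q := by
    conv_lhs => rw [← modByMonic_add_div (b' * a) (P t), hm]
  have hvq : val v x (P t * q) = β t + val v x q := by rw [val_mul, D.val_eq]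
  have hcarry := fun cb (h : Ge cb (val v x b')) => D.carry_all t b' a hbd had cb c h hc.ge
  -- In b' a = 1 + P q the multiple of P has value larger than b' a by at least `β t - β 0`; hence
  -- b' a has the value of 1, and 1 is its dominant part.
  have hlarge : ∀ cb, Ge cb (val v x b') → Ge (cb + c + (β t - β 0)) (val v x (P t * q)) := by
    intro cb hcb
    rw [hvq]
    exact (Ge.add (le_refl (β t : WithTop ℝ)) (hcarry cb hcb)).anti (by linarith)
  have hbtop : val v x b' ≠ ⊤ := by
    intro htop
    have h1 : Ge 1 (val v x (P t * q)) :=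
      (hlarge (1 - c - (β t - β 0)) (by rw [htop]; exact le_top)).anti (by linarith)
    have h2 : val v x (b' * a) = ⊤ := by rw [val_mul, htop, top_add]
    have h3 : Ge 1 (v (1 : L)) := by
      have := isCut_ge.map_sub (c := 1) (y := aeval x (b' * a)) (z := aeval x (P t * q))
        (by change Ge 1 (val v x (b' * a)); rw [h2]; exact le_top) h1
      rwa [← map_sub, e, add_sub_cancel_right, map_one] at this
    rw [AddValuation.map_one] at h3
    have := nonpos_of_ge_zero h3
    linarith
  obtain ⟨cb, hcb⟩ := WithTop.ne_top_iff_exists.1 hbtop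
  have h1 := hlarge cb hcb.le
  have h2 : val v x (b' * a) = (cb + c : ℝ) := by rw [val_mul, ← hcb, hc, ← WithTop.coe_add]
  have h3 : v (aeval x (b' * a) - aeval x (P t * q)) = v (aeval x (b' * a)) := by
    refine AddValuation.map_sub_eq_of_lt_left v ?_
    change val v x _ < val v x _
    rw [h2]
    exact lt_of_lt_of_le (WithTop.coe_lt_coe.2 (by linarith)) h1
  rw [← map_sub, e, add_sub_cancel_right, map_one, AddValuation.map_one, ← e] at h3
  have h4 : (0 : ℝ) = cb + c := by
    have : ((0 : ℝ) : WithTop ℝ) = ((cb + c : ℝ) : WithTop ℝ) := by rw [← h2]; exact h3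
    exact WithTop.coe_injective this
  refine ⟨b', hbd, ?_, ?_⟩
  · rw [← hcb]; congr 1; linarith
  · rw [e, add_sub_cancel_left]
    exact h1.anti (by linarith)

/-- From a polynomial whose value is never fixed we obtain a weakly affine one of smaller or
equal degree. -/
theorem exists_weaklyAffine (D : IsChain v x P β) {p : ℕ} (hp : p.Prime) {h : K[X]} {e : ℕ} {c : ℝ}
    (hgt : ∀ s, Gt (c + (p ^ e : ℕ) * β s) (val v x h))
    (hev : ∀ᶠ t in Filter.atTop, val v x (coeffAt (P t) h (p ^ e)) = c ∧
        (∀ k : ℕ, Ge (c + (p ^ e : ℕ) * β t - k * β t) (val v x (coeffAt (P t) h k))) ∧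
        ∀ j : ℕ, 1 ≤ j → ((∀ e', j ≠ p ^ e') ∨ p ^ e < j) → ∀ s,
          Gt (c + (p ^ e : ℕ) * β s - j * β t) (val v x (coeffAt (P t) h j))) :
    ∃ (t : ℕ) (R : K[X]), coeffAt (P t) R (p ^ e) = 1 ∧
      (∀ j, p ^ e < j → coeffAt (P t) R j = 0) ∧
      (∀ j, 0 < j → coeffAt (P t) R j ≠ 0 → ∃ k : ℕ, j = p ^ k) ∧
      ∀ s, Gt ((p ^ e : ℕ) * β s) (val v x R) := by
  classical
  have hε0 : 0 < β 1 - β 0 := sub_pos.2 (D.mono Nat.one_pos)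
  obtain ⟨t, ⟨hc, hge, hbad⟩, hsmall, ht⟩ := (hev.and ((D.eventually_small (p ^ e) hε0).and
    (Filter.eventually_ge_atTop 1))).exists
  set d := p ^ e with hd
  have hd0 : 0 < d := pow_pos hp.pos e
  have hPt := D.monic t
  have hβ1 : β 1 ≤ β t := D.mono.monotone ht
  obtain ⟨b, hbd, hbv, hb1⟩ := D.exists_inverse ht (degree_coeffAt_lt hPt h d) hc
  set a := coeffAt (P t) h with ha
  -- `h` is multiplied by the approximate inverse `b` of its coefficient of index d = p^e, that
  -- digit is replaced by 1, the others are reduced modulo `P t`, and of the remaining indices only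
  -- 0 and the powers of p below d are kept. Each change affects the value at x only above d β s:
  -- the first two by the gain `β t - β 0` and the choice of t, the last by `hbad`.
  set S := (Finset.range d).filter fun j => j = 0 ∨ ∃ k, j = p ^ k with hS
  have hdS : d ∉ S := by simp [hS]
  set r : ℕ → K[X] := fun j => if j = d then 1 else (b * a j) %ₘ P t with hr
  have hrd : ∀ j, (r j).degree < (P t).degree := by
    intro j
    rw [hr]; dsimp only
    split_ifs
    · exact D.degree_one_lt t
    · exact degree_modByMonic_lt _ hPt
  set R := ∑ j ∈ insert d S, r j * P t ^ j with hR
  have hcoef : ∀ j, coeffAt (P t) R j = if j ∈ insert d S then r j else 0 :=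
    coeffAt_sum_mul_pow hPt _ r fun j _ => hrd j
  refine ⟨t, R, ?_, fun j hj => ?_, fun j hj0 hj => ?_, fun s => ?_⟩
  · rw [hcoef, if_pos (Finset.mem_insert_self _ _), hr]; simp
  · rw [hcoef, if_neg]
    simp only [hS, Finset.mem_insert, Finset.mem_filter, Finset.mem_range]
    omega
  · rw [hcoef] at hj
    by_cases hjS : j ∈ insert d S
    · rcases Finset.mem_insert.1 hjS with rfl | hjS
      · exact ⟨e, rfl⟩
      · rcases (Finset.mem_filter.1 hjS).2 with rfl | h'
        · exact absurd hj0 (lt_irrefl _)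
        · exact h'
    · rw [if_neg hjS] at hj; exact absurd rfl hj
  · set M := h.natDegree + d + 1 with hM
    have hsum : h = ∑ j ∈ Finset.range M, a j * P t ^ j :=
      eq_sum_coeffAt hPt h M (by have := D.one_le t; nlinarith)
    have hsub : insert d S ⊆ Finset.range M := by
      intro j hj
      simp only [hS, Finset.mem_insert, Finset.mem_filter, Finset.mem_range] at hj ⊢
      omega
    have hPj : ∀ j : ℕ, Ge (j * β t) (v (aeval x (P t) ^ j)) :=
      Ge.map_pow (show Ge (β t) (val v x (P t)) from (D.val_eq t).ge)
    have key : R = b * h - ∑ j ∈ Finset.range M,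
        (b * a j - if j ∈ insert d S then r j else 0) * P t ^ j := by
      rw [hsum, Finset.mul_sum, ← Finset.sum_sub_distrib, hR, ← Finset.sum_subset hsub]
      · refine Finset.sum_congr rfl fun j hj => ?_
        rw [if_pos hj]; ring
      · intro j _ hj
        rw [if_neg hj]; ring
    have hsm := hsmall s
    rw [key, val, map_sub]
    refine isCut_gt.map_sub ?_ ?_
    · rw [map_mul (aeval x), mul_comm (aeval x b)]
      exact isCut_gt.anti (isCut_gt.map_mul (hgt s) hbv.ge) (by linarith)
    · rw [map_sum]
      refine isCut_gt.map_sum _ _ fun j _ => ?_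
      rw [map_mul, map_pow]
      by_cases hjS : j ∈ insert d S
      · rw [if_pos hjS]
        by_cases hjd : j = d
        · have h1 := isCut_ge.map_mul (y := aeval x (b * a d - 1)) hb1 (hPj d)
          simp only [hr, hjd, if_pos]
          exact lt_of_lt_of_le (WithTop.coe_lt_coe.2 (by linarith)) h1
        · have hq : b * a j - r j = P t * ((b * a j) /ₘ P t) := by
            simp only [hr, if_neg hjd]
            rw [modByMonic_eq_sub_mul_div]; ring
          have h1 := D.carry_all t b (a j) hbd (degree_coeffAt_lt hPt h j) _ _ hbv.ge (hge j)
          have h2 := isCut_ge.map_mul (isCut_ge.map_mul (y := aeval x (P t)) (D.val_eq t).ge h1)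
            (hPj j)
          rw [hq, map_mul (aeval x)]
          exact lt_of_lt_of_le (WithTop.coe_lt_coe.2 (by linarith)) h2
      · rw [if_neg hjS, sub_zero]
        have hj : 1 ≤ j ∧ ((∀ e', j ≠ p ^ e') ∨ d < j) := by
          simp only [hS, Finset.mem_insert, Finset.mem_filter, Finset.mem_range, not_or,
            not_and, not_exists] at hjS
          obtain ⟨h1, h2⟩ := hjS
          rcases lt_or_ge d j with h3 | h3
          · exact ⟨by omega, Or.inr h3⟩
          · have h4 := h2 (by omega)
            exact ⟨by omega, Or.inl h4.2⟩
        have h1 := isCut_gt.map_mul (isCut_gt.map_mul (hbad j hj.1 hj.2 s) hbv.ge) (hPj j)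
        rw [map_mul (aeval x), mul_comm (aeval x b)]
        exact isCut_gt.anti h1 (by linarith)

/-- The hypotheses on a limit key polynomial `R` of degree `p ^ e deg P`. -/
theorem limit_fixed (D : IsChain v x P β) {p : ℕ} (hp : p.Prime) [CharP L p] {e : ℕ} {R : K[X]}
    (hR : R.Monic) (hRd : R.natDegree = p ^ e * (P 0).natDegree)
    (hRv : ∀ s, Gt ((p ^ e : ℕ) * β s) (val v x R))
    (hmin : ∀ e' < e, ∀ (t : ℕ) (R' : K[X]), coeffAt (P t) R' (p ^ e') = 1 →
      (∀ j, p ^ e' < j → coeffAt (P t) R' j = 0) →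
      (∀ j, 0 < j → coeffAt (P t) R' j ≠ 0 → ∃ k : ℕ, j = p ^ k) →
      ¬ ∀ s, Gt ((p ^ e' : ℕ) * β s) (val v x R')) :
    (∀ h : K[X], h.degree < R.degree → ∃ t, Fixed v x P β t h) ∧
      ∀ᶠ t in Filter.atTop, InU v x Ge (P t) (β t) ((p ^ e : ℕ) * β t) R := by
  -- A polynomial of least degree that is never fixed would yield a weakly affine candidate of
  -- exponent e' with p^e' deg P ≤ deg h < p^e deg P, contrary to the minimality of e.
  have hlow : ∀ h : K[X], h.natDegree < R.natDegree → ∃ t, Fixed v x P β t h := by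
    intro h
    induction hn : h.natDegree using Nat.strong_induction_on generalizing h with
    | _ n ih =>
      intro hnR
      by_contra! hunf
      obtain ⟨e', hle, c, hgt, hev⟩ := D.exists_pow_of_unfixed hp hunf
        (fun g hg => ih _ (hn ▸ hg) g rfl ((hn ▸ hg : g.natDegree < n).trans hnR))
      have hee : e' < e := by
        have h1 : p ^ e' * (P 0).natDegree < p ^ e * (P 0).natDegree := by omega
        exact (Nat.pow_lt_pow_iff_right hp.one_lt).1 (lt_of_mul_lt_mul_right h1 (Nat.zero_le _))
      obtain ⟨t, R', h1, h2, h3, h4⟩ := D.exists_weaklyAffine hp hgt hev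
      exact hmin e' hee t R' h1 h2 h3 h4
  have hRpos : 1 ≤ R.natDegree := by
    rw [hRd]; exact Nat.mul_pos (pow_pos hp.pos e) D.pos
  refine ⟨fun h hh => hlow h (natDegree_lt_of_degree_lt hRpos hh), ?_⟩
  have hone : ∀ t, coeffAt (P t) R (p ^ e) = 1 := by
    intro t
    have h0 : R.natDegree / (P t).natDegree = p ^ e := by
      rw [hRd, D.natDegree_eq t]; exact Nat.mul_div_cancel _ D.pos
    have h1 := leadingCoeff_coeffAt_natDegree_div (D.monic t) (D.one_le t) hR.ne_zero
    have h2 := natDegree_coeffAt_natDegree_div (D.monic t) (D.one_le t) R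
    rw [h0] at h1 h2
    rw [hRd, D.natDegree_eq t, Nat.sub_self] at h2
    exact (Monic.natDegree_eq_zero (h1.trans hR.leadingCoeff)).1 h2
  -- The digit of R of index p^e is 1 for every t, and its term has value p^e β t, less than that of
  -- R.
  have hunf : ∀ t, ¬ Fixed v x P β t R := by
    intro t hfix
    rcases eq_or_ne (val v x R) ⊤ with htop | htop
    · have := hfix ((p ^ e : ℕ) * β t + 1) (by rw [htop]; exact le_top) (p ^ e)
      rw [hone, val, map_one, AddValuation.map_one] at this
      have h3 := nonpos_of_ge_zero this
      linarith
    · obtain ⟨c, hc⟩ := WithTop.ne_top_iff_exists.1 htop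
      have h2 := hRv t
      rw [← hc] at h2
      have h2' := WithTop.coe_lt_coe.1 h2
      have := hfix c hc.le (p ^ e)
      rw [hone, val, map_one, AddValuation.map_one] at this
      have h3 := nonpos_of_ge_zero this
      linarith
  obtain ⟨e', hle, c, hgt, hev⟩ := D.exists_pow_of_unfixed hp hunf hlow
  have hee : e' ≤ e := by
    rw [hRd] at hle
    exact (Nat.pow_le_pow_iff_right hp.one_lt).1 (le_of_mul_le_mul_right hle D.pos)
  rcases lt_or_eq_of_le hee with hlt | rfl
  · obtain ⟨t, R', h1, h2, h3, h4⟩ := D.exists_weaklyAffine hp hgt hev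
    exact absurd h4 (hmin e' hlt t R' h1 h2 h3)
  · filter_upwards [hev] with t ht k
    obtain ⟨hc, hge, -⟩ := ht
    rw [hone, val, map_one, AddValuation.map_one] at hc
    have hc0 : c = 0 := by
      have : ((0 : ℝ) : WithTop ℝ) = c := hc
      exact (WithTop.coe_injective this).symm
    exact (hge k).anti (by rw [hc0]; linarith)

end IsChain

end Candidate

/-! ### Computing with initial forms -/

section GradedLemmas

variable {F Γ : Type*} [Field F] [AddCommGroup Γ] [LinearOrder Γ] [IsOrderedAddMonoid Γ]
  {v : AddValuation F (WithTop Γ)}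

/-- The class of `y` in `P_β / P_{β+}`. -/
def cls (v : AddValuation F (WithTop Γ)) (β : Γ) (y : F) (h : (β : WithTop Γ) ≤ v y) : Gr v :=
  Ideal.Quotient.mk (reesIdeal v) ⟨AddMonoidAlgebra.single β y, single_mem_rees v h⟩

theorem cls_eq_zero_iff {β : Γ} {y : F} (h : (β : WithTop Γ) ≤ v y) :
    cls v β y h = 0 ↔ (β : WithTop Γ) < v y := by
  rw [cls, Ideal.Quotient.eq_zero_iff_mem]
  constructor
  · intro H
    have := H β
    rwa [AddMonoidAlgebra.coeff_single, Finsupp.single_eq_same] at this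
  · intro H γ
    rw [AddMonoidAlgebra.coeff_single, Finsupp.single_apply]
    split_ifs with h'
    · subst h'; exact H
    · rw [AddValuation.map_zero]; exact WithTop.coe_lt_top _

theorem cls_mul {β β' : Γ} {y y' : F} (h : (β : WithTop Γ) ≤ v y) (h' : (β' : WithTop Γ) ≤ v y')
    (h'' : ((β + β' : Γ) : WithTop Γ) ≤ v (y * y')) :
    cls v β y h * cls v β' y' h' = cls v (β + β') (y * y') h'' := by
  rw [cls, cls, cls, ← map_mul]
  congr 1
  ext1
  exact AddMonoidAlgebra.single_mul_single _ _ _ _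

theorem cls_sum {ι : Type*} (s : Finset ι) {β : Γ} (y : ι → F)
    (h : ∀ j, (β : WithTop Γ) ≤ v (y j)) (h' : (β : WithTop Γ) ≤ v (∑ j ∈ s, y j)) :
    ∑ j ∈ s, cls v β (y j) (h j) = cls v β (∑ j ∈ s, y j) h' := by
  simp only [cls]
  rw [← map_sum]
  congr 1
  ext1
  rw [AddSubmonoidClass.coe_finsetSum]
  exact (map_sum (AddMonoidAlgebra.singleAddHom β) y s).symm

theorem init_of_eq {β : Γ} {y : F} (h : v y = β) : init v y = cls v β y h.ge := by
  have hne : v y ≠ ⊤ := by rw [h]; exact WithTop.coe_ne_top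
  have hβ : (v y).untop hne = β := by
    rw [← WithTop.coe_inj, WithTop.coe_untop, h]
  rw [init, dif_neg hne, cls]
  congr 2
  rw [hβ]

theorem init_of_top {y : F} (h : v y = ⊤) : init v y = 0 := by
  rw [init, dif_pos h]

theorem init_eq_zero_iff {y : F} : init v y = 0 ↔ v y = ⊤ := by
  refine ⟨fun h => ?_, init_of_top⟩
  by_contra hne
  obtain ⟨β, hβ⟩ := WithTop.ne_top_iff_exists.1 hne
  rw [init_of_eq hβ.symm, cls_eq_zero_iff, hβ] at h
  exact lt_irrefl _ h

theorem init_zero : init v 0 = 0 := init_of_top (AddValuation.map_zero v)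

theorem init_mul (y y' : F) : init v (y * y') = init v y * init v y' := by
  by_cases h : v y = ⊤
  · rw [init_of_top h, zero_mul, init_of_top (by rw [AddValuation.map_mul, h, top_add])]
  by_cases h' : v y' = ⊤
  · rw [init_of_top h', mul_zero, init_of_top (by rw [AddValuation.map_mul, h', add_top])]
  obtain ⟨β, hβ⟩ := WithTop.ne_top_iff_exists.1 h
  obtain ⟨β', hβ'⟩ := WithTop.ne_top_iff_exists.1 h'
  have hmul : v (y * y') = ((β + β' : Γ) : WithTop Γ) := by
    rw [AddValuation.map_mul, ← hβ, ← hβ', WithTop.coe_add]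
  rw [init_of_eq hβ.symm, init_of_eq hβ'.symm, init_of_eq hmul, cls_mul]

theorem init_one : init v 1 = 1 := by
  have h : v 1 = ((0 : Γ) : WithTop Γ) := by rw [AddValuation.map_one]; rfl
  rw [init_of_eq h, cls]
  exact map_one (Ideal.Quotient.mk (reesIdeal v))

theorem init_pow (y : F) (n : ℕ) : init v (y ^ n) = init v y ^ n := by
  induction n with
  | zero => rw [pow_zero, pow_zero, init_one]
  | succ n ih => rw [pow_succ, pow_succ, init_mul, ih]

theorem sum_init_of_eq {ι : Type*} (s : Finset ι) {β : Γ} (y : ι → F)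
    (h : ∀ j ∈ s, v (y j) = β) (h' : (β : WithTop Γ) ≤ v (∑ j ∈ s, y j)) :
    ∑ j ∈ s, init v (y j) = cls v β (∑ j ∈ s, y j) h' := by
  have h2 : (β : WithTop Γ) ≤ v (∑ j : s, y j) := by
    rwa [Finset.sum_coe_sort s (fun j => y j)]
  have h1 := cls_sum (v := v) (Finset.univ : Finset s) (β := β) (fun j => y j)
    (fun j => (h j j.2).ge) h2
  rw [← Finset.sum_coe_sort s (fun j => init v (y j)),
    Finset.sum_congr rfl fun (j : s) _ => init_of_eq (h j j.2), h1]
  congr 1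
  exact Finset.sum_coe_sort s (fun j => y j)

/-- The homogeneous components of a relation between initial forms. -/
theorem lt_map_sum_of_sum_init_eq_zero {ι : Type*} (s : Finset ι) (y : ι → F)
    (h : ∑ j ∈ s, init v (y j) = 0) (β : Γ) :
    (β : WithTop Γ) < v (∑ j ∈ s with v (y j) = β, y j) := by
  classical
  have key : ∀ y : F, ∃ r : rees v, Ideal.Quotient.mk (reesIdeal v) r = init v y ∧
      r.1.coeff β = if v y = β then y else 0 := by
    intro y
    by_cases hy : v y = ⊤
    · refine ⟨0, by rw [map_zero, init_of_top hy], ?_⟩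
      rw [if_neg (by rw [hy]; exact WithTop.top_ne_coe)]; rfl
    · obtain ⟨γ, hγ⟩ := WithTop.ne_top_iff_exists.1 hy
      refine ⟨⟨AddMonoidAlgebra.single γ y, single_mem_rees v hγ.le⟩,
        (init_of_eq hγ.symm).symm, ?_⟩
      simp only
      rw [AddMonoidAlgebra.coeff_single, Finsupp.single_apply, ← hγ]
      simp only [WithTop.coe_inj]
  choose r hr hrc using key
  simp only [← hr] at h
  rw [← map_sum, Ideal.Quotient.eq_zero_iff_mem] at h
  have h1 := h β
  rw [AddSubmonoidClass.coe_finsetSum, AddMonoidAlgebra.coeff_sum, Finsupp.finsetSum_apply] at h1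
  simp only [hrc] at h1
  rwa [← Finset.sum_filter] at h1

/-- The homogeneous component of degree v(y) in the relation in(y) + in(-y') = 0, with `Bool`
indexing the two summands. -/
theorem eq_and_lt_of_init_eq {y y' : F} (h : init v y = init v y') (hy : v y ≠ ⊤) :
    v y = v y' ∧ v y < v (y - y') := by
  classical
  have hneg : init v (-y') = -init v y' := by
    by_cases hy' : v y' = ⊤
    · rw [init_of_top hy', init_of_top (by rw [AddValuation.map_neg, hy']), neg_zero]
    · obtain ⟨γ, hγ⟩ := WithTop.ne_top_iff_exists.1 hy'
      have h2 : v (-y') = γ := by rw [AddValuation.map_neg, hγ]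
      rw [init_of_eq hγ.symm, init_of_eq h2, cls, cls, ← map_neg]
      congr 1
      ext1
      exact AddMonoidAlgebra.single_neg _ _
  obtain ⟨β, hβ⟩ := WithTop.ne_top_iff_exists.1 hy
  have h1 : ∑ j : Bool, init v (bif j then y else -y') = 0 := by
    simp [hneg, h]
  have h2 := lt_map_sum_of_sum_init_eq_zero Finset.univ (fun j : Bool => bif j then y else -y')
    h1 β
  rw [Finset.sum_filter] at h2
  simp only [Fintype.sum_bool, cond_true, cond_false, AddValuation.map_neg, ← hβ] at h2
  by_cases hy' : v y' = β
  · refine ⟨by rw [hy', hβ], ?_⟩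
    simp only [if_pos, hy', ← sub_eq_add_neg] at h2
    rwa [← hβ]
  · simp only [if_pos, if_neg hy', add_zero, ← hβ] at h2
    exact absurd h2 (lt_irrefl _)

theorem init_sum {ι : Type*} (s : Finset ι) (y : ι → F) {β : Γ}
    (h : ∀ j ∈ s, (β : WithTop Γ) ≤ v (y j)) (h' : v (∑ j ∈ s, y j) = β) :
    init v (∑ j ∈ s, y j) = ∑ j ∈ s with v (y j) = β, init v (y j) := by
  classical
  have hrest : (β : WithTop Γ) < v (∑ j ∈ s with ¬ v (y j) = β, y j) := by
    refine AddValuation.map_lt_sum v WithTop.coe_ne_top fun j hj => ?_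
    obtain ⟨hj1, hj2⟩ := Finset.mem_filter.1 hj
    exact lt_of_le_of_ne (h j hj1) (Ne.symm hj2)
  have hsplit := Finset.sum_filter_add_sum_filter_not s (fun j => v (y j) = β) y
  have hmain : (β : WithTop Γ) ≤ v (∑ j ∈ s with v (y j) = β, y j) :=
    AddValuation.map_le_sum v fun j hj => (Finset.mem_filter.1 hj).2.ge
  rw [sum_init_of_eq _ y (fun j hj => (Finset.mem_filter.1 hj).2) hmain, init_of_eq h', ← sub_eq_zero]
  have hle := h'.ge
  rw [← hsplit] at h'
  have : cls v β (∑ j ∈ s, y j) hle - cls v β (∑ j ∈ s with v (y j) = β, y j) hmain =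
      cls v β (∑ j ∈ s with ¬ v (y j) = β, y j) hrest.le := by
    rw [sub_eq_iff_eq_add, cls, cls, cls, ← map_add]
    congr 1
    ext1
    simp only
    rw [← hsplit, AddMonoidAlgebra.single_add, add_comm]
    rfl
  rw [this, cls_eq_zero_iff]
  exact hrest

end GradedLemmas

/-! ### Liftings of the minimal polynomial of an initial form -/

section Lifting

variable {K L Γ : Type*} [Field K] [Field L] [Algebra K L]
  [AddCommGroup Γ] [LinearOrder Γ] [IsOrderedAddMonoid Γ]
  {v : AddValuation L (WithTop Γ)} {x : L}

theorem subset_saturation (A : Subring (Gr v)) {g : Gr v} (hg : g ∈ A) : g ∈ saturation v A :=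
  ⟨1, one_ne_zero, by rw [init_one]; exact A.one_mem, by rwa [init_one, one_mul]⟩

theorem inx_mul (h h' : K[X]) : inx v x (h * h') = inx v x h * inx v x h' := by
  rw [inx, map_mul, init_mul]; rfl

theorem inx_pow (h : K[X]) (n : ℕ) : inx v x (h ^ n) = inx v x h ^ n := by
  rw [inx, map_pow, init_pow]; rfl

theorem inx_eq_zero_iff {h : K[X]} : inx v x h = 0 ↔ val v x h = ⊤ := init_eq_zero_iff

/-- Initial forms of polynomials whose values are those of their expansions. -/
theorem inx_mem_of_fixed {A : Subring (Gr v)} {P : K[X]} (hP : P.Monic) (hP1 : 1 ≤ P.natDegree)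
    (hA : ∀ a : K[X], a.degree < P.degree → inx v x a ∈ A) (hPA : inx v x P ∈ A) {h : K[X]}
    (hfix : ∀ j : ℕ, val v x h ≤ val v x (coeffAt P h j * P ^ j)) : inx v x h ∈ A := by
  by_cases htop : val v x h = ⊤
  · rw [inx_eq_zero_iff.2 htop]; exact A.zero_mem
  obtain ⟨β, hβ⟩ := WithTop.ne_top_iff_exists.1 htop
  have hs := eq_sum_coeffAt hP h (h.natDegree + 1) (by nlinarith)
  have hs' : aeval x h = ∑ j ∈ Finset.range (h.natDegree + 1), aeval x (coeffAt P h j * P ^ j) := by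
    conv_lhs => rw [hs]
    rw [map_sum]
  have := init_sum (v := v) (Finset.range (h.natDegree + 1))
    (fun j => aeval x (coeffAt P h j * P ^ j)) (β := β) (fun j _ => hβ.le.trans (hfix j))
    (by rw [← hs']; exact hβ.symm)
  rw [inx, hs', this]
  refine A.sum_mem fun j _ => ?_
  change inx v x _ ∈ A
  rw [inx_mul, inx_pow]
  exact A.mul_mem (hA _ (degree_coeffAt_lt hP h j)) (A.pow_mem hPA j)

/-- The values of the polynomials of degree less than that of a lifting of the minimal polynomial
of `in Q`. -/
theorem IsMinPoly.le_val_term {A : Subring (Gr v)} {P : K[X]} (hP : P.Monic)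
    (hA : ∀ a : K[X], a.degree < P.degree → inx v x a ∈ A) {g : (Gr v)[X]}
    (hg : IsMinPoly (saturation v A) (inx v x P) g) {h : K[X]}
    (hd : h.natDegree < g.natDegree * P.natDegree) (j : ℕ) :
    val v x h ≤ val v x (coeffAt P h j * P ^ j) := by
  classical
  set N := g.natDegree with hN
  set y : ℕ → L := fun j => aeval x (coeffAt P h j * P ^ j) with hy
  have hs : aeval x h = ∑ j ∈ Finset.range N, y j := by
    conv_lhs => rw [eq_sum_coeffAt hP h N hd]
    rw [map_sum]
  change v (aeval x h) ≤ v (y j)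
  by_contra! hcon
  have hjN : j ∈ Finset.range N := by
    by_contra hjN
    have h0 : y j = 0 := by
      rw [hy]; simp only
      rw [coeffAt_eq_zero hP (hd.trans_le (Nat.mul_le_mul_right _ (by simpa using hjN))), zero_mul,
        map_zero]
    rw [h0, AddValuation.map_zero] at hcon
    exact not_top_lt hcon
  obtain ⟨i, hiN, hmin⟩ := Finset.exists_min_image (Finset.range N) (fun j => v (y j)) ⟨j, hjN⟩
  have hilt : v (y i) < v (aeval x h) := (hmin j hjN).trans_lt hcon
  obtain ⟨m, hm⟩ := WithTop.ne_top_iff_exists.1 hilt.ne_top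
  -- If h(x) had a value above the minimum m, the terms of value m would cancel in the graded
  -- algebra, and their coefficients would form a relation `q` for `in P` of degree less than that
  -- of g.
  set S := (Finset.range N).filter fun j => v (y j) = m with hS
  set q : (Gr v)[X] := ∑ j ∈ S, C (inx v x (coeffAt P h j)) * X ^ j with hq
  have hcoef : ∀ k, q.coeff k = if k ∈ S then inx v x (coeffAt P h k) else 0 := by
    intro k
    simp [hq, coeff_X_pow]
  have hSsum : (m : WithTop Γ) < v (∑ j ∈ S, y j) := by
    have hsplit := Finset.sum_filter_add_sum_filter_not (Finset.range N) (fun j => v (y j) = m) y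
    rw [← hs] at hsplit
    rw [eq_sub_of_add_eq hsplit]
    refine lt_of_lt_of_le (lt_min (by rw [hm]; exact hilt) ?_) (AddValuation.map_sub v _ _)
    refine AddValuation.map_lt_sum v WithTop.coe_ne_top fun k hk => ?_
    obtain ⟨hk1, hk2⟩ := Finset.mem_filter.1 hk
    have := hmin k hk1
    rw [← hm] at this
    exact lt_of_le_of_ne this (Ne.symm hk2)
  have heval : q.eval (inx v x P) = 0 := by
    rw [hq, eval_finsetSum]
    simp only [eval_mul, eval_C, eval_pow, eval_X]
    have : ∀ j, inx v x (coeffAt P h j) * inx v x P ^ j = init v (y j) := by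
      intro j; rw [← inx_pow, ← inx_mul]; rfl
    simp only [this]
    rw [sum_init_of_eq S y (fun k hk => (Finset.mem_filter.1 hk).2) hSsum.le, cls_eq_zero_iff]
    exact hSsum
  have hiS : i ∈ S := Finset.mem_filter.2 ⟨hiN, hm.symm⟩
  have hq0 : q ≠ 0 := by
    intro h0
    have h1 := hcoef i
    rw [h0, coeff_zero, if_pos hiS, eq_comm, inx_eq_zero_iff] at h1
    have h2 : v (y i) = ⊤ := by
      change val v x (coeffAt P h i * P ^ i) = ⊤
      rw [val, map_mul, AddValuation.map_mul]
      change val v x _ + _ = ⊤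
      rw [h1, top_add]
    rw [h2] at hilt
    exact not_top_lt hilt
  have h1 := hg.2.2.2 q hq0 (fun k => by
    rw [hcoef]
    split_ifs
    · exact subset_saturation A (hA _ (degree_coeffAt_lt hP h k))
    · exact subset_saturation A A.zero_mem) heval
  have h2 : q.natDegree < N := by
    have hNpos : 0 < N := by
      have := Finset.mem_range.1 hjN; omega
    rw [natDegree_lt_iff_degree_lt hq0, degree_lt_iff_coeff_zero]
    intro k hk
    rw [hcoef, if_neg]
    simp only [hS, Finset.mem_filter, Finset.mem_range, not_and]
    omega
  omega

/-- The values of the coefficients of a lifting. -/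
theorem IsMinPoly.val_lifting {A : Subring (Gr v)} {P : K[X]} {β : Γ} (hPβ : val v x P = β)
    {g : (Gr v)[X]} (hg : IsMinPoly (saturation v A) (inx v x P) g) (b : ℕ → K[X])
    (hb : ∀ j < g.natDegree, inx v x (b j) = g.coeff j) :
    (∀ j < g.natDegree, ((g.natDegree • β : Γ) : WithTop Γ) ≤ val v x (b j * P ^ j)) ∧
      ((g.natDegree • β : Γ) : WithTop Γ) <
        val v x (P ^ g.natDegree + ∑ j ∈ Finset.range g.natDegree, b j * P ^ j) := by
  classical
  set N := g.natDegree with hN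
  set b' : ℕ → K[X] := fun j => if j = N then 1 else b j with hb'
  set y : ℕ → L := fun j => aeval x (b' j * P ^ j) with hy
  have hcoef : ∀ j ≤ N, inx v x (b' j) = g.coeff j := by
    intro j hj
    rw [hb']; dsimp only
    split_ifs with h
    · rw [h, hN, hg.1.coeff_natDegree, inx, map_one, init_one]
    · exact hb j (lt_of_le_of_ne hj h)
  have hyN : v (y N) = ((N • β : Γ) : WithTop Γ) := by
    rw [hy, hb']; simp only [if_pos]
    rw [one_mul, map_pow, AddValuation.map_pow]
    change N • val v x P = _
    rw [hPβ, WithTop.coe_nsmul]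
  have hin : ∀ j ≤ N, init v (y j) = g.coeff j * inx v x P ^ j := by
    intro j hj
    rw [← hcoef j hj, ← inx_pow, ← inx_mul]; rfl
  have hsum0 : ∑ j ∈ Finset.range (N + 1), init v (y j) = 0 := by
    rw [← hg.2.2.1, eval_eq_sum_range]
    exact Finset.sum_congr rfl fun j hj => hin j (by simpa [Nat.lt_succ_iff] using hj)
  have hlt := lt_map_sum_of_sum_init_eq_zero _ y hsum0 (N • β)
  set S := (Finset.range (N + 1)).filter fun j => v (y j) = ((N • β : Γ) : WithTop Γ) with hS
  -- g is homogeneous: removing the terms of total degree N β, among them the leading one, leaves a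
  -- polynomial of degree < N which still kills `in P`, so it vanishes by minimality.
  set q : (Gr v)[X] := g - ∑ j ∈ S, C (g.coeff j) * X ^ j with hq
  have hqc : ∀ k, q.coeff k = if k ∈ S then 0 else g.coeff k := by
    intro k
    simp only [hq, coeff_sub, finsetSum_coeff, coeff_C_mul, coeff_X_pow, mul_ite, mul_one,
      mul_zero, Finset.sum_ite_eq]
    split_ifs <;> simp
  have hNS : N ∈ S := Finset.mem_filter.2 ⟨by simp, hyN⟩
  have hqe : q.eval (inx v x P) = 0 := by
    rw [hq, eval_sub, hg.2.2.1, zero_sub, neg_eq_zero, eval_finsetSum]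
    simp only [eval_mul, eval_C, eval_pow, eval_X]
    rw [Finset.sum_congr rfl fun j hj => (hin j (by
      simpa [Nat.lt_succ_iff] using (Finset.mem_filter.1 hj).1)).symm,
      sum_init_of_eq S y (fun k hk => (Finset.mem_filter.1 hk).2) hlt.le, cls_eq_zero_iff]
    exact hlt
  have hq0 : q = 0 := by
    by_contra hne
    have h1 := hg.2.2.2 q hne (fun k => by
      rw [hqc]
      split_ifs
      · exact subset_saturation A A.zero_mem
      · exact hg.2.1 k) hqe
    have h2 : q.natDegree < N := by
      rw [natDegree_lt_iff_degree_lt hne, degree_lt_iff_coeff_zero]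
      intro k hk
      rw [hqc]
      split_ifs with hkS
      · rfl
      · refine coeff_eq_zero_of_natDegree_lt ?_
        rcases lt_or_eq_of_le hk with h | h
        · exact h
        · exact absurd (h ▸ hNS) hkS
    omega
  have hnS : ∀ j ≤ N, j ∉ S → v (y j) = ⊤ := by
    intro j hj hjS
    have h1 := hqc j
    rw [hq0, coeff_zero, if_neg hjS] at h1
    rw [← init_eq_zero_iff, hin j hj, ← h1, zero_mul]
  have hge : ∀ j ≤ N, ((N • β : Γ) : WithTop Γ) ≤ v (y j) := by
    intro j hj
    by_cases hjS : j ∈ S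
    · exact (Finset.mem_filter.1 hjS).2.ge
    · rw [hnS j hj hjS]; exact le_top
  refine ⟨fun j hj => ?_, ?_⟩
  · have := hge j hj.le
    simp only [hy, hb', if_neg hj.ne] at this
    exact this
  · have e : aeval x (P ^ N + ∑ j ∈ Finset.range N, b j * P ^ j) =
        ∑ j ∈ Finset.range (N + 1), y j := by
      rw [Finset.sum_range_succ, add_comm, map_add, map_sum]
      congr 1
      · refine Finset.sum_congr rfl fun j hj => ?_
        rw [hy, hb']; simp only
        rw [if_neg (Finset.mem_range.1 hj).ne]
      · rw [hy, hb']; simp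
    rw [val, e, ← Finset.sum_filter_add_sum_filter_not _ (fun j => v (y j) = ((N • β : Γ) : WithTop Γ))]
    refine AddValuation.map_lt_add v hlt (AddValuation.map_lt_sum v WithTop.coe_ne_top fun j hj => ?_)
    obtain ⟨h1, h2⟩ := Finset.mem_filter.1 hj
    rw [hnS j (by simpa [Nat.lt_succ_iff] using h1) (fun h => h2 (Finset.mem_filter.1 h).2)]
    exact WithTop.coe_lt_top _

/-- The initial form of a homogeneous standard expansion. -/
theorem IsHomogExpansion.inx_expansion {Q : Ordinal.{0} → K[X]} {α : Ordinal.{0} → ℕ}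
    {l : Ordinal.{0}} {c : (Ordinal.{0} →₀ ℕ) →₀ K} (hc : IsHomogExpansion v x Q α l c) :
    inx v x (expansion Q c) = ∑ γ ∈ c.support, inx v x (C (c γ) * mono Q γ) := by
  classical
  by_cases hne : c.support = ∅
  · rw [hne, Finset.sum_empty, expansion, Finsupp.sum, hne, Finset.sum_empty, inx, map_zero, init_zero]
  obtain ⟨γ₀, hγ₀⟩ := Finset.nonempty_iff_ne_empty.2 hne
  have hall : ∀ γ ∈ c.support, monoVal v x Q c γ = monoVal v x Q c γ₀ :=
    fun γ hγ => hc.2 γ hγ γ₀ hγ₀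
  have h0 := hc.1.2 _ ⟨γ₀, hγ₀, rfl⟩
  -- For a homogeneous expansion the non-vanishing condition concerns the sum over all monomials; it
  -- says that no cancellation raises the value of the whole above that of its monomials.
  rw [Finset.filter_true_of_mem hall] at h0
  have hntop : monoVal v x Q c γ₀ ≠ ⊤ := by
    intro htop
    exact h0 (Finset.sum_eq_zero fun γ hγ => inx_eq_zero_iff.2 ((hall γ hγ).trans htop))
  obtain ⟨β, hβ⟩ := WithTop.ne_top_iff_exists.1 hntop
  have hv : ∀ γ ∈ c.support, v (aeval x (C (c γ) * mono Q γ)) = β :=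
    fun γ hγ => (hall γ hγ).trans hβ.symm
  have hle : (β : WithTop Γ) ≤ v (∑ γ ∈ c.support, aeval x (C (c γ) * mono Q γ)) :=
    AddValuation.map_le_sum v fun γ hγ => (hv γ hγ).ge
  have hsum := sum_init_of_eq c.support (fun γ => aeval x (C (c γ) * mono Q γ)) hv hle
  change ∑ γ ∈ c.support, init v (aeval x (C (c γ) * mono Q γ)) ≠ 0 at h0
  change _ = ∑ γ ∈ c.support, init v (aeval x (C (c γ) * mono Q γ))
  have he : aeval x (expansion Q c) = ∑ γ ∈ c.support, aeval x (C (c γ) * mono Q γ) := by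
    rw [expansion, Finsupp.sum, map_sum]
  rw [hsum, Ne, cls_eq_zero_iff] at h0
  rw [hsum, inx, he]
  exact init_of_eq (le_antisymm (not_lt.1 h0) hle)

end Lifting

/-! ### Passage to real values -/

section RealVal

variable {F Γ : Type*} [Field F] [AddCommGroup Γ] [LinearOrder Γ] [IsOrderedAddMonoid Γ]

/-- The valuation with real values defined by an embedding of the value group into `ℝ`. -/
def realVal (φ : Γ →+ ℝ) (hφ : StrictMono φ) (v : AddValuation F (WithTop Γ)) :
    AddValuation F (WithTop ℝ) :=
  v.map φ.withTopMap rfl hφ.monotone.withTop_map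

variable {φ : Γ →+ ℝ} {hφ : StrictMono φ} {v : AddValuation F (WithTop Γ)}

theorem realVal_apply (y : F) : realVal φ hφ v y = (v y).map φ := rfl

theorem realVal_le_iff {y z : F} : realVal φ hφ v y ≤ realVal φ hφ v z ↔ v y ≤ v z :=
  hφ.withTop_map.le_iff_le

theorem ge_realVal_iff {β : Γ} {y : F} :
    Ge (φ β) (realVal φ hφ v y) ↔ (β : WithTop Γ) ≤ v y :=
  hφ.withTop_map.le_iff_le (a := (β : WithTop Γ))

theorem gt_realVal_iff {β : Γ} {y : F} :
    Gt (φ β) (realVal φ hφ v y) ↔ (β : WithTop Γ) < v y :=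
  hφ.withTop_map.lt_iff_lt (a := (β : WithTop Γ))

theorem realVal_of_eq {β : Γ} {y : F} (h : v y = β) : realVal φ hφ v y = (φ β : ℝ) := by
  rw [realVal_apply, h]; rfl

end RealVal

/-! ### Degrees of key polynomials and of standard monomials -/

section Degrees

variable {K : Type*} [Field K] {Q : Ordinal.{0} → K[X]} {α : Ordinal.{0} → ℕ} {l : Ordinal.{0}}

/-- The degrees of the key polynomials. -/
structure Degrees (Q : Ordinal.{0} → K[X]) (α : Ordinal.{0} → ℕ) (l : Ordinal.{0}) : Prop where
  one_le : 1 ≤ l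
  monic : ∀ i, 1 ≤ i → i ≤ l → (Q i).Monic
  pos : ∀ i, 1 ≤ i → i ≤ l → 1 ≤ (Q i).natDegree
  mono : ∀ i j, 1 ≤ i → i ≤ j → j ≤ l → (Q i).natDegree ≤ (Q j).natDegree
  succ : ∀ i, 1 ≤ i → i < l → 1 ≤ α (i + 1) ∧ (Q (i + 1)).natDegree = α (i + 1) * (Q i).natDegree
  limit : ∀ i, 1 ≤ i → i + Ordinal.omega0 ≤ l → (∀ t : ℕ, α (i + ((t + 1 : ℕ) : Ordinal.{0})) = 1) →
    (Q (i + Ordinal.omega0)).natDegree = α (i + Ordinal.omega0) * (Q i).natDegree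

theorem exists_eq_add_natCast {i j : Ordinal.{0}} (h : j ≤ i) (h' : i < j + Ordinal.omega0) :
    ∃ n : ℕ, i = j + (n : Ordinal.{0}) := by
  have e := Ordinal.add_sub_cancel_of_le h
  rw [← e, add_lt_add_iff_left, Ordinal.lt_omega0] at h'
  obtain ⟨n, hn⟩ := h'
  exact ⟨n, by rw [← hn, e]⟩

theorem add_natCast_add_omega0 (j : Ordinal.{0}) (n : ℕ) :
    j + (n : Ordinal.{0}) + Ordinal.omega0 = j + Ordinal.omega0 := by
  rw [add_assoc, Ordinal.natCast_add_omega0]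

theorem add_natCast_succ (j : Ordinal.{0}) (n : ℕ) :
    j + ((n + 1 : ℕ) : Ordinal.{0}) = j + (n : Ordinal.{0}) + 1 := by
  rw [Nat.cast_succ, add_assoc]

theorem omega0_add_le_of_le_add_one {i l : Ordinal.{0}} (h : i + Ordinal.omega0 ≤ l + 1) :
    i + Ordinal.omega0 ≤ l := by
  by_contra! hlt
  have := (Ordinal.isSuccLimit_add i Ordinal.isSuccLimit_omega0).add_one_lt hlt
  exact absurd h (not_le.2 this)

namespace Degrees

theorem base (hX : Q 1 = X) : Degrees Q α 1 where
  one_le := le_rfl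
  monic i h1 h2 := by rw [le_antisymm h2 h1, hX]; exact monic_X
  pos i h1 h2 := by rw [le_antisymm h2 h1, hX, natDegree_X]
  mono i j h1 h2 h3 := by
    have e : i = j := le_antisymm h2 (h3.trans h1)
    rw [e]
  succ i h1 h2 := absurd h1 (not_le.2 h2)
  limit i h1 h2 := by
    have h3 : Ordinal.omega0 ≤ 1 := (le_add_left le_rfl).trans h2
    exact absurd h3 (not_le.2 Ordinal.one_lt_omega0)

theorem add_one (D : Degrees Q α l) (hm : (Q (l + 1)).Monic) (hα : 1 ≤ α (l + 1))
    (hd : (Q (l + 1)).natDegree = α (l + 1) * (Q l).natDegree) : Degrees Q α (l + 1) := by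
  have hcase : ∀ {i : Ordinal.{0}}, i ≤ l + 1 → i ≤ l ∨ i = l + 1 := fun {i} hi => by
    rcases lt_or_eq_of_le hi with h | h
    · exact Or.inl (Order.lt_add_one_iff.1 h)
    · exact Or.inr h
  have hle : (Q l).natDegree ≤ (Q (l + 1)).natDegree := by
    rw [hd]; exact Nat.le_mul_of_pos_left _ hα
  refine ⟨D.one_le.trans (le_add_right le_rfl), ?_, ?_, ?_, ?_, ?_⟩
  · intro i h1 h2
    rcases hcase h2 with h | rfl
    · exact D.monic i h1 h
    · exact hm
  · intro i h1 h2
    rcases hcase h2 with h | rfl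
    · exact D.pos i h1 h
    · exact (D.pos l D.one_le le_rfl).trans hle
  · intro i j h1 h2 h3
    rcases hcase h3 with h | rfl
    · exact D.mono i j h1 h2 h
    · rcases hcase h2 with h | rfl
      · exact (D.mono i l h1 h le_rfl).trans hle
      · exact le_rfl
  · intro i h1 h2
    rcases lt_or_eq_of_le (Order.lt_add_one_iff.1 h2) with h | rfl
    · exact D.succ i h1 h
    · exact ⟨hα, hd⟩
  · intro i h1 h2 h3
    exact D.limit i h1 (omega0_add_le_of_le_add_one h2) h3

theorem natDegree_eq_of_alpha_eq_one (D : Degrees Q α l) {i : Ordinal.{0}} (hi : 1 ≤ i) (n : ℕ)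
    (hn : i + (n : Ordinal.{0}) ≤ l) (hα : ∀ t < n, α (i + ((t + 1 : ℕ) : Ordinal.{0})) = 1) :
    (Q (i + (n : Ordinal.{0}))).natDegree = (Q i).natDegree := by
  induction n with
  | zero => simp
  | succ n ih =>
    have h1 := hα n (Nat.lt_succ_self n)
    rw [add_natCast_succ] at hn h1 ⊢
    have h2 : i + (n : Ordinal.{0}) < l := lt_of_lt_of_le (lt_add_one _) hn
    rw [(D.succ _ (hi.trans (le_add_right le_rfl)) h2).2, h1, one_mul,
      ih h2.le fun t ht => hα t (ht.trans (Nat.lt_succ_self n))]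

theorem add_omega0 (D : ∀ t : ℕ, Degrees Q α (l + (t : Ordinal.{0})))
    (hα1 : ∀ t : ℕ, α (l + ((t + 1 : ℕ) : Ordinal.{0})) = 1)
    (hm : (Q (l + Ordinal.omega0)).Monic) (hα : 1 ≤ α (l + Ordinal.omega0))
    (hd : (Q (l + Ordinal.omega0)).natDegree = α (l + Ordinal.omega0) * (Q l).natDegree) :
    Degrees Q α (l + Ordinal.omega0) := by
  have hl1 : 1 ≤ l := by simpa using (D 0).one_le
  have hlt : ∀ {i : Ordinal.{0}}, i < l + Ordinal.omega0 → ∃ t : ℕ, i < l + (t : Ordinal.{0}) := by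
    intro i hi
    rcases le_total l i with h | h
    · obtain ⟨n, rfl⟩ := exists_eq_add_natCast h hi
      exact ⟨n + 1, by rw [add_natCast_succ]; exact lt_add_one _⟩
    · exact ⟨1, lt_of_le_of_lt h (by rw [Nat.cast_one]; exact lt_add_one _)⟩
  have hQt : ∀ t : ℕ, (Q (l + (t : Ordinal.{0}))).natDegree = (Q l).natDegree := fun t =>
    (D t).natDegree_eq_of_alpha_eq_one hl1 t le_rfl fun s _ => hα1 s
  have hle : (Q l).natDegree ≤ (Q (l + Ordinal.omega0)).natDegree := by
    rw [hd]; exact Nat.le_mul_of_pos_left _ hα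
  refine ⟨hl1.trans (le_add_right le_rfl), ?_, ?_, ?_, ?_, ?_⟩
  · intro i h1 h2
    rcases lt_or_eq_of_le h2 with h | rfl
    · obtain ⟨t, ht⟩ := hlt h
      exact (D t).monic i h1 ht.le
    · exact hm
  · intro i h1 h2
    rcases lt_or_eq_of_le h2 with h | rfl
    · obtain ⟨t, ht⟩ := hlt h
      exact (D t).pos i h1 ht.le
    · have := (D 0).pos l hl1 (le_add_right le_rfl)
      exact this.trans hle
  · intro i j h1 h2 h3
    rcases lt_or_eq_of_le h3 with h | rfl
    · obtain ⟨t, ht⟩ := hlt h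
      exact (D t).mono i j h1 h2 ht.le
    · rcases lt_or_eq_of_le h2 with h | rfl
      · obtain ⟨t, ht⟩ := hlt h
        refine ((D t).mono i _ h1 ht.le le_rfl).trans ?_
        rw [hQt]; exact hle
      · exact le_rfl
  · intro i h1 h2
    obtain ⟨t, ht⟩ := hlt h2
    exact (D t).succ i h1 ht
  · intro i h1 h2 h3
    rcases le_total l i with h | h
    · have h4 : i < l + Ordinal.omega0 :=
        lt_of_lt_of_le (lt_add_of_pos_right i Ordinal.omega0_pos) h2
      obtain ⟨n, rfl⟩ := exists_eq_add_natCast h h4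
      rw [add_natCast_add_omega0, hd, hQt]
    · rcases le_or_gt (i + Ordinal.omega0) l with h4 | h4
      · exact (D 0).limit i h1 (by simpa using h4) h3
      · obtain ⟨n, rfl⟩ := exists_eq_add_natCast h h4
        rw [add_natCast_add_omega0] at hd
        rw [hd]
        congr 1
        exact (D 0).natDegree_eq_of_alpha_eq_one h1 n (by simp) fun t _ => h3 t

/-- The degrees of `Q_i` and `Q_{i+}`. -/
theorem natDegree_plus (D : Degrees Q α l) {i : Ordinal.{0}} (h1 : 1 ≤ i) (h2 : i < l) :
    plus α l i ≤ l ∧ (Q (plus α l i)).natDegree = α (plus α l i) * (Q i).natDegree := by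
  rw [plus]
  split_ifs with he
  · exact ⟨Order.add_one_le_of_lt h2, (D.succ i h1 h2).2⟩
  · have hlt : ∀ t : ℕ, i + ((t + 1 : ℕ) : Ordinal.{0}) < l := by
      intro t
      induction t with
      | zero =>
        rw [add_natCast_succ, Nat.cast_zero, add_zero]
        refine lt_of_le_of_ne (Order.add_one_le_of_lt h2) fun h => he ⟨1, one_pos, Or.inl ?_⟩
        rw [Nat.cast_one, h]
      | succ t ih =>
        refine lt_of_le_of_ne ?_ fun h => he ⟨t + 1 + 1, Nat.succ_pos _, Or.inl h⟩
        rw [add_natCast_succ]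
        exact Order.add_one_le_of_lt ih
    have hle : i + Ordinal.omega0 ≤ l := by
      by_contra! h
      obtain ⟨n, hn⟩ := exists_eq_add_natCast h2.le h
      have := hlt n
      rw [hn, add_natCast_succ] at this
      exact absurd this (not_lt.2 (le_add_right le_rfl))
    refine ⟨hle, D.limit i h1 hle fun t => le_antisymm ?_ ?_⟩
    · by_contra! h
      exact he ⟨t + 1, Nat.succ_pos _, Or.inr ⟨hlt t, h⟩⟩
    · have h3 : i + (t : Ordinal.{0}) < l :=
        lt_of_le_of_lt (by rw [add_natCast_succ]; exact le_add_right le_rfl) (hlt t)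
      rw [add_natCast_succ]
      exact (D.succ _ (h1.trans (le_add_right le_rfl)) h3).1

/-- If j is inessential and i < j + ω, then i is inessential too and i₊ = j₊, so both indices would
occur in a family in which a standard monomial has at most one. -/
theorem plus_le (D : Degrees Q α l) {n : ℕ} {γ : Ordinal.{0} →₀ ℕ} (hγ : IsStdIndex Q α n l γ)
    {i j : Ordinal.{0}} (hi : i ∈ γ.support) (hj : j ∈ γ.support) (hji : j < i) (hil : i < l) :
    plus α l j ≤ i := by
  have hj1 := (hγ.1 j hj).1
  by_cases he : Essential α l j
  · rw [plus, if_pos he]; exact Order.add_one_le_of_lt hji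
  · by_contra! h
    have hpl := (D.natDegree_plus hj1 (hji.trans hil)).1
    have hpj : plus α l j = j + Ordinal.omega0 := by rw [plus, if_neg he]
    rw [hpj] at h hpl
    obtain ⟨n, rfl⟩ := exists_eq_add_natCast hji.le h
    have hei : ¬ Essential α l (j + (n : Ordinal.{0})) := by
      rintro ⟨t, ht, ht'⟩
      refine he ⟨n + t, by omega, ?_⟩
      rwa [Nat.cast_add, ← add_assoc]
    have hpi : plus α l (j + (n : Ordinal.{0})) = j + Ordinal.omega0 := by
      rw [plus, if_neg hei, add_natCast_add_omega0]
    have := hγ.2.2.2 j hj1 (hji.trans hil) he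
      (show j ∈ _ from ⟨hj1, by rw [hpj]; exact lt_add_of_pos_right j Ordinal.omega0_pos, rfl,
        Finsupp.mem_support_iff.1 hj⟩)
      (show j + (n : Ordinal.{0}) ∈ _ from ⟨(hγ.1 _ hi).1, by rw [hpj]; exact h,
        by rw [hpi, hpj], Finsupp.mem_support_iff.1 hi⟩)
    exact absurd hji (by rw [← this]; exact lt_irrefl _)

/-- The exponents behave like digits in a mixed radix system: if i is the largest index, the lower
part has degree < deg Q_i, and (γ_i + 1) deg Q_i ≤ deg Q_{i₊}. Hence standard expansions not
involving Q_l are digits for Q_l. -/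
theorem natDegree_mono_lt (D : Degrees Q α l) {n : ℕ} {γ : Ordinal.{0} →₀ ℕ}
    (hγ : IsStdIndex Q α n l γ) (hγl : γ l = 0) : (KeyPoly.mono Q γ).natDegree < (Q l).natDegree := by
  have hlt : ∀ i ∈ γ.support, i < l := fun i hi =>
    lt_of_le_of_ne (hγ.1 i hi).2 fun h => Finsupp.mem_support_iff.1 hi (h ▸ hγl)
  have main : ∀ s : Finset Ordinal.{0}, s ⊆ γ.support → ∀ m, 1 ≤ m → m ≤ l →
      (∀ j ∈ s, plus α l j ≤ m) → ∑ i ∈ s, γ i * (Q i).natDegree < (Q m).natDegree := by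
    intro s
    induction s using Finset.induction_on_max with
    | empty => intro _ m h1 h2 _; rw [Finset.sum_empty]; exact D.pos m h1 h2
    | insert i s hmax ih =>
      intro hs m h1 h2 hm
      have hi : i ∈ γ.support := hs (Finset.mem_insert_self i s)
      have hi1 := (hγ.1 i hi).1
      have hs' : s ⊆ γ.support := fun j hj => hs (Finset.mem_insert_of_mem hj)
      rw [Finset.sum_insert fun h => lt_irrefl _ (hmax i h)]
      have h3 := ih hs' i hi1 (hlt i hi).le fun j hj =>
        D.plus_le hγ hi (hs' hj) (hmax j hj) (hlt i hi)
      have h4 := hγ.2.1 i hi1 (hlt i hi)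
      obtain ⟨-, h5⟩ := D.natDegree_plus hi1 (hlt i hi)
      have hpm := hm i (Finset.mem_insert_self i s)
      have hp1 : 1 ≤ plus α l i := by
        rw [plus]
        split_ifs <;> exact hi1.trans (le_add_right le_rfl)
      have h6 := D.mono _ m hp1 hpm h2
      rw [h5] at h6
      have h7 : (γ i + 1) * (Q i).natDegree ≤ α (plus α l i) * (Q i).natDegree :=
        Nat.mul_le_mul_right _ h4
      rw [add_mul, one_mul] at h7
      omega
  have h1 := main γ.support (fun _ h => h) l D.one_le le_rfl fun j hj =>
    (D.natDegree_plus (hγ.1 j hj).1 (hlt j hj)).1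
  refine lt_of_le_of_lt ?_ h1
  refine (natDegree_prod_le _ _).trans (Finset.sum_le_sum fun i _ => natDegree_pow_le)

theorem degree_expansion_lt (D : Degrees Q α l) {n : ℕ} {c : (Ordinal.{0} →₀ ℕ) →₀ K}
    (hc : ∀ γ ∈ c.support, IsStdIndex Q α n l γ ∧ γ l = 0) :
    (expansion Q c).degree < (Q l).degree := by
  have hQ := D.monic l D.one_le le_rfl
  refine lt_of_le_of_lt (degree_sum_le _ _)
    ((Finset.sup_lt_iff (bot_lt_iff_ne_bot.2 (degree_ne_bot.2 hQ.ne_zero))).2 fun γ hγ => ?_)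
  rw [degree_eq_natDegree hQ.ne_zero]
  refine lt_of_le_of_lt degree_le_natDegree (WithBot.coe_lt_coe.2 ?_)
  exact lt_of_le_of_lt (natDegree_C_mul_le _ _)
    (D.natDegree_mono_lt (hc γ hγ).1 (hc γ hγ).2)

end Degrees

end Degrees

/-! ### Value estimates for the next key polynomial -/

section Values

variable {K L : Type*} [Field K] [Field L] [Algebra K L] {w : AddValuation L (WithTop ℝ)} {x : L}
  {P : K[X]} {b κ : ℝ}

theorem ge_add_iff {c d : ℝ} {y : WithTop ℝ} : Ge c (y + (d : WithTop ℝ)) ↔ Ge (c - d) y := by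
  cases y with
  | top => simp
  | coe y =>
    unfold Ge
    rw [← WithTop.coe_add, WithTop.coe_le_coe, WithTop.coe_le_coe, sub_le_iff_le_add]

theorem val_mul_pow (hb : val w x P = b) (a : K[X]) (j : ℕ) :
    val w x (a * P ^ j) = val w x a + ((j * b : ℝ) : WithTop ℝ) := by
  rw [val_mul]
  congr 1
  rw [val, map_pow, AddValuation.map_pow]
  change j • val w x P = _
  rw [hb, ← WithTop.coe_nsmul, nsmul_eq_mul]

theorem ge_val_mul_pow_iff (hb : val w x P = b) {c : ℝ} {a : K[X]} {j : ℕ} :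
    Ge c (val w x (a * P ^ j)) ↔ Ge (c - j * b) (val w x a) := by
  rw [val_mul_pow hb, ge_add_iff]

theorem Carry.ge (h : Carry w x Gt P κ) : Carry w x Ge P κ :=
  fun a a' ha ha' c c' hc hc' => (h a a' ha ha' c c' hc hc').le

theorem Carry.anti {B : ℝ → WithTop ℝ → Prop} (hB : IsCut B) (h : Carry w x B P κ) {κ' : ℝ}
    (hκ : κ ≤ κ') : Carry w x B P κ' :=
  fun a a' ha ha' c c' hc hc' => hB.anti (h a a' ha ha' c c' hc hc') (by linarith)

/-- Quotients by a polynomial whose value is larger than that of the terms of its expansion. -/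
theorem InU.gt_quotient (hP : P.Monic) (hP1 : 1 ≤ P.natDegree)
    (hC : Carry w x Ge P κ) (hκ : κ ≤ b) (hb : Ge b (val w x P)) {R : K[X]} {α : ℕ}
    (hR : R.Monic) (hRd : R.natDegree = α * P.natDegree) (hRU : InU w x Ge P b (α * b) R)
    {a a' : K[X]} {c c' : ℝ} (Ha : InU w x Ge P b c a) (Ha' : InU w x Ge P b c' a')
    {κ' : ℝ} (hκ' : α * b < κ') : Gt (c + c' - κ') (val w x ((a * a') /ₘ R)) := by
  have hκP : Ge κ (val w x P) := hb.anti hκ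
  have h1 := Ha.mul isCut_ge hP hP1 hC hκ hκP Ha'
  have h2 := (InU.div_mod hP hP1 hC hκ hκP hR hRd hRU h1).eval isCut_ge hP hP1 hb
  exact lt_of_lt_of_le (WithTop.coe_lt_coe.2 (by linarith)) h2

theorem degree_sum_mul_pow_lt (hP : P.Monic) (a : ℕ → K[X]) {N : ℕ}
    (ha : ∀ j < N, (a j).degree < P.degree) :
    (∑ j ∈ Finset.range N, a j * P ^ j).degree < (P ^ N).degree := by
  refine degree_sum_mul_lt (hP.pow N) _ _ fun j hj => ?_
  have hj' := Finset.mem_range.1 hj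
  by_cases h0 : a j = 0
  · rw [h0, zero_mul, degree_zero, bot_lt_iff_ne_bot]
    exact degree_ne_bot.2 (hP.pow N).ne_zero
  · have h1 := (natDegree_lt_natDegree_iff h0).2 (ha j hj')
    rw [degree_eq_natDegree (mul_ne_zero h0 (hP.pow j).ne_zero),
      degree_eq_natDegree (hP.pow N).ne_zero, natDegree_mul h0 (hP.pow j).ne_zero,
      hP.natDegree_pow, hP.natDegree_pow]
    refine WithBot.coe_lt_coe.2 ?_
    have := Nat.mul_le_mul_right P.natDegree (Nat.succ_le_of_lt hj')
    rw [Nat.succ_mul] at this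
    simp only [Nat.cast_id]
    omega

theorem monic_of_coeffAt_eq_one (hP : P.Monic) (hP1 : 1 ≤ P.natDegree) {R : K[X]} {N : ℕ}
    (h1 : coeffAt P R N = 1) (h0 : ∀ j, N < j → coeffAt P R j = 0) :
    R.Monic ∧ R.natDegree = N * P.natDegree := by
  have hs := eq_sum_coeffAt hP R (N + 1 + R.natDegree) (by nlinarith)
  rw [Finset.sum_range_add, Finset.sum_eq_zero (s := Finset.range R.natDegree) (fun j _ => by
    rw [h0 _ (by omega), zero_mul]), add_zero, Finset.sum_range_succ, h1, one_mul, add_comm] at hs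
  have hlt := degree_sum_mul_pow_lt hP (coeffAt P R) (N := N) fun j _ => degree_coeffAt_lt hP R j
  constructor
  · rw [hs]; exact (hP.pow N).add_of_left hlt
  · conv_lhs => rw [hs]
    rw [natDegree_add_eq_left_of_degree_lt hlt, hP.natDegree_pow]

/-- The top digit of a monic `h` is monic of degree < deg P, so its value is at most C. As `h` is
fixed, its own value cannot exceed that of the top term. The summand 1 is mere slack. -/
theorem val_le_of_inU (hP : P.Monic) (hP1 : 1 ≤ P.natDegree) {C b' : ℝ}
    (hC : ∀ a : K[X], a.Monic → a.degree < P.degree → val w x a ≤ (C : WithTop ℝ))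
    (hb' : |b| ≤ b') {h : K[X]} (hh : h.Monic) {α : ℕ} (hd : h.natDegree < α * P.natDegree)
    (hfix : ∀ c : ℝ, Ge c (val w x h) → InU w x Ge P b c h) :
    val w x h ≤ ((C + α * b' + 1 : ℝ) : WithTop ℝ) := by
  by_contra! hlt
  set j := h.natDegree / P.natDegree with hj
  have hjα : j < α := (Nat.div_lt_iff_lt_mul hP1).2 hd
  have h1 := hfix _ hlt.le j
  have hm : (coeffAt P h j).Monic := by
    rw [Monic, leadingCoeff_coeffAt_natDegree_div hP hP1 hh.ne_zero, hh.leadingCoeff]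
  have h2 := WithTop.coe_le_coe.1 (h1.trans (hC _ hm (degree_coeffAt_lt hP h j)))
  have h3 : (j : ℝ) * b ≤ α * b' := by
    have h4 : (j : ℝ) ≤ α := by exact_mod_cast hjα.le
    calc (j : ℝ) * b ≤ j * b' := by
          exact mul_le_mul_of_nonneg_left ((le_abs_self b).trans hb') (Nat.cast_nonneg j)
      _ ≤ α * b' := mul_le_mul_of_nonneg_right h4 ((abs_nonneg b).trans hb')
  linarith

end Values

/-! ### The invariant of the construction; liftings and steps inside T -/

section Invariant

variable {K L Γ : Type*} [Field K] [Field L] [Algebra K L]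
  [AddCommGroup Γ] [LinearOrder Γ] [IsOrderedAddMonoid Γ]
  {φ : Γ →+ ℝ} {hφ : StrictMono φ} {v : AddValuation L (WithTop Γ)} {x : L}
  {Q : Ordinal.{0} → K[X]} {α : Ordinal.{0} → ℕ} {l : Ordinal.{0}}

/-- The properties of the key polynomials `Q_i`, `i ≤ l`, preserved by the construction. -/
structure Invariant (φ : Γ →+ ℝ) (hφ : StrictMono φ) (v : AddValuation L (WithTop Γ)) (x : L)
    (Q : Ordinal.{0} → K[X]) (α : Ordinal.{0} → ℕ) (l : Ordinal.{0}) : Prop where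
  degrees : Degrees Q α l
  init_mem : ∀ h : K[X], h.degree < (Q l).degree → inx v x h ∈ grSub v x Q l
  bdd : ∃ C : ℝ, ∀ h : K[X], h.Monic → h.degree < (Q l).degree →
    val (realVal φ hφ v) x h ≤ (C : WithTop ℝ)
  -- The condition is void if Q_l(x) = 0. The strict cut is needed so that a change of the
  -- polynomial at slope `κ` leaves minimal terms intact (`val_coeffAt_add`).
  carry : ∀ κ : ℝ, val (realVal φ hφ v) x (Q l) = κ → Carry (realVal φ hφ v) x Gt (Q l) κ

theorem grSub_mono {l l' : Ordinal.{0}} (h : l ≤ l') : grSub v x Q l ≤ grSub v x Q l' := by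
  refine Subring.closure_mono (Set.union_subset_union_right _ ?_)
  rintro g ⟨i, h1, h2, h3⟩
  exact ⟨i, h1, h2.trans_le h, h3⟩

theorem inx_mem_grSub {i : Ordinal.{0}} (h1 : 1 ≤ i) (h2 : i < l) :
    inx v x (Q i) ∈ grSub v x Q l :=
  Subring.subset_closure (Or.inr ⟨i, h1, h2, rfl⟩)

theorem inx_C_mem_grSub (a : K) : inx v x (C a) ∈ grSub v x Q l := by
  refine Subring.subset_closure (Or.inl ⟨a, ?_⟩)
  rw [inx, aeval_C]

theorem IsMinPoly.one_le_natDegree {A : Set (Gr v)} {θ : Gr v} {g : (Gr v)[X]}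
    (hg : IsMinPoly A θ g) : 1 ≤ g.natDegree := by
  by_contra! h
  have h1 : g = 1 := hg.1.natDegree_eq_zero.1 (by omega)
  have h2 := hg.2.2.1
  rw [h1, eval_one, ← init_one, init_eq_zero_iff, AddValuation.map_one] at h2
  exact WithTop.zero_ne_top h2

namespace Invariant

theorem monic (I : Invariant φ hφ v x Q α l) : (Q l).Monic :=
  I.degrees.monic l I.degrees.one_le le_rfl

theorem one_le_natDegree (I : Invariant φ hφ v x Q α l) : 1 ≤ (Q l).natDegree :=
  I.degrees.pos l I.degrees.one_le le_rfl

theorem base (hX : Q 1 = X) : Invariant φ hφ v x Q α 1 where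
  degrees := Degrees.base hX
  init_mem h hd := by
    rw [hX, degree_X] at hd
    rw [eq_C_of_degree_le_zero (Order.le_of_lt_succ hd)]
    exact inx_C_mem_grSub _
  bdd := by
    refine ⟨0, fun h hm hd => ?_⟩
    rw [hX, degree_X] at hd
    have h1 : h = 1 := by
      rw [← hm.natDegree_eq_zero, ← Nat.lt_one_iff]
      exact (natDegree_lt_iff_degree_lt hm.ne_zero).2 hd
    simp [h1, val]
  carry κ _ a a' ha ha' c c' _ _ := by
    have h0 : (a * a') /ₘ Q 1 = 0 := by
      refine div_of_degree_lt (by rw [hX]; exact monic_X) ?_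
      rw [hX, degree_X] at *
      rw [eq_C_of_degree_le_zero (Order.le_of_lt_succ ha),
        eq_C_of_degree_le_zero (Order.le_of_lt_succ ha'), ← C_mul]
      exact lt_of_le_of_lt degree_C_le zero_lt_one
    rw [h0, val, map_zero, AddValuation.map_zero]
    exact isCut_gt.top _

/-- Polynomials of degree < deg Q_{l+1} are fixed by their Q_l-expansions, by minimality of g; this
gives the initial forms and the bound. A quotient by Q_{l+1} loses only N b, which is less than the
value of Q_{l+1} because the terms of the lifted relation cancel; this gives the strict carry. -/
theorem lifting (I : Invariant φ hφ v x Q α l) (hne : aeval x (Q l) ≠ 0)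
    (H : IsLifting v x Q α l) : Invariant φ hφ v x Q α (l + 1) := by
  obtain ⟨g, hg, hα, c, hQ, hc⟩ := H
  have hP := I.monic
  have hP1 := I.one_le_natDegree
  set P := Q l with hPdef
  set N := g.natDegree with hN
  rw [hα] at hQ hc
  obtain ⟨β, hβ⟩ := WithTop.ne_top_iff_exists.1
    (fun h => hne ((AddValuation.top_iff v).1 h) : v (aeval x P) ≠ ⊤)
  set b := φ β with hb
  have hPβ : val v x P = β := hβ.symm
  have hPb : val (realVal φ hφ v) x P = (b : ℝ) := realVal_of_eq hPβ
  have hbd : ∀ j < N, (expansion Q (c j)).degree < P.degree := fun j hj =>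
    I.degrees.degree_expansion_lt (hc j hj).1.1.1
  obtain ⟨hlow, hval⟩ := hg.val_lifting hPβ (fun j => expansion Q (c j)) fun j hj =>
    (hc j hj).1.inx_expansion.trans (hc j hj).2
  rw [← hQ] at hval
  have hval' : Gt (N * b) (val (realVal φ hφ v) x (Q (l + 1))) := by
    rw [hb, ← nsmul_eq_mul, ← map_nsmul]
    exact gt_realVal_iff.2 hval
  have hsum := degree_sum_mul_pow_lt hP (fun j => expansion Q (c j)) hbd
  have hRm : (Q (l + 1)).Monic := by rw [hQ]; exact (hP.pow N).add_of_left hsum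
  have hRd : (Q (l + 1)).natDegree = N * P.natDegree := by
    rw [hQ, natDegree_add_eq_left_of_degree_lt hsum, hP.natDegree_pow]
  have hRU : InU (realVal φ hφ v) x Ge P b (N * b) (Q (l + 1)) := by
    rw [hQ]
    refine (InU.pow_self hP hP1 N).add isCut_ge hP (InU.sum isCut_ge hP _ _ fun j hj => ?_)
    have hj' := Finset.mem_range.1 hj
    have h1 : Ge (N * b) (val (realVal φ hφ v) x (expansion Q (c j) * P ^ j)) := by
      rw [hb, ← nsmul_eq_mul, ← map_nsmul]
      exact ge_realVal_iff.2 (hlow j hj')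
    rw [ge_val_mul_pow_iff hPb] at h1
    have h2 : InU (realVal φ hφ v) x Ge P b (N * b - j * b) (expansion Q (c j)) :=
      InU.of_degree_lt isCut_ge hP (hbd j hj') h1
    exact (h2.mul_pow isCut_ge hP j).anti isCut_ge (by linarith)
  have hterm : ∀ h : K[X], h.degree < (Q (l + 1)).degree → ∀ j,
      val v x h ≤ val v x (coeffAt P h j * P ^ j) := fun h hd j =>
    hg.le_val_term hP I.init_mem
      (hRd ▸ natDegree_lt_of_degree_lt (by rw [hRd]; exact Nat.mul_pos hg.one_le_natDegree hP1) hd) j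
  have hfix : ∀ h : K[X], h.degree < (Q (l + 1)).degree → ∀ c : ℝ,
      Ge c (val (realVal φ hφ v) x h) → InU (realVal φ hφ v) x Ge P b c h := fun h hd c hc j => by
    rw [← ge_val_mul_pow_iff hPb]
    exact hc.trans (realVal_le_iff.2 (hterm h hd j))
  refine ⟨I.degrees.add_one hRm (hα ▸ hg.one_le_natDegree) (hα ▸ hRd), fun h hd => ?_, ?_, ?_⟩
  · exact inx_mem_of_fixed hP hP1 (fun a ha => grSub_mono (le_add_right le_rfl) (I.init_mem a ha))
      (inx_mem_grSub I.degrees.one_le (lt_add_one l)) (hterm h hd)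
  · obtain ⟨C, hC⟩ := I.bdd
    refine ⟨_, fun h hm hd => val_le_of_inU (α := N) hP hP1 hC le_rfl hm ?_ (hfix h hd)⟩
    rw [← hRd]
    exact (natDegree_lt_natDegree_iff hm.ne_zero).2 hd
  · intro κ' hκ' a a' ha ha' c c' hc hc'
    rw [hκ'] at hval'
    exact InU.gt_quotient hP hP1 (I.carry b hPb).ge le_rfl hPb.ge hRm hRd hRU
      (hfix a ha c hc) (hfix a' ha' c' hc') (WithTop.coe_lt_coe.1 hval')

theorem add_natCast_degrees (I : Invariant φ hφ v x Q α l) {z : ℕ → K[X]} {s : ℕ}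
    (hz : ∀ j < s, (z j).degree < (Q l).degree) (hF : ∀ i ≤ s, Follows Q α l z i) :
    Degrees Q α (l + (s : Ordinal.{0})) ∧ (Q (l + (s : Ordinal.{0}))).Monic ∧
      (Q (l + (s : Ordinal.{0}))).degree = (Q l).degree ∧
      (Q (l + (s : Ordinal.{0})) - Q l).degree < (Q l).degree := by
  have hsum : ∀ i ≤ s, (∑ j ∈ Finset.range i, z j).degree < (Q l).degree := fun i hi =>
    degree_sum_mul_lt I.monic _ _ fun j hj => hz j ((Finset.mem_range.1 hj).trans_le hi)
  have hdeg : ∀ i ≤ s, (Q (l + (i : Ordinal.{0}))).Monic ∧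
      (Q (l + (i : Ordinal.{0}))).degree = (Q l).degree := fun i hi => by
    rw [(hF i hi).1, partialSum]
    exact ⟨I.monic.add_of_left (hsum i hi), degree_add_eq_left_of_degree_lt (hsum i hi)⟩
  refine ⟨?_, (hdeg s le_rfl).1, (hdeg s le_rfl).2, ?_⟩
  · have main : ∀ i ≤ s, Degrees Q α (l + (i : Ordinal.{0})) := by
      intro i hi
      induction i with
      | zero => simpa using I.degrees
      | succ i ih =>
        have h1 := (hF (i + 1) hi).2 (Nat.succ_pos i)
        have h2 := hdeg (i + 1) hi
        have h3 := hdeg i (by omega)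
        rw [add_natCast_succ] at h1 h2 ⊢
        refine (ih (by omega)).add_one h2.1 h1.ge ?_
        rw [h1, one_mul]
        exact natDegree_eq_of_degree_eq (h2.2.trans h3.2.symm)
    exact main s le_rfl
  · rw [(hF s le_rfl).1, partialSum, add_sub_cancel_left]
    exact hsum s le_rfl

/-- The degree does not change, so the statements on polynomials of smaller degree persist. Only a
polynomial of value at least that of Q_l is added, which preserves the carry. -/
theorem add_natCast (I : Invariant φ hφ v x Q α l) (hne : aeval x (Q l) ≠ 0) {z : ℕ → K[X]} {s : ℕ}
    (hz : ∀ j < s, (z j).degree < (Q l).degree) (hzv : ∀ j < s, val v x (Q l) ≤ val v x (z j))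
    (hF : ∀ i ≤ s, Follows Q α l z i) : Invariant φ hφ v x Q α (l + (s : Ordinal.{0})) := by
  obtain ⟨hD, -, hdeg, hsub⟩ := I.add_natCast_degrees hz hF
  have hP := I.monic
  have hP1 := I.one_le_natDegree
  refine ⟨hD, fun h hd => grSub_mono (le_add_right le_rfl) (I.init_mem h (hdeg ▸ hd)), ?_, ?_⟩
  · obtain ⟨C, hC⟩ := I.bdd
    exact ⟨C, fun h hm hd => hC h hm (hdeg ▸ hd)⟩
  · intro κ' hκ'
    obtain ⟨β, hβ⟩ := WithTop.ne_top_iff_exists.1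
      (fun h => hne ((AddValuation.top_iff v).1 h) : v (aeval x (Q l)) ≠ ⊤)
    have hPb : val (realVal φ hφ v) x (Q l) = (φ β : ℝ) := realVal_of_eq hβ.symm
    have hy : Ge (φ β) (val (realVal φ hφ v) x (Q (l + (s : Ordinal.{0})) - Q l)) := by
      refine ge_realVal_iff.2 ?_
      rw [(hF s le_rfl).1, partialSum, add_sub_cancel_left, map_sum]
      refine AddValuation.map_le_sum v fun j hj => ?_
      rw [hβ]
      exact hzv j (Finset.mem_range.1 hj)
    have h1 := (I.carry _ hPb).add_right isCut_gt hP hP1 hsub hy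
    have h2 : φ β ≤ κ' := by
      rw [← WithTop.coe_le_coe, ← hκ', val, ← add_sub_cancel (Q l) (Q (l + (s : Ordinal.{0}))),
        map_add]
      exact isCut_ge.map_add hPb.ge hy
    rw [add_sub_cancel] at h1
    exact h1.anti isCut_gt h2

theorem add_natCast_of_inT (I : Invariant φ hφ v x Q α l) (hne : aeval x (Q l) ≠ 0)
    {z : ℕ → K[X]} {s : ℕ} (hT : InT v x Q α l z s) (hF : ∀ i ≤ s, Follows Q α l z i) :
    Invariant φ hφ v x Q α (l + (s : Ordinal.{0})) := by
  obtain ⟨hexp, h0, hinc, -, -⟩ := hT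
  refine I.add_natCast hne (fun j hj => ?_) (fun j hj => ?_) hF
  · obtain ⟨c, hc, hz⟩ := hexp j hj
    rw [hz]
    exact I.degrees.degree_expansion_lt hc.1.1
  · induction j with
    | zero => rw [h0 hj]
    | succ j ih => exact (ih (by omega)).trans (hinc j hj).le

end Invariant

end Invariant

/-! ### Newton polygons do not depend on the embedding of the value group -/

section Transfer

variable {K L Γ : Type*} [Field K] [Field L] [Algebra K L]
  [AddCommGroup Γ] [LinearOrder Γ] [IsOrderedAddMonoid Γ]
  {φ : Γ →+ ℝ} {hφ : StrictMono φ} {v : AddValuation L (WithTop Γ)} {x : L} {P h : K[X]}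

theorem termVal_realVal (b : WithTop Γ) (j : ℕ) :
    termVal (realVal φ hφ v) x P h (b.map φ) j = (termVal v x P h b j).map φ := by
  change _ = φ.withTopMap (val v x (coeffAt P h j) + j • b)
  rw [map_add, map_nsmul]
  rfl

theorem sideSet_realVal (b : WithTop Γ) :
    sideSet (realVal φ hφ v) x P h (b.map φ) = sideSet v x P h b := by
  classical
  ext j
  simp only [sideSet, Finset.mem_filter, termVal_realVal, hφ.withTop_map.le_iff_le]

theorem delta_realVal : delta (realVal φ hφ v) x P h = delta v x P h := by
  have : val (realVal φ hφ v) x P = (val v x P).map φ := rfl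
  rw [delta, this, sideSet_realVal, delta]

end Transfer

/-! ### Sides whose initial form is a power of a linear polynomial -/

section SideSets

variable {K L Γ : Type*} [Field K] [Field L] [Algebra K L]
  [AddCommGroup Γ] [LinearOrder Γ] [IsOrderedAddMonoid Γ]
  {v : AddValuation L (WithTop Γ)} {x : L} {P h z : K[X]}

theorem coeff_initForm (b : WithTop Γ) (k : ℕ) [Decidable (k ∈ sideSet v x P h b)] :
    (initForm v x P h b).coeff k =
      if k ∈ sideSet v x P h b then inx v x (coeffAt P h k) else 0 := by
  simp [initForm, coeff_X_pow]

theorem init_add_of_eq {β : Γ} {y y' : L} (hy : v y = β) (hy' : v y' = β) (hs : v (y + y') = β) :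
    init v y + init v y' = init v (y + y') := by
  rw [init_of_eq hy, init_of_eq hy', init_of_eq hs, cls, cls, cls, ← map_add]
  congr 1
  ext1
  exact (AddMonoidAlgebra.single_add _ _ _).symm

/-- The side of the Newton polygon on which the initial form is a power of a linear one. -/
theorem val_eq_of_initForm_eq {b : Γ} {δ : ℕ} (hδ : 0 < δ) (hmem : δ ∈ sideSet v x P h b)
    (hfin : val v x (coeffAt P h δ) ≠ ⊤) (hz : val v x z ≠ ⊤)
    (heq : initForm v x P h b = C (inx v x (coeffAt P h δ)) * (X + C (inx v x z)) ^ δ) :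
    0 ∈ sideSet v x P h b ∧ val v x z = b := by
  classical
  have h0 := congrArg (fun q => coeff q 0) heq
  simp only [coeff_initForm, coeff_C_mul] at h0
  rw [coeff_zero_eq_eval_zero, eval_pow, eval_add, eval_X, eval_C, zero_add] at h0
  have hv : val v x (coeffAt P h δ * z ^ δ) = val v x (coeffAt P h δ) + δ • val v x z := by
    simp [val]
  have hne : inx v x (coeffAt P h δ * z ^ δ) ≠ 0 := by
    rw [Ne, inx_eq_zero_iff, hv, WithTop.add_eq_top, not_or]
    refine ⟨hfin, ?_⟩
    obtain ⟨c, hc⟩ := WithTop.ne_top_iff_exists.1 hz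
    rw [← hc, ← WithTop.coe_nsmul]
    exact WithTop.coe_ne_top
  rw [← inx_pow, ← inx_mul] at h0
  have hmem0 : 0 ∈ sideSet v x P h b := by
    by_contra hcon
    rw [if_neg hcon] at h0
    exact hne h0.symm
  rw [if_pos hmem0] at h0
  refine ⟨hmem0, ?_⟩
  have h1 := (eq_and_lt_of_init_eq h0.symm fun htop => hne (inx_eq_zero_iff.2 htop)).1
  change val v x _ = val v x _ at h1
  rw [hv] at h1
  have h2 := le_antisymm ((Finset.mem_filter.1 hmem0).2 δ) ((Finset.mem_filter.1 hmem).2 0)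
  rw [termVal, termVal, zero_nsmul, add_zero, ← h1] at h2
  obtain ⟨d, hd⟩ := WithTop.ne_top_iff_exists.1 hfin
  obtain ⟨c, hc⟩ := WithTop.ne_top_iff_exists.1 hz
  rw [← hd, ← hc, ← WithTop.coe_nsmul, ← WithTop.coe_nsmul, ← WithTop.coe_add, ← WithTop.coe_add,
    WithTop.coe_inj] at h2
  rw [← hc, WithTop.coe_inj]
  exact (nsmul_right_strictMono hδ.ne').injective (add_left_cancel h2)

/-- Evaluate the identity at `in P`. The left side vanishes because h(x) = 0, so `in P + in z` must
vanish, that is, P + z has a larger value than P. -/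
theorem lt_val_add_of_initForm_eq (hP : P.Monic) (hP1 : 1 ≤ P.natDegree) (hx : aeval x h = 0)
    {b : Γ} {δ : ℕ} (hmem : δ ∈ sideSet v x P h b) (hfin : val v x (coeffAt P h δ) ≠ ⊤)
    (hPb : val v x P = b) (hz : val v x z = b)
    (heq : initForm v x P h b = C (inx v x (coeffAt P h δ)) * (X + C (inx v x z)) ^ δ) :
    (b : WithTop Γ) < val v x (P + z) := by
  classical
  have hle : (b : WithTop Γ) ≤ val v x (P + z) := by
    rw [val, map_add]
    exact AddValuation.map_le_add v hPb.ge hz.ge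
  refine lt_of_le_of_ne hle fun hcon => ?_
  obtain ⟨d, hd⟩ := WithTop.ne_top_iff_exists.1 hfin
  set m : Γ := d + δ • b with hm
  set y : ℕ → L := fun j => aeval x (coeffAt P h j * P ^ j) with hy
  have hyt : ∀ j, v (y j) = termVal v x P h b j := fun j => by
    simp only [hy, map_mul, map_pow, AddValuation.map_mul, AddValuation.map_pow, termVal]
    change _ + j • val v x P = _
    rw [hPb]; rfl
  have hmδ : termVal v x P h b δ = m := by
    rw [termVal, ← hd, ← WithTop.coe_nsmul, ← WithTop.coe_add]
  have hmin : ∀ j, (m : WithTop Γ) ≤ v (y j) := fun j => by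
    rw [hyt, ← hmδ]; exact (Finset.mem_filter.1 hmem).2 j
  have hS : ∀ j ∈ sideSet v x P h b, v (y j) = m := fun j hj => by
    rw [hyt, ← hmδ]
    exact le_antisymm ((Finset.mem_filter.1 hj).2 δ) ((Finset.mem_filter.1 hmem).2 j)
  have hsub : sideSet v x P h b ⊆ Finset.range (h.natDegree + 1) := Finset.filter_subset _ _
  have hsum : ∑ j ∈ Finset.range (h.natDegree + 1), y j = 0 := by
    rw [← hx]
    conv_rhs => rw [eq_sum_coeffAt hP h (h.natDegree + 1) (by nlinarith)]
    rw [map_sum]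
  have hlt : (m : WithTop Γ) < v (∑ j ∈ sideSet v x P h b, y j) := by
    rw [← Finset.sum_sdiff hsub] at hsum
    rw [← neg_eq_of_add_eq_zero_right hsum, AddValuation.map_neg]
    refine AddValuation.map_lt_sum v WithTop.coe_ne_top fun j hj => lt_of_le_of_ne (hmin j) ?_
    intro he
    obtain ⟨h1, h2⟩ := Finset.mem_sdiff.1 hj
    refine h2 (Finset.mem_filter.2 ⟨h1, fun k => ?_⟩)
    rw [← hyt, ← hyt, ← he]
    exact hmin k
  have he := congrArg (eval (inx v x P)) heq
  rw [initForm, eval_finsetSum] at he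
  simp only [eval_mul, eval_C, eval_pow, eval_X, eval_add] at he
  have hin : ∀ j, inx v x (coeffAt P h j) * inx v x P ^ j = init v (y j) := fun j => by
    rw [← inx_pow, ← inx_mul]; rfl
  have hadd : inx v x P + inx v x z = inx v x (P + z) := by
    have := init_add_of_eq (v := v) hPb hz (by rw [← map_add]; exact hcon.symm)
    rw [inx, inx, this, ← map_add]; rfl
  simp only [hin] at he
  rw [sum_init_of_eq _ y hS hlt.le, (cls_eq_zero_iff hlt.le).2 hlt, hadd, ← inx_pow, ← inx_mul,
    eq_comm, inx_eq_zero_iff] at he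
  have hv : val v x (coeffAt P h δ * (P + z) ^ δ) = m := by
    simp only [val, map_mul, map_pow, AddValuation.map_mul, AddValuation.map_pow]
    change val v x _ + δ • val v x (P + z) = _
    rw [← hcon, ← hd, ← WithTop.coe_nsmul, ← WithTop.coe_add]
  rw [hv] at he
  exact WithTop.coe_ne_top he

end SideSets

/-! ### Newton polygons of a polynomial vanishing at x, and their change with P -/

section RealSides

variable {K L : Type*} [Field K] [Field L] [Algebra K L] {w : AddValuation L (WithTop ℝ)} {x : L}
  {P h z : K[X]} {b d : ℝ} {δ : ℕ}

theorem mem_sideSet_iff (hP : P.Monic) (hP1 : 1 ≤ P.natDegree) (hd : val w x (coeffAt P h δ) = d) :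
    δ ∈ sideSet w x P h b ↔ ∀ k : ℕ, Ge (d + δ * b - k * b) (val w x (coeffAt P h k)) := by
  classical
  have hδ : δ < h.natDegree + 1 := by
    by_contra! hlt
    rw [coeffAt_eq_zero hP (by nlinarith), val, map_zero, AddValuation.map_zero] at hd
    exact WithTop.top_ne_coe hd
  rw [sideSet, Finset.mem_filter, Finset.mem_range, and_iff_right hδ]
  refine forall_congr' fun k => ?_
  rw [termVal, termVal, hd, ← ge_add_iff, ← WithTop.coe_nsmul, ← WithTop.coe_nsmul, nsmul_eq_mul,
    nsmul_eq_mul, ← WithTop.coe_add]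

/-- At least two terms of the expansion of `h` have the least value if `h(x) = 0`. -/
theorem exists_two_minimal (hP : P.Monic) (hP1 : 1 ≤ P.natDegree) (hx : aeval x h = 0)
    (hPb : val w x P = b) (hfin : ∃ k, val w x (coeffAt P h k) ≠ ⊤) :
    ∃ i j, i < j ∧ ∃ di dj : ℝ, val w x (coeffAt P h i) = di ∧ val w x (coeffAt P h j) = dj ∧
      i ∈ sideSet w x P h b ∧ j ∈ sideSet w x P h b := by
  classical
  set y : ℕ → L := fun j => aeval x (coeffAt P h j * P ^ j) with hy
  set R := Finset.range (h.natDegree + 1) with hR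
  have hyt : ∀ j, w (y j) = termVal w x P h b j := fun j => by
    simp only [hy, map_mul, map_pow, AddValuation.map_mul, AddValuation.map_pow, termVal]
    change _ + j • val w x P = _
    rw [hPb]; rfl
  have htop : ∀ k ∉ R, coeffAt P h k = 0 := fun k hk => by
    rw [hR, Finset.mem_range, not_lt] at hk
    exact coeffAt_eq_zero hP (by nlinarith)
  have hsum : ∑ j ∈ R, y j = 0 := by
    rw [← hx]
    conv_rhs => rw [eq_sum_coeffAt hP h (h.natDegree + 1) (by nlinarith)]
    rw [map_sum]
  obtain ⟨i, hi, hmin⟩ := Finset.exists_min_image R (fun j => w (y j)) ⟨0, by simp [hR]⟩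
  have hne : w (y i) ≠ ⊤ := by
    obtain ⟨k, hk⟩ := hfin
    have hkR : k ∈ R := by
      by_contra hcon
      exact hk (by rw [htop k hcon, val, map_zero, AddValuation.map_zero])
    refine ((hmin k hkR).trans_lt ?_).ne
    rw [hyt, termVal, ← WithTop.coe_nsmul]
    exact WithTop.add_lt_top.2 ⟨lt_top_iff_ne_top.2 hk, WithTop.coe_lt_top _⟩
  have hkey : ∀ k ∈ R, w (y k) = w (y i) →
      ∃ dk : ℝ, val w x (coeffAt P h k) = dk ∧ k ∈ sideSet w x P h b := by
    intro k hk hki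
    have h1 : val w x (coeffAt P h k) ≠ ⊤ := by
      intro h1
      rw [← hki, hyt, termVal, h1, top_add] at hne
      exact hne rfl
    obtain ⟨dk, hdk⟩ := WithTop.ne_top_iff_exists.1 h1
    refine ⟨dk, hdk.symm, Finset.mem_filter.2 ⟨hk, fun k' => ?_⟩⟩
    by_cases hk' : k' ∈ R
    · rw [← hyt, ← hyt, hki]
      exact hmin k' hk'
    · rw [termVal, termVal, htop k' hk', val, val, map_zero, AddValuation.map_zero, top_add]
      exact le_top
  have hex : ∃ j ∈ R, j ≠ i ∧ w (y j) = w (y i) := by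
    by_contra! hcon
    have h1 : w (y i) < w (∑ j ∈ R.erase i, y j) :=
      AddValuation.map_lt_sum w hne fun j hj => by
        obtain ⟨h1, h2⟩ := Finset.mem_erase.1 hj
        exact lt_of_le_of_ne (hmin j h2) (Ne.symm (hcon j h2 h1))
    rw [← Finset.add_sum_erase R y hi] at hsum
    rw [← neg_eq_of_add_eq_zero_right hsum, AddValuation.map_neg] at h1
    exact lt_irrefl _ h1
  obtain ⟨j, hj, hji, hjv⟩ := hex
  obtain ⟨di, hdi, hSi⟩ := hkey i hi rfl
  obtain ⟨dj, hdj, hSj⟩ := hkey j hj hjv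
  rcases lt_or_gt_of_ne hji with hlt | hlt
  · exact ⟨j, i, hlt, dj, di, hdj, hdi, hSj, hSi⟩
  · exact ⟨i, j, hlt, di, dj, hdi, hdj, hSi, hSj⟩

/-- The coefficients of ordinate at least `δ` after the change of `P` to `P + z`. -/
theorem val_coeffAt_add (hP : P.Monic) (hP1 : 1 ≤ P.natDegree) (hz : z.degree < P.degree)
    (hC : Carry w x Gt (P + z) b) (hzb : Ge b (val w x z)) (hPz : Ge b (val w x (P + z)))
    (hd : val w x (coeffAt P h δ) = d) (hmem : δ ∈ sideSet w x P h b)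
    (hmax : ∀ j ∈ sideSet w x P h b, j ≤ δ) :
    val w x (coeffAt (P + z) h δ) = d ∧
      ∀ k, δ < k → Gt (d + δ * b - k * b) (val w x (coeffAt (P + z) h k)) := by
  classical
  have hP' : (P + z).Monic := hP.add_of_left hz
  have hdeg : (P + z).degree = P.degree := degree_add_eq_left_of_degree_lt hz
  have hP1' : 1 ≤ (P + z).natDegree := by rwa [natDegree_eq_of_degree_eq hdeg]
  set N := h.natDegree + 1 with hN
  have hge := (mem_sideSet_iff hP hP1 hd).1 hmem
  have hgt : ∀ i, δ < i → Gt (d + δ * b - i * b) (val w x (coeffAt P h i)) := by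
    intro i hi
    refine lt_of_le_of_ne (hge i) fun he => ?_
    refine absurd (hmax i ((mem_sideSet_iff hP hP1 he.symm).2 fun k => (hge k).anti ?_))
      (not_le.2 hi)
    linarith
  -- The binomial expansion of P = (P + z) - z with strict errors. The new coefficient of index k
  -- receives contributions only from i ≥ k, and those with i > δ are strictly above the line.
  have happ := Carry.taylor_approx isCut_gt hP' hP1' hC.ge le_rfl hPz hC hPz
    (by rwa [hdeg]) hzb N (coeffAt P h) (fun i _ => by rw [hdeg]; exact degree_coeffAt_lt hP h i)
    (μ := d + δ * b) fun i _ => hge i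
  rw [add_sub_cancel_right, ← eq_sum_coeffAt hP h N (by nlinarith)] at happ
  have hterm : ∀ k i : ℕ, δ < i → Gt (d + δ * b - k * b)
      (w ((i.choose k : L) * aeval x (coeffAt P h i) * (-aeval x z) ^ (i - k))) := by
    intro k i hi
    rcases lt_or_ge i k with hik | hik
    · rw [Nat.choose_eq_zero_of_lt hik, Nat.cast_zero, zero_mul, zero_mul, AddValuation.map_zero]
      exact WithTop.coe_lt_top _
    · rw [show (i.choose k : L) * aeval x (coeffAt P h i) * (-aeval x z) ^ (i - k) =
        aeval x (coeffAt P h i) * ((-aeval x z) ^ (i - k) * (i.choose k : L)) by ring]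
      have hzb' : Ge b (w (-aeval x z)) := by rw [AddValuation.map_neg]; exact hzb
      refine isCut_gt.anti (isCut_gt.map_mul (hgt i hi)
        (isCut_ge.map_mul (hzb'.map_pow (i - k)) (nonneg_map_natCast _))) ?_
      rw [Nat.cast_sub hik]
      linarith
  constructor
  · have h1 := happ δ
    have hδN : δ ∈ Finset.range N := Finset.mem_of_mem_filter δ hmem
    rw [← Finset.add_sum_erase _ _ hδN, Nat.choose_self, Nat.cast_one, one_mul, Nat.sub_self,
      pow_zero, mul_one] at h1
    have h2 : Gt (d + δ * b - δ * b) (w (∑ i ∈ (Finset.range N).erase δ,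
        (i.choose δ : L) * aeval x (coeffAt P h i) * (-aeval x z) ^ (i - δ))) := by
      refine isCut_gt.map_sum _ _ fun i hi => ?_
      rcases lt_or_gt_of_ne (Finset.ne_of_mem_erase hi) with hlt | hlt
      · rw [Nat.choose_eq_zero_of_lt hlt, Nat.cast_zero, zero_mul, zero_mul, AddValuation.map_zero]
        exact WithTop.coe_lt_top _
      · exact hterm δ i hlt
    have h3 := isCut_gt.map_add h1 h2
    rw [sub_add_eq_sub_sub, sub_add_cancel, add_sub_cancel_right] at h3
    have h4 : w (aeval x (coeffAt P h δ)) < w (aeval x (coeffAt (P + z) h δ) -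
        aeval x (coeffAt P h δ)) := by
      change val w x _ < _
      rw [hd]; exact h3
    have h5 := AddValuation.map_add_eq_of_lt_left w h4
    rw [add_sub_cancel] at h5
    exact h5.trans hd
  · intro k hk
    have h1 := happ k
    have h2 : Gt (d + δ * b - k * b) (w (∑ i ∈ Finset.range N,
        (i.choose k : L) * aeval x (coeffAt P h i) * (-aeval x z) ^ (i - k))) := by
      refine isCut_gt.map_sum _ _ fun i _ => ?_
      rcases lt_or_ge i k with hik | hik
      · rw [Nat.choose_eq_zero_of_lt hik, Nat.cast_zero, zero_mul, zero_mul, AddValuation.map_zero]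
        exact WithTop.coe_lt_top _
      · exact hterm k i (hk.trans_le hik)
    have h3 := isCut_gt.map_add h1 h2
    rwa [sub_add_cancel] at h3

/-- The value of a root of `h` is the slope of the side with the upper endpoint `δ`. -/
theorem eq_slope (hP : P.Monic) (hP1 : 1 ≤ P.natDegree) (hx : aeval x h = 0) {b' b'' : ℝ}
    (hPb : val w x P = b') (hd : val w x (coeffAt P h δ) = d)
    (hgt : ∀ k, δ < k → Gt (d + δ * b - k * b) (val w x (coeffAt P h k))) (hb : b < b')
    (h0 : 0 ∈ sideSet w x P h b'') (hδ : δ ∈ sideSet w x P h b'') : b' = b'' := by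
  classical
  have hδ' := (mem_sideSet_iff hP hP1 hd).1 hδ
  obtain ⟨d0, hd0⟩ : ∃ d0 : ℝ, val w x (coeffAt P h 0) = d0 := by
    have h1 := (Finset.mem_filter.1 h0).2 δ
    rw [termVal, termVal, hd, zero_nsmul, add_zero, ← WithTop.coe_nsmul, ← WithTop.coe_add] at h1
    obtain ⟨d0, h2⟩ := WithTop.ne_top_iff_exists.1 (h1.trans_lt (WithTop.coe_lt_top _)).ne
    exact ⟨d0, h2.symm⟩
  have h0' := (mem_sideSet_iff hP hP1 hd0).1 h0
  have e1 : d + δ * b'' ≤ d0 := by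
    have := hδ' 0
    rw [hd0] at this
    have := WithTop.coe_le_coe.1 this
    push_cast at this; linarith
  obtain ⟨i, j, hij, di, dj, hdi, hdj, hi, hj⟩ :=
    exists_two_minimal hP hP1 hx hPb ⟨δ, by rw [hd]; exact WithTop.coe_ne_top⟩
  have hi' := (mem_sideSet_iff hP hP1 hdi).1 hi
  have hj' := (mem_sideSet_iff hP hP1 hdj).1 hj
  have real : ∀ {c e : ℝ} {y : WithTop ℝ}, Ge c y → y = e → c ≤ e := fun h1 h2 => by
    rw [h2] at h1; exact WithTop.coe_le_coe.1 h1
  have hjδ : j ≤ δ := by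
    by_contra! hlt
    have h1 := hgt j hlt
    rw [hdj] at h1
    have h1 := WithTop.coe_lt_coe.1 h1
    have h2 := real (hj' δ) hd
    have h3 : (δ : ℝ) ≤ j := by exact_mod_cast hlt.le
    nlinarith [mul_le_mul_of_nonneg_right h3 (sub_nonneg.2 hb.le)]
  have hij' : (i : ℝ) < j := by exact_mod_cast hij
  have hjδ' : (j : ℝ) ≤ δ := by exact_mod_cast hjδ
  have hi0 : (0 : ℝ) ≤ i := Nat.cast_nonneg i
  -- At b' two indices i < j ≤ δ are minimal. Lowering the slope from b'' would make the term δ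
  -- strictly smaller than the term i; raising it would make the term 0 strictly smaller than the
  -- term j.
  rcases lt_trichotomy b' b'' with hlt | he | hlt
  · have h1 := real (hδ' i) hdi
    have h2 := real (hi' δ) hd
    nlinarith [mul_pos (sub_pos.2 (hij'.trans_le hjδ')) (sub_pos.2 hlt)]
  · exact he
  · have h1 := real (h0' j) hdj
    have h2 := real (hj' 0) hd0
    push_cast at h1 h2
    nlinarith [mul_pos (hi0.trans_lt hij') (sub_pos.2 hlt)]

end RealSides

/-! ### Values of the key polynomials coming from the set T -/

section Chains

variable {K L Γ : Type*} [Field K] [Field L] [Algebra K L] [FiniteDimensional K L]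
  [AddCommGroup Γ] [LinearOrder Γ] [IsOrderedAddMonoid Γ]
  {φ : Γ →+ ℝ} {hφ : StrictMono φ} {v : AddValuation L (WithTop Γ)} {x : L}
  {Q : Ordinal.{0} → K[X]} {α : Ordinal.{0} → ℕ} {l : Ordinal.{0}}

/-- P divides the minimal polynomial only if P(x) = 0: otherwise the cofactor, of smaller degree,
would vanish at x. -/
theorem coeffAt_minpoly_zero_ne_zero {P : K[X]} (hP : P.Monic) (hP1 : 1 ≤ P.natDegree)
    (hne : aeval x P ≠ 0) : coeffAt P (minpoly K x) 0 ≠ 0 := by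
  intro h0
  rw [coeffAt_zero_index, modByMonic_eq_zero_iff_dvd hP] at h0
  obtain ⟨q, hq⟩ := h0
  have hf := minpoly.monic (Algebra.IsIntegral.isIntegral (R := K) x)
  have hq0 : q ≠ 0 := by
    rintro rfl
    rw [mul_zero] at hq
    exact hf.ne_zero hq
  have h1 : aeval x q = 0 := by
    have := minpoly.aeval K x
    rw [hq, map_mul] at this
    exact (mul_eq_zero.1 this).resolve_left hne
  have h2 := natDegree_le_of_dvd (minpoly.dvd K x h1) hq0
  rw [hq, natDegree_mul hP.ne_zero hq0] at h2
  omega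

namespace Invariant

/-- The top digit of the monic polynomial f is monic of degree < deg Q_l, so `bdd` makes its value
finite. -/
theorem val_top_coeff_ne_top (I : Invariant φ hφ v x Q α l) {P : K[X]} (hP : P.Monic)
    (hdeg : P.degree = (Q l).degree) :
    ∃ k, val v x (coeffAt P (minpoly K x) k) ≠ ⊤ := by
  have hf := minpoly.monic (Algebra.IsIntegral.isIntegral (R := K) x)
  have hP1 : 1 ≤ P.natDegree := by
    rw [natDegree_eq_of_degree_eq hdeg]; exact I.one_le_natDegree
  obtain ⟨C, hC⟩ := I.bdd
  refine ⟨(minpoly K x).natDegree / P.natDegree, fun htop => ?_⟩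
  have h1 := hC (coeffAt P (minpoly K x) ((minpoly K x).natDegree / P.natDegree))
    (by rw [Monic, leadingCoeff_coeffAt_natDegree_div hP hP1 hf.ne_zero, hf.leadingCoeff])
    (by rw [← hdeg]; exact degree_coeffAt_lt hP _ _)
  have h2 : val (realVal φ hφ v) x (coeffAt P (minpoly K x)
      ((minpoly K x).natDegree / P.natDegree)) = ⊤ := congrArg (WithTop.map φ) htop
  rw [h2] at h1
  exact absurd h1 (not_le.2 (WithTop.coe_lt_top C))

theorem one_le_delta (I : Invariant φ hφ v x Q α l) (hne : aeval x (Q l) ≠ 0) :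
    1 ≤ delta v x (Q l) (minpoly K x) := by
  obtain ⟨β, hβ⟩ := WithTop.ne_top_iff_exists.1
    (fun h => hne ((AddValuation.top_iff v).1 h) : v (aeval x (Q l)) ≠ ⊤)
  have hPb : val (realVal φ hφ v) x (Q l) = (φ β : ℝ) := realVal_of_eq hβ.symm
  obtain ⟨k, hk⟩ := I.val_top_coeff_ne_top I.monic rfl
  obtain ⟨i, j, hij, -, -, -, -, -, hj⟩ := exists_two_minimal I.monic I.one_le_natDegree
    (minpoly.aeval K x) hPb ⟨k, fun h => hk (hφ.withTop_map.injective h)⟩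
  rw [← delta_realVal (hφ := hφ), delta, hPb]
  exact (Nat.one_le_of_lt hij).trans (Finset.le_sup (f := id) hj)

/-- The slopes of the sides attached to the elements of the set `T`. -/
theorem slope_of_inT (I : Invariant φ hφ v x Q α l) {z : ℕ → K[X]} {j : ℕ}
    (hne : aeval x (Q l) ≠ 0) (hT : InT v x Q α l z (j + 2)) (hPm : (partialSum Q l z j).Monic)
    (hPd : (partialSum Q l z j).degree = (Q l).degree) (hPne : aeval x (partialSum Q l z j) ≠ 0) :
    ∃ b : Γ, val v x (z j) = b ∧
      0 ∈ sideSet v x (partialSum Q l z j) (minpoly K x) b ∧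
      delta v x (Q l) (minpoly K x) ∈ sideSet v x (partialSum Q l z j) (minpoly K x) b ∧
      (∀ i ∈ sideSet v x (partialSum Q l z j) (minpoly K x) b,
        i ≤ delta v x (Q l) (minpoly K x)) ∧
      val v x (coeffAt (partialSum Q l z j) (minpoly K x) (delta v x (Q l) (minpoly K x))) ≠ ⊤ ∧
      (val v x (partialSum Q l z j) = b → (b : WithTop Γ) < val v x (partialSum Q l z (j + 1))) := by
  classical
  have hδ := I.one_le_delta hne
  have hP1 : 1 ≤ (partialSum Q l z j).natDegree := by
    rw [natDegree_eq_of_degree_eq hPd]; exact I.one_le_natDegree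
  obtain ⟨-, -, hinc, -, hsl⟩ := hT
  obtain ⟨b, hb, heq⟩ := hsl j (by omega)
  have hz := (lt_of_lt_of_le (hinc j (by omega)) le_top).ne
  rcases hb with ⟨-, h0⟩ | ⟨hbt, hmem, hmax, -⟩
  · exact absurd (h0 0 hδ) (coeffAt_minpoly_zero_ne_zero hPm hP1 hPne)
  obtain ⟨b, rfl⟩ := WithTop.ne_top_iff_exists.1 hbt
  have hfin : val v x (coeffAt (partialSum Q l z j) (minpoly K x)
      (delta v x (Q l) (minpoly K x))) ≠ ⊤ := by
    obtain ⟨k, hk⟩ := I.val_top_coeff_ne_top hPm hPd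
    have h1 := (Finset.mem_filter.1 hmem).2 k
    intro htop
    rw [termVal, htop, top_add, top_le_iff, termVal, ← WithTop.coe_nsmul, WithTop.add_eq_top] at h1
    rcases h1 with h1 | h1
    · exact hk h1
    · exact WithTop.coe_ne_top h1
  obtain ⟨h0, hzb⟩ := val_eq_of_initForm_eq hδ hmem hfin hz heq
  refine ⟨b, hzb, h0, hmem, hmax, hfin, fun hPb => ?_⟩
  have := lt_val_add_of_initForm_eq hPm hP1 (minpoly.aeval K x) hmem hfin hPb hzb heq
  rwa [partialSum, add_assoc, ← Finset.sum_range_succ] at this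

/-- The values of the key polynomials of an infinite sequence in the set `T`. -/
theorem val_partialSum (I : Invariant φ hφ v x Q α l) {z : ℕ → K[X]}
    (hT : ∀ t, InT v x Q α l z t) (hne : ∀ t, aeval x (partialSum Q l z t) ≠ 0) :
    ∃ b : ℕ → Γ, StrictMono b ∧ ∀ t, val v x (z t) = b t ∧ val v x (partialSum Q l z t) = b t := by
  have h0 : partialSum Q l z 0 = Q l := by rw [partialSum, Finset.sum_range_zero, add_zero]
  have hQne : aeval x (Q l) ≠ 0 := h0 ▸ hne 0
  have hzd : ∀ j, (z j).degree < (Q l).degree := fun j => by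
    obtain ⟨c, hc, hz⟩ := (hT (j + 1)).1 j (Nat.lt_succ_self j)
    rw [hz]
    exact I.degrees.degree_expansion_lt hc.1.1
  have hsd : ∀ t, (∑ j ∈ Finset.range t, z j).degree < (Q l).degree := fun t =>
    degree_sum_mul_lt I.monic _ _ fun j _ => hzd j
  have hPm : ∀ t, (partialSum Q l z t).Monic := fun t => I.monic.add_of_left (hsd t)
  have hPd : ∀ t, (partialSum Q l z t).degree = (Q l).degree := fun t =>
    degree_add_eq_left_of_degree_lt (hsd t)
  have hP1 : ∀ t, 1 ≤ (partialSum Q l z t).natDegree := fun t => by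
    rw [natDegree_eq_of_degree_eq (hPd t)]; exact I.one_le_natDegree
  choose b hb hb0 hbδ hbmax hbfin hblt using fun j =>
    I.slope_of_inT hQne (hT (j + 2)) (hPm j) (hPd j) (hne j)
  have hbm : StrictMono b := strictMono_nat_of_lt_succ fun j => by
    have := (hT (j + 2)).2.2.1 j (by omega)
    rwa [hb, hb, WithTop.coe_lt_coe] at this
  have hQb : val v x (Q l) = b 0 := by
    rw [← hb, (hT 1).2.1 one_pos]
  have hcarry : ∀ t, Carry (realVal φ hφ v) x Gt (partialSum Q l z t) (φ (b 0)) := fun t => by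
    refine (I.carry _ (realVal_of_eq hQb)).add_right isCut_gt I.monic I.one_le_natDegree (hsd t) ?_
    rw [val, map_sum]
    refine isCut_ge.map_sum _ _ fun j _ => ge_realVal_iff.2 ?_
    change _ ≤ val v x (z j)
    rw [hb]
    exact WithTop.coe_le_coe.2 (hbm.monotone (Nat.zero_le j))
  refine ⟨b, hbm, fun t => ⟨hb t, ?_⟩⟩
  -- Suppose P_t has value b_t. The initial form condition forces a larger value on P_{t+1}. The
  -- coefficient of index δ keeps its value and the higher ones stay strictly above the line, so
  -- `eq_slope` identifies the value of P_{t+1} with the slope b_{t+1}.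
  induction t with
  | zero => rw [h0, hQb]
  | succ t ih =>
    have hs : partialSum Q l z (t + 1) = partialSum Q l z t + z t := by
      rw [partialSum, partialSum, Finset.sum_range_succ, add_assoc]
    obtain ⟨β, hβ⟩ := WithTop.ne_top_iff_exists.1
      (fun h => hne (t + 1) ((AddValuation.top_iff v).1 h) :
        v (aeval x (partialSum Q l z (t + 1))) ≠ ⊤)
    have hlt : b t < β := by
      have := hblt t ih
      rw [val, ← hβ] at this
      exact WithTop.coe_lt_coe.1 this
    obtain ⟨d, hd⟩ := WithTop.ne_top_iff_exists.1 (hbfin t)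
    have hd' := realVal_of_eq (hφ := hφ) hd.symm
    have hPβ : val (realVal φ hφ v) x (partialSum Q l z (t + 1)) = (φ β : ℝ) :=
      realVal_of_eq hβ.symm
    have hside : ∀ t, sideSet (realVal φ hφ v) x (partialSum Q l z t) (minpoly K x) (φ (b t) : ℝ) =
        sideSet v x (partialSum Q l z t) (minpoly K x) (b t) := fun t =>
      sideSet_realVal (b t : WithTop Γ)
    have hstep := val_coeffAt_add (w := realVal φ hφ v) (b := φ (b t)) (z := z t) (hPm t) (hP1 t)
      (by rw [hPd]; exact hzd t)
      (by
        rw [← hs]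
        exact (hcarry (t + 1)).anti isCut_gt (hφ.monotone (hbm.monotone (Nat.zero_le t))))
      (ge_realVal_iff.2 (hb t).ge)
      (by rw [← hs, hPβ]; exact WithTop.coe_le_coe.2 (hφ hlt).le) hd'
      (by rw [hside]; exact hbδ t) (by rw [hside]; exact hbmax t)
    rw [← hs] at hstep
    have := eq_slope (hPm (t + 1)) (hP1 (t + 1)) (minpoly.aeval K x) hPβ hstep.1 hstep.2 (hφ hlt)
      (by rw [hside]; exact hb0 (t + 1)) (by rw [hside]; exact hbδ (t + 1))
    rw [val, ← hβ, hφ.injective this]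

end Invariant

end Chains

/-! ### Limit key polynomials preserve the invariant -/

section Limits

variable {K L Γ : Type*} [Field K] [Field L] [Algebra K L]
  [AddCommGroup Γ] [LinearOrder Γ] [IsOrderedAddMonoid Γ]
  {φ : Γ →+ ℝ} {hφ : StrictMono φ} {v : AddValuation L (WithTop Γ)} {x : L}
  {Q : Ordinal.{0} → K[X]} {α : Ordinal.{0} → ℕ} {l : Ordinal.{0}}

theorem prime_ringExpChar (h : ringChar K ≠ 0) :
    (ringExpChar K).Prime ∧ CharP L (ringExpChar K) := by
  have he : ringExpChar K = ringChar K := by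
    rw [ringExpChar]
    exact max_eq_left (Nat.one_le_iff_ne_zero.2 h)
  rw [he]
  refine ⟨(CharP.char_is_prime_or_zero K (ringChar K)).resolve_right h, ?_⟩
  exact charP_of_injective_algebraMap (algebraMap K L).injective (ringChar K)

theorem val_realVal_ge_mul {p : ℕ} {P R : K[X]} {b : Γ} (hb : val v x P = b) :
    Gt ((p : ℝ) * φ b) (val (realVal φ hφ v) x R) ↔ p • val v x P < val v x R := by
  rw [hb, ← nsmul_eq_mul, ← map_nsmul, ← WithTop.coe_nsmul]
  exact gt_realVal_iff

variable [FiniteDimensional K L]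

namespace Invariant

/-- By `val_partialSum` the Q_{l+t} form a chain, bounded by γ. `limit_fixed` makes each polynomial
of degree < deg Q_{l+ω} fixed from some t on, so its initial form and value are read off a
Q_{l+t}-expansion. For a carry, one index T late enough for both factors and for Q_{l+ω} is used. -/
theorem add_omega0 (I : Invariant φ hφ v x Q α l) (hchar : ringChar K ≠ 0)
    (H : CaseTwo v x Q α l) {γ : Γ}
    (hγ : ∀ t : ℕ, val v x (Q (l + (t : Ordinal.{0}))) ≤ (γ : WithTop Γ))
    (hkey : IsLimitKey v x Q α l) : Invariant φ hφ v x Q α (l + Ordinal.omega0) := by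
  obtain ⟨-, z, hT, -, hF⟩ := H
  obtain ⟨hp, hCharP⟩ := prime_ringExpChar (L := L) hchar
  obtain ⟨e, -, hα, ⟨⟨t₀, hR1, hR0, -⟩, hRv⟩, hmin⟩ := hkey
  set p := ringExpChar K
  set R := Q (l + Ordinal.omega0) with hR
  have hQP : ∀ t : ℕ, Q (l + (t : Ordinal.{0})) = partialSum Q l z t := fun t => (hF t).1
  have hne : ∀ t, aeval x (partialSum Q l z t) ≠ 0 := fun t h0 => by
    have := hγ t
    rw [hQP, val, h0, AddValuation.map_zero] at this
    exact absurd this (not_le.2 (WithTop.coe_lt_top γ))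
  obtain ⟨b, hbm, hb⟩ := I.val_partialSum hT hne
  have hzd : ∀ j, (z j).degree < (Q l).degree := fun j => by
    obtain ⟨c, hc, hz⟩ := (hT (j + 1)).1 j (Nat.lt_succ_self j)
    rw [hz]
    exact I.degrees.degree_expansion_lt hc.1.1
  have hdeg := fun t : ℕ => I.add_natCast_degrees (s := t) (fun j _ => hzd j) fun i _ => hF i
  have h0 : partialSum Q l z 0 = Q l := by rw [partialSum, Finset.sum_range_zero, add_zero]
  have hPd : ∀ t, (partialSum Q l z t).degree = (Q l).degree := fun t => by
    rw [← hQP]; exact (hdeg t).2.2.1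
  have hQb : val v x (Q l) = b 0 := by rw [← h0, (hb 0).2]
  have D : IsChain (realVal φ hφ v) x (partialSum Q l z) (fun t => φ (b t)) :=
    { monic := fun t => by rw [← hQP]; exact (hdeg t).2.1
      natDegree_eq := fun t => natDegree_eq_of_degree_eq (by rw [hPd, hPd])
      pos := by rw [h0]; exact I.one_le_natDegree
      val_eq := fun t => realVal_of_eq (hb t).2
      mono := hφ.comp hbm
      bdd := by
        refine ⟨φ γ, ?_⟩
        rintro _ ⟨t, rfl⟩
        refine hφ.monotone (WithTop.coe_le_coe.1 ?_)
        rw [← (hb t).2, ← hQP]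
        exact hγ t
      carry := by rw [h0]; exact (I.carry _ (realVal_of_eq hQb)).ge }
  have hRmd : R.Monic ∧ R.natDegree = p ^ e * (partialSum Q l z 0).natDegree := by
    rw [hQP] at hR1 hR0
    rw [← D.natDegree_eq t₀]
    exact monic_of_coeffAt_eq_one (D.monic t₀) (D.one_le t₀) hR1 hR0
  have hRv' : ∀ s, Gt ((p ^ e : ℕ) * φ (b s)) (val (realVal φ hφ v) x R) := fun s => by
    rw [val_realVal_ge_mul (hb s).2, ← hQP]
    exact hRv s
  obtain ⟨hfix, hRU⟩ := D.limit_fixed hp hRmd.1 hRmd.2 hRv' (by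
    intro e' he' t R' h1 h2 h3 h4
    refine hmin e' he' R' ⟨⟨t, by rw [hQP]; exact ⟨h1, h2, h3⟩⟩, fun s => ?_⟩
    rw [hQP, ← val_realVal_ge_mul (hb s).2]
    exact h4 s)
  refine ⟨?_, ?_, ?_, ?_⟩
  · refine Degrees.add_omega0 (fun t => (hdeg t).1) (fun t => (hF (t + 1)).2 (Nat.succ_pos t))
      hRmd.1 ?_ ?_
    · rw [hα]; exact Nat.one_le_pow _ _ hp.pos
    · rw [hα, ← h0]; exact hRmd.2
  · intro h hd
    obtain ⟨t, ht⟩ := hfix h hd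
    refine inx_mem_of_fixed (D.monic t) (D.one_le t) (fun a ha => ?_) ?_ fun j => ?_
    · exact grSub_mono (le_add_right le_rfl) (I.init_mem a (by rwa [hPd] at ha))
    · rw [← hQP]
      refine inx_mem_grSub (I.degrees.one_le.trans (le_add_right le_rfl)) ?_
      rw [add_lt_add_iff_left]
      exact Ordinal.natCast_lt_omega0 t
    · refine realVal_le_iff (hφ := hφ).1 (WithTop.forall_coe_le_iff_le.1 fun c hc => ?_)
      change Ge c (val (realVal φ hφ v) x _)
      rw [ge_val_mul_pow_iff (D.val_eq t)]
      exact ht c hc j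
  · obtain ⟨C, hC⟩ := I.bdd
    refine ⟨C + (p ^ e : ℕ) * max |φ (b 0)| |φ γ| + 1, fun h hm hd => ?_⟩
    obtain ⟨t, ht⟩ := hfix h hd
    refine val_le_of_inU (D.monic t) (D.one_le t) (fun a ham had => hC a ham (by rwa [hPd] at had))
      (abs_le_max_abs_abs (D.zero_le t) ?_) hm ?_ ht
    · refine hφ.monotone (WithTop.coe_le_coe.1 ?_)
      rw [← (hb t).2, ← hQP]
      exact hγ t
    · rw [D.natDegree_eq, ← hRmd.2]
      exact (natDegree_lt_natDegree_iff hm.ne_zero).2 hd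
  · intro κ' hκ' a a' ha ha' c c' hc hc'
    obtain ⟨t, ht⟩ := hfix a ha
    obtain ⟨t', ht'⟩ := hfix a' ha'
    obtain ⟨s, hs⟩ := Filter.eventually_atTop.1 hRU
    set T := max (max t t') s with hTdef
    have h1 := hRv' T
    rw [hκ'] at h1
    exact InU.gt_quotient (D.monic T) (D.one_le T) (D.carry_all T) (D.zero_le T) (D.val_eq T).ge
      hRmd.1 (by rw [hRmd.2, D.natDegree_eq T]) (hs T (le_max_right _ _))
      ((ht.mono D ((le_max_left _ _).trans (le_max_left _ _))) c hc)
      ((ht'.mono D ((le_max_right _ _).trans (le_max_left _ _))) c' hc')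
      (WithTop.coe_lt_coe.1 h1)

theorem step (I : Invariant φ hφ v x Q α l) {l' : Ordinal.{0}} (H : Step v x Q α l l') :
    Invariant φ hφ v x Q α l' := by
  obtain ⟨hne, H | H | H | H⟩ := H
  · obtain ⟨rfl, -, H⟩ := H
    exact I.lifting hne H
  · obtain ⟨-, -, s, rfl, y, w, ψ, z, m, B, -, -, -, -, -, hz, -, -, -, -, -, hs, hF⟩ := H
    exact I.add_natCast_of_inT hne hs.1.2 hF
  · obtain ⟨-, -, s, rfl, z, hz, hF⟩ := H
    exact I.add_natCast_of_inT hne hz.1 hF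
  · obtain ⟨hchar, -, rfl, H, ⟨γ, hγ⟩, hkey⟩ := H
    exact I.add_omega0 hchar H hγ hkey

end Invariant

end Limits

/-! ### The separability argument -/

section Limit

variable {K L : Type*} [Field K] [Field L] [Algebra K L] {w : AddValuation L (WithTop ℝ)} {x : L}

theorem exists_ge (y : WithTop ℝ) : ∃ c : ℝ, Ge c y := by
  cases y with
  | top => exact ⟨0, le_top⟩
  | coe y => exact ⟨y, le_rfl⟩

theorem exists_forall_ge (y : ℕ → WithTop ℝ) (κ : ℝ) (N : ℕ) :
    ∃ μ : ℝ, ∀ k < N, Ge (μ - k * κ) (y k) := by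
  induction N with
  | zero => exact ⟨0, fun k hk => absurd hk (Nat.not_lt_zero k)⟩
  | succ N ih =>
    obtain ⟨μ, hμ⟩ := ih
    obtain ⟨c, hc⟩ := exists_ge (y N)
    refine ⟨min μ (c + N * κ), fun k hk => ?_⟩
    rcases Nat.lt_succ_iff_lt_or_eq.1 hk with h | rfl
    · exact (hμ k h).anti (by linarith [min_le_left μ (c + N * κ)])
    · exact hc.anti (by linarith [min_le_right μ (c + k * κ)])

/-- Derivatives of polynomials of small degree and large value have large values. -/
theorem exists_ge_val_derivative {P : K[X]} {C₀ : ℝ}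
    (hB : ∀ h : K[X], h.Monic → h.degree < P.degree → val w x h ≤ (C₀ : WithTop ℝ)) (m : ℕ)
    (hm : (m : WithBot ℕ) ≤ P.degree) :
    ∃ C' : ℝ, ∀ h : K[X], h.degree < (m : WithBot ℕ) → ∀ c : ℝ, Ge c (val w x h) →
      Ge (c - C') (val w x (derivative h)) := by
  obtain ⟨ξ, hξ0, hξ⟩ : ∃ ξ : ℝ, ξ ≤ 0 ∧ Ge ξ (w x) := by
    obtain ⟨c, hc⟩ := exists_ge (w x)
    exact ⟨min c 0, min_le_right _ _, hc.anti (min_le_left _ _)⟩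
  induction m with
  | zero =>
    refine ⟨0, fun h hd c _ => ?_⟩
    have h0 : h = 0 := by
      rw [← degree_eq_bot]
      exact Nat.WithBot.lt_zero_iff.1 (by simpa using hd)
    rw [h0, derivative_zero, val, map_zero, AddValuation.map_zero]
    exact le_top
  | succ m ih =>
    have hmP : (m : WithBot ℕ) < P.degree :=
      lt_of_lt_of_le (WithBot.coe_lt_coe.2 (Nat.lt_succ_self m)) hm
    obtain ⟨C', hC'⟩ := ih hmP.le
    refine ⟨|C₀| - m * ξ + |C'|, fun h hd c hc => ?_⟩
    -- If a ≠ 0, then h / a is monic with value at most C₀, so a large value of h forces a large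
    -- value of a. The rest `g` has smaller degree.
    set a := h.coeff m with ha
    have hwa : Ge (c - |C₀|) (w (algebraMap K L a)) := by
      by_cases ha0 : a = 0
      · rw [ha0, map_zero, AddValuation.map_zero]; exact le_top
      have hhd : h.natDegree = m := by
        refine le_antisymm ?_ (le_natDegree_of_ne_zero ha0)
        have h0 : h ≠ 0 := by
          rintro rfl
          exact ha0 (coeff_zero m)
        exact Nat.lt_succ_iff.1 ((natDegree_lt_iff_degree_lt h0).2 hd)
      have hmon : (C a⁻¹ * h).Monic := by
        rw [Monic, leadingCoeff_mul, leadingCoeff_C, leadingCoeff, hhd]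
        exact inv_mul_cancel₀ ha0
      have h1 : val w x h = val w x (C a⁻¹ * h) + w (algebraMap K L a) := by
        conv_lhs => rw [show h = (C a⁻¹ * h) * C a by
          rw [mul_comm, ← mul_assoc, ← C_mul, mul_inv_cancel₀ ha0, C_1, one_mul]]
        rw [val_mul]
        congr 1
        rw [val, aeval_C]
      have h2 := hB _ hmon (by
        rw [degree_C_mul (inv_ne_zero ha0)]
        exact lt_of_le_of_lt (degree_le_natDegree.trans_eq (by rw [hhd])) hmP)
      rw [h1] at hc
      have h3 : Ge c (w (algebraMap K L a) + (C₀ : WithTop ℝ)) := by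
        rw [add_comm]
        exact hc.trans (add_le_add_left h2 _)
      exact (ge_add_iff.1 h3).anti (by linarith [le_abs_self C₀])
    set g := h - C a * X ^ m with hg
    have hgd : g.degree < (m : WithBot ℕ) := by
      rw [degree_lt_iff_coeff_zero]
      intro k hk
      rw [hg, coeff_sub, coeff_C_mul, coeff_X_pow]
      rcases eq_or_lt_of_le hk with rfl | hlt
      · simp [ha]
      · rw [if_neg hlt.ne', mul_zero, sub_zero]
        exact (degree_lt_iff_coeff_zero _ _).1 hd k hlt
    have hmξ : ∀ i : ℕ, i ≤ m → (m : ℝ) * ξ ≤ i * ξ := fun i hi => by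
      have : (i : ℝ) ≤ m := by exact_mod_cast hi
      nlinarith
    have hgv : Ge (c - |C₀| + m * ξ) (val w x g) := by
      rw [hg, val, map_sub]
      refine isCut_ge.map_sub (hc.anti ?_) ?_
      · have := hmξ 0 (Nat.zero_le m)
        push_cast at this
        linarith [abs_nonneg C₀]
      · rw [map_mul, aeval_C, map_pow, aeval_X]
        exact isCut_ge.map_mul hwa (hξ.map_pow m)
    have h1 := hC' g hgd _ hgv
    have h2 : h = g + C a * X ^ m := by rw [hg, sub_add_cancel]
    rw [h2, derivative_add, derivative_C_mul_X_pow, val, map_add]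
    refine isCut_ge.map_add (h1.anti ?_) ?_
    · linarith [le_abs_self C']
    · rw [C_mul, map_mul (aeval x), map_mul (aeval x), aeval_C, aeval_C, map_natCast, map_pow, aeval_X]
      have h3 := isCut_ge.map_mul (isCut_ge.map_mul hwa (nonneg_map_natCast (v := w) m))
        (hξ.map_pow (m - 1))
      refine h3.anti ?_
      have := hmξ (m - 1) (Nat.sub_le m 1)
      linarith [abs_nonneg C']

/-- If the values of monic polynomials of a fixed degree tend to infinity, the simple root `x` of
its minimal polynomial is approximated, and the Newton polygon has a side of length one. -/
theorem eventually_delta_eq_one [FiniteDimensional K L] [Algebra.IsSeparable K L]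
    {R : ℕ → K[X]} {κ C₀ : ℝ} (hR : ∀ t, (R t).Monic) (hd : ∀ t, (R t).degree = (R 0).degree)
    (h1 : 1 ≤ (R 0).natDegree)
    (hB : ∀ h : K[X], h.Monic → h.degree < (R 0).degree → val w x h ≤ (C₀ : WithTop ℝ))
    (hκ : val w x (R 0) = κ) (hC : Carry w x Ge (R 0) κ) (hne : ∀ t, aeval x (R t) ≠ 0)
    (hlim : ∀ M : ℝ, ∀ᶠ t in Filter.atTop, Gt M (val w x (R t))) :
    ∀ᶠ t in Filter.atTop, delta w x (R t) (minpoly K x) = 1 := by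
  classical
  set f := minpoly K x with hf
  have hx : aeval x f = 0 := minpoly.aeval K x
  obtain ⟨C', hC'⟩ := exists_ge_val_derivative hB (R 0).natDegree
    (degree_eq_natDegree (hR 0).ne_zero).ge
  rw [← degree_eq_natDegree (hR 0).ne_zero] at hC'
  obtain ⟨μ, hμ⟩ := exists_forall_ge (fun k => val w x (coeffAt (R 0) f k)) κ (f.natDegree + 1)
  have hU : InU w x Ge (R 0) κ μ f := fun k => by
    rcases lt_or_ge k (f.natDegree + 1) with hk | hk
    · exact hμ k hk
    · rw [coeffAt_eq_zero (hR 0) (by nlinarith), val, map_zero, AddValuation.map_zero]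
      exact le_top
  obtain ⟨r₀, hr₀⟩ := exists_ge (val w x (derivative (R 0)))
  -- A lower bound for the value of the derivative of every late `R t`: the difference to `R 0` is a
  -- digit of value at least κ, so its derivative has value at least κ - C'.
  set r := min r₀ (κ - C') with hr
  -- Separability enters here: f'(x) ≠ 0.
  obtain ⟨F, hF⟩ := WithTop.ne_top_iff_exists.1 (fun h =>
    (Algebra.IsSeparable.isSeparable K x).aeval_derivative_ne_zero (minpoly.aeval K x)
      ((AddValuation.top_iff w).1 h) : w (aeval x (derivative f)) ≠ ⊤)
  -- The first threshold keeps R t - R 0 at value at least κ and makes powers of R t gain. The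
  -- second puts the terms with derivatives of coefficients above F. The third does so for the terms
  -- of index k ≥ 2 with the derivative of R t, and also settles the final comparison.
  filter_upwards [hlim κ, hlim (F - μ + κ + C'), hlim (F - μ + 2 * κ - r)] with t ht1 ht2 ht3
  obtain ⟨β, hβ⟩ := WithTop.ne_top_iff_exists.1
    (fun h => hne t ((AddValuation.top_iff w).1 h) : w (aeval x (R t)) ≠ ⊤)
  have hPβ : val w x (R t) = β := hβ.symm
  rw [hPβ] at ht1 ht2 ht3
  replace ht1 := WithTop.coe_lt_coe.1 ht1
  replace ht2 := WithTop.coe_lt_coe.1 ht2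
  replace ht3 := WithTop.coe_lt_coe.1 ht3
  have hP := hR t
  have hP1 : 1 ≤ (R t).natDegree := by rwa [natDegree_eq_of_degree_eq (hd t)]
  have hy : Ge κ (val w x (R t - R 0)) := by
    rw [val, map_sub]
    exact isCut_ge.map_sub ((WithTop.coe_le_coe.2 ht1.le).trans hPβ.ge) hκ.ge
  have hyd : (R t - R 0).degree < (R 0).degree := by
    rw [← hd t]
    exact degree_sub_lt_left (hd t) hP.ne_zero (by rw [hP.leadingCoeff, (hR 0).leadingCoeff])
  have hCt : Carry w x Ge (R t) κ := by
    have := hC.add_right isCut_ge (hR 0) h1 hyd hy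
    rwa [add_sub_cancel] at this
  have hUt : InU w x Ge (R t) κ μ f :=
    hU.change (hR 0) hP (hd t).symm hP1 hCt le_rfl
      (hPβ ▸ WithTop.coe_le_coe.2 ht1.le) le_rfl hy
  have hR' : Ge r (val w x (derivative (R t))) := by
    have h2 := hC' _ hyd κ hy
    rw [show R t = R 0 + (R t - R 0) by ring, derivative_add, val, map_add]
    exact isCut_ge.map_add (hr₀.anti (min_le_left _ _)) (h2.anti (min_le_right _ _))
  set P := R t with hPdef
  set N := f.natDegree + 1 with hN
  have hρ : ∀ k : ℕ, Ge (k * β) (w (aeval x P ^ k)) := fun k => Ge.map_pow hβ.le k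
  have hkey : ∀ k : ℕ, 1 ≤ k → β - κ ≤ k * (β - κ) := fun k hk => by
    have : (1 : ℝ) ≤ k := by exact_mod_cast hk
    nlinarith
  have hsum := eq_sum_coeffAt hP f N (by nlinarith)
  have hder : aeval x (derivative f) =
      ∑ k ∈ Finset.range N, (aeval x (derivative (coeffAt P f k)) * aeval x P ^ k +
        aeval x (coeffAt P f k) * (k * aeval x P ^ (k - 1) * aeval x (derivative P))) := by
    conv_lhs => rw [hsum]
    rw [derivative_sum, map_sum]
    refine Finset.sum_congr rfl fun k _ => ?_
    simp only [derivative_mul, derivative_pow, map_add, map_mul, map_pow, map_natCast]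
  -- The constant coefficient is minus the sum of the other terms, because f(x) = 0; hence it is as
  -- large as a term containing a factor P.
  have hzero : Ge (μ + β - κ) (val w x (coeffAt P f 0)) := by
    have h0 : (0 : ℕ) ∈ Finset.range N := by simp [hN]
    have h2 : ∑ k ∈ Finset.range N, aeval x (coeffAt P f k * P ^ k) = 0 := by
      rw [← map_sum, ← hsum, hx]
    rw [← Finset.add_sum_erase _ _ h0, pow_zero, mul_one] at h2
    rw [val, ← neg_eq_of_add_eq_zero_left h2, AddValuation.map_neg]
    refine isCut_ge.map_sum _ _ fun k hk => ?_
    have hk1 := hkey k (Nat.one_le_iff_ne_zero.2 (Finset.ne_of_mem_erase hk))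
    rw [map_mul, map_pow]
    exact (isCut_ge.map_mul (hUt k) (hρ k)).anti (by linarith)
  have hT : ∀ k, Gt F (w (aeval x (derivative (coeffAt P f k)) * aeval x P ^ k)) := fun k => by
    have hcd : (coeffAt P f k).degree < (R 0).degree := by
      rw [← hd t]; exact degree_coeffAt_lt hP f k
    rcases Nat.eq_zero_or_pos k with rfl | hk
    · rw [pow_zero, mul_one]
      exact lt_of_lt_of_le (WithTop.coe_lt_coe.2 (by linarith)) (hC' _ hcd _ hzero)
    · have hk1 := hkey k hk
      exact lt_of_lt_of_le (WithTop.coe_lt_coe.2 (by linarith))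
        (isCut_ge.map_mul (hC' _ hcd _ (hUt k)) (hρ k))
  have hS : ∀ k, k ≠ 1 → Gt F (w (aeval x (coeffAt P f k) *
      (k * aeval x P ^ (k - 1) * aeval x (derivative P)))) := fun k hk => by
    rcases Nat.eq_zero_or_pos k with rfl | hk0
    · rw [Nat.cast_zero, zero_mul, zero_mul, mul_zero, AddValuation.map_zero]
      exact WithTop.coe_lt_top F
    · have hk1 := hkey (k - 1) (by omega)
      have h2 := isCut_ge.map_mul (hUt k) (isCut_ge.map_mul (isCut_ge.map_mul
        (nonneg_map_natCast (v := w) k) (hρ (k - 1))) hR')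
      refine lt_of_lt_of_le (WithTop.coe_lt_coe.2 ?_) h2
      rw [Nat.cast_sub hk0, Nat.cast_one] at *
      linarith
  -- All other terms of f'(x) exceed F, so this one has value F. Hence the value of the coefficient
  -- of index 1 is at most F - r, independently of t.
  have hone : w (aeval x (coeffAt P f 1) * aeval x (derivative P)) = F := by
    have hmem : 1 ∈ Finset.range N := by
      have := minpoly.natDegree_pos (Algebra.IsIntegral.isIntegral (R := K) x)
      exact Finset.mem_range.2 (Nat.succ_lt_succ this)
    rw [Finset.sum_add_distrib, ← Finset.add_sum_erase _ (fun k => aeval x (coeffAt P f k) *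
      (k * aeval x P ^ (k - 1) * aeval x (derivative P))) hmem, Nat.cast_one, Nat.sub_self,
      pow_zero, one_mul, one_mul, add_left_comm] at hder
    have hrest : Gt F (w (∑ k ∈ Finset.range N,
        aeval x (derivative (coeffAt P f k)) * aeval x P ^ k +
        ∑ k ∈ (Finset.range N).erase 1, aeval x (coeffAt P f k) *
          (k * aeval x P ^ (k - 1) * aeval x (derivative P)))) :=
      isCut_gt.map_add (isCut_gt.map_sum _ _ fun k _ => hT k)
        (isCut_gt.map_sum _ _ fun k hk => hS k (Finset.ne_of_mem_erase hk))
    rw [eq_sub_of_add_eq hder.symm, AddValuation.map_sub_eq_of_lt_left w (by rw [← hF]; exact hrest)]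
    exact hF.symm
  rw [AddValuation.map_mul] at hone
  have hfin := (WithTop.add_ne_top.1 (hone.trans_ne WithTop.coe_ne_top))
  obtain ⟨d, hdv⟩ := WithTop.ne_top_iff_exists.1 hfin.1
  obtain ⟨r', hr'⟩ := WithTop.ne_top_iff_exists.1 hfin.2
  have hdF : d ≤ F - r := by
    rw [← hdv, ← hr', ← WithTop.coe_add] at hone
    have h2 := WithTop.coe_injective hone
    have h3 : r ≤ r' := by
      rw [val, ← hr'] at hR'
      exact WithTop.coe_le_coe.1 hR'
    linarith
  -- For k ≥ 2 the k-th term is at least μ + k (β - κ), which by the third threshold exceeds F - r +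
  -- β, a bound for the first term.
  have hle : ∀ k ∈ sideSet w x P f (β : WithTop ℝ), k ≤ 1 := by
    intro k hk
    by_contra! hk2
    have h2 := (Finset.mem_filter.1 hk).2 1
    have h3 : Ge (μ - k * κ + k * β) (termVal w x P f β k) := by
      refine isCut_ge.add (hUt k) ?_
      rw [← WithTop.coe_nsmul, nsmul_eq_mul]
    have h4 : termVal w x P f β 1 = ((d + β : ℝ) : WithTop ℝ) := by
      rw [termVal, one_nsmul, val, ← hdv, WithTop.coe_add]
    rw [h4] at h2
    have h5 := WithTop.coe_le_coe.1 (h3.trans h2)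
    have h6 : (2 : ℝ) ≤ k := by exact_mod_cast hk2
    nlinarith
  obtain ⟨i, j, hij, -, -, -, -, -, hj⟩ := exists_two_minimal hP hP1 hx hPβ
    ⟨1, by rw [val, ← hdv]; exact WithTop.coe_ne_top⟩
  have hj1 := hle j hj
  rw [delta, hPβ]
  refine le_antisymm (Finset.sup_le hle) ?_
  rw [show (1 : ℕ) = id j by simp only [id]; omega]
  exact Finset.le_sup hj

end Limit

/-! ### Infinite sequences of key polynomials -/

section Sequences

variable {K L Γ : Type*} [Field K] [Field L] [Algebra K L] [FiniteDimensional K L]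
  [AddCommGroup Γ] [LinearOrder Γ] [IsOrderedAddMonoid Γ]
  {φ : Γ →+ ℝ} {hφ : StrictMono φ} {v : AddValuation L (WithTop Γ)} {x : L}
  {Q : Ordinal.{0} → K[X]} {α : Ordinal.{0} → ℕ} {l : Ordinal.{0}}

theorem invariant_of_isStage (H : IsStage v x Q α l) : Invariant φ hφ v x Q α l := by
  obtain ⟨hX, -, H⟩ := H
  induction H with
  | refl => exact Invariant.base hX
  | tail _ h ih => exact ih.step h

/-- f is monic with value ∞, so its degree cannot lie in the range where `bdd` bounds the values. -/
theorem Invariant.natDegree_le (I : Invariant φ hφ v x Q α l) :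
    (Q l).natDegree ≤ (minpoly K x).natDegree := by
  have hf := minpoly.monic (Algebra.IsIntegral.isIntegral (R := K) x)
  by_contra! hlt
  obtain ⟨C, hC⟩ := I.bdd
  have h1 := hC _ hf (degree_lt_degree hlt)
  rw [val, minpoly.aeval, AddValuation.map_zero] at h1
  exact absurd h1 (not_le.2 (WithTop.coe_lt_top C))

/-- The multiples of |γ| are cofinal in ℝ. Convergence to infinity in Γ thus gives convergence to
infinity in ℝ, which uses that the valuation is non-trivial. -/
theorem exists_le_map {γ : Γ} (hγ : γ ≠ 0) (hφ : StrictMono φ) (M : ℝ) :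
    ∃ γ' : Γ, M ≤ φ γ' := by
  have h0 : 0 < φ |γ| := by
    rw [← map_zero φ]; exact hφ (abs_pos.2 hγ)
  obtain ⟨n, hn⟩ := Archimedean.arch M h0
  exact ⟨n • |γ|, by rwa [map_nsmul]⟩

theorem eventually_add_natCast {p : Ordinal.{0} → Prop} (l : Ordinal.{0}) (a : ℕ) :
    (∀ᶠ t : ℕ in Filter.atTop, p (l + (a : Ordinal.{0}) + (t : Ordinal.{0}))) ↔
      ∀ᶠ t : ℕ in Filter.atTop, p (l + (t : Ordinal.{0})) := by
  rw [Filter.eventually_atTop, Filter.eventually_atTop]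
  constructor
  · rintro ⟨N, hN⟩
    refine ⟨a + N, fun t ht => ?_⟩
    have := hN (t - a) (by omega)
    rwa [add_assoc, ← Nat.cast_add, Nat.add_sub_cancel' (by omega)] at this
  · rintro ⟨N, hN⟩
    refine ⟨N, fun t ht => ?_⟩
    rw [add_assoc, ← Nat.cast_add]
    exact hN _ (by omega)

/-- The key polynomials of an infinite sequence have eventually the same degree. -/
theorem exists_degree_eq (H : IsInfiniteSequence v x Q α l) :
    ∃ (l₀ : Ordinal.{0}) (a b : ℕ), l = l₀ + (a : Ordinal.{0}) ∧
      Invariant φ hφ v x Q α (l₀ + (b : Ordinal.{0})) ∧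
      ∀ t : ℕ, (Q (l₀ + (b : Ordinal.{0}) + (t : Ordinal.{0}))).Monic ∧
        (Q (l₀ + (b : Ordinal.{0}) + (t : Ordinal.{0}))).degree =
          (Q (l₀ + (b : Ordinal.{0}))).degree ∧
        aeval x (Q (l₀ + (b : Ordinal.{0}) + (t : Ordinal.{0}))) ≠ 0 := by
  obtain ⟨l₀, hl, hl', hstage, hne, H⟩ := H
  obtain ⟨a, rfl⟩ := exists_eq_add_natCast hl hl'
  have I₀ : Invariant φ hφ v x Q α l₀ := invariant_of_isStage hstage
  refine ⟨l₀, a, ?_⟩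
  rcases H with ⟨-, -, -, z, hT, -, hF⟩ | ⟨s, hs, hs0, hstep⟩
  · have hzd : ∀ j, (z j).degree < (Q l₀).degree := fun j => by
      obtain ⟨c, hc, hz⟩ := (hT (j + 1)).1 j (Nat.lt_succ_self j)
      rw [hz]
      exact I₀.degrees.degree_expansion_lt hc.1.1
    refine ⟨0, rfl, by simpa using I₀, fun t => ?_⟩
    rw [Nat.cast_zero, add_zero]
    have := I₀.add_natCast_degrees (s := t) (fun j _ => hzd j) fun i _ => hF i
    exact ⟨this.2.1, this.2.2.1, hne t⟩
  · have I : ∀ k, Invariant φ hφ v x Q α (l₀ + (s k : Ordinal.{0})) := fun k => by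
      induction k with
      | zero => rw [hs0]; simpa using I₀
      | succ k ih => exact ih.step (hstep k)
    set D : ℕ → ℕ := fun k => (Q (l₀ + (s k : Ordinal.{0}))).natDegree
    have hbdd : BddAbove (Set.range D) := by
      refine ⟨(minpoly K x).natDegree, ?_⟩
      rintro _ ⟨k, rfl⟩
      exact (I k).natDegree_le
    -- The degrees are non-decreasing and bounded by deg f. From the stage where the maximum is
    -- attained they are constant, also at the indices between consecutive stages, as each of these
    -- lies below a later stage.
    obtain ⟨k₀, hk₀⟩ := Nat.sSup_mem (Set.range_nonempty D) hbdd
    have hmax : ∀ k, D k ≤ D k₀ := fun k => by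
      rw [hk₀]; exact le_csSup hbdd ⟨k, rfl⟩
    refine ⟨s k₀, rfl, I k₀, fun t => ?_⟩
    have hle : s k₀ + t ≤ s (s k₀ + t) := hs.le_apply
    have h1 : l₀ + ((s k₀ + t : ℕ) : Ordinal.{0}) ≤ l₀ + (s (s k₀ + t) : Ordinal.{0}) := by
      rw [add_le_add_iff_left]
      exact_mod_cast hle
    rw [Nat.cast_add, ← add_assoc] at h1
    have h2 : l₀ + (s k₀ : Ordinal.{0}) ≤ l₀ + (s k₀ : Ordinal.{0}) + (t : Ordinal.{0}) :=
      le_add_right le_rfl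
    have Dg := (I (s k₀ + t)).degrees
    have h3 := (I k₀).degrees.one_le
    have hm := Dg.monic _ (h3.trans h2) h1
    refine ⟨hm, ?_, ?_⟩
    · rw [degree_eq_natDegree hm.ne_zero, degree_eq_natDegree (I k₀).monic.ne_zero]
      have h4 := Dg.mono _ _ h3 h2 h1
      have h5 := (Dg.mono _ _ (h3.trans h2) h1 le_rfl).trans (hmax _)
      exact congrArg _ (le_antisymm h5 h4)
    · rw [add_assoc, ← Nat.cast_add]
      exact hne _

/-- Infinite sequences of key polynomials whose values are unbounded. -/
theorem eventually_delta_eq_one_of_isInfiniteSequence [Algebra.IsSeparable K L] [Archimedean Γ]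
    {γ₀ : Γ} (hγ₀ : γ₀ ≠ 0) (H : IsInfiniteSequence v x Q α l)
    (hlim : ∀ γ : Γ, ∀ᶠ t : ℕ in Filter.atTop,
      (γ : WithTop Γ) < v (aeval x (Q (l + (t : Ordinal.{0}))))) :
    ∀ᶠ t : ℕ in Filter.atTop, delta v x (Q (l + (t : Ordinal.{0}))) (minpoly K x) = 1 := by
  -- Hölder's embedding theorem provides the real values used in the estimates.
  obtain ⟨ψ, hψ⟩ := Archimedean.exists_orderAddMonoidHom_real_injective Γ
  set φ : Γ →+ ℝ := ψ.toAddMonoidHom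
  have hφ : StrictMono φ := ψ.monotone'.strictMono_of_injective hψ
  obtain ⟨l₀, a, b, rfl, I, hQ⟩ := exists_degree_eq (φ := φ) (hφ := hφ) H
  rw [eventually_add_natCast (p := fun i => delta v x (Q i) (minpoly K x) = 1),
    ← eventually_add_natCast (p := fun i => delta v x (Q i) (minpoly K x) = 1) l₀ b]
  replace hlim : ∀ γ : Γ, ∀ᶠ t : ℕ in Filter.atTop,
      (γ : WithTop Γ) < v (aeval x (Q (l₀ + (b : Ordinal.{0}) + (t : Ordinal.{0})))) := fun γ =>
    (eventually_add_natCast (p := fun i => (γ : WithTop Γ) < v (aeval x (Q i))) l₀ b).2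
      ((eventually_add_natCast (p := fun i => (γ : WithTop Γ) < v (aeval x (Q i))) l₀ a).1
        (hlim γ))
  set m := l₀ + (b : Ordinal.{0})
  have hm0 : m + ((0 : ℕ) : Ordinal.{0}) = m := by simp
  have hne : aeval x (Q m) ≠ 0 := by simpa using (hQ 0).2.2
  obtain ⟨β, hβ⟩ := WithTop.ne_top_iff_exists.1
    (fun h => hne ((AddValuation.top_iff v).1 h) : v (aeval x (Q m)) ≠ ⊤)
  have hκ : val (realVal φ hφ v) x (Q m) = (φ β : ℝ) := realVal_of_eq hβ.symm
  obtain ⟨C, hC⟩ := I.bdd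
  have key := eventually_delta_eq_one (w := realVal φ hφ v) (x := x) (C₀ := C) (κ := φ β)
    (R := fun t : ℕ => Q (m + (t : Ordinal.{0}))) (fun t => (hQ t).1)
    (fun t => by rw [hm0]; exact (hQ t).2.1) (by rw [hm0]; exact I.one_le_natDegree)
    (by rw [hm0]; exact hC) (by rw [hm0]; exact hκ) (by rw [hm0]; exact (I.carry _ hκ).ge)
    (fun t => (hQ t).2.2) fun M => by
      obtain ⟨γ', hγ'⟩ := exists_le_map hγ₀ hφ M
      filter_upwards [hlim γ'] with t ht
      exact lt_of_le_of_lt (WithTop.coe_le_coe.2 hγ') (gt_realVal_iff (hφ := hφ).2 ht)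
  simpa only [delta_realVal] using key

end Sequences

end

end KeyPoly

theorem mainTheorem3 {K L Γ : Type*} [Field K] [Field L] [Algebra K L]
    [FiniteDimensional K L] [Algebra.IsSeparable K L]
    [AddCommGroup Γ] [LinearOrder Γ] [IsOrderedAddMonoid Γ] [Archimedean Γ] [Module ℚ Γ]
    (ν : AddValuation K (WithTop Γ)) (hν : ∃ a : K, a ≠ 0 ∧ ν a ≠ 0)
    (ν' : AddValuation L (WithTop Γ)) (hext : ∀ a : K, ν' (algebraMap K L a) = ν a)
    (x : L) (hx : Algebra.adjoin K {x} = ⊤)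
    (hnorm : ∀ i < (minpoly K x).natDegree, 0 < ν ((minpoly K x).coeff i))
    (Q : Ordinal.{0} → Polynomial K) (α : Ordinal.{0} → ℕ) (l : Ordinal.{0})
    (hseq : KeyPoly.IsInfiniteSequence ν' x Q α l)
    (hlim : ∀ γ : Γ, ∀ᶠ t : ℕ in Filter.atTop,
      (γ : WithTop Γ) < ν' (Polynomial.aeval x (Q (l + (t : Ordinal.{0}))))) :
    ∃ e : ℕ, ∀ᶠ t : ℕ in Filter.atTop,
      KeyPoly.delta ν' x (Q (l + (t : Ordinal.{0}))) (minpoly K x) = ringExpChar K ^ e := by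
  obtain ⟨a, ha, hνa⟩ := hν
  have hne : ν a ≠ ⊤ := fun h => ha ((AddValuation.top_iff ν).1 h)
  obtain ⟨γ₀, hγ₀⟩ := WithTop.ne_top_iff_exists.1 hne
  -- Separability gives the stable value 1 = p^0 in every characteristic.
  refine ⟨0, ?_⟩
  rw [pow_zero]
  refine KeyPoly.eventually_delta_eq_one_of_isInfiniteSequence (γ₀ := γ₀) ?_ hseq hlim
  rintro rfl
  exact hνa hγ₀.symm
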